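/- Consider finite simplicial complexes $\Delta$ of dimension two with underlying topological space $|\Delta|$. Such a $\Delta$ is a triangulation of the orientable surface $M_4$ of genus $4$ if $|\Delta|$ is a closed connected surface (a compact connected $2$-manifold without boundary) that is orientable and has Euler characteristic $f_0-f_1+f_2=-6$, where $f_k$ is the number of $k$-dimensional faces of $\Delta$. It is vertex-minimal if no triangulation of $M_4$ has fewer vertices. A polyhedral embedding of $\Delta$ in $\mathbb R^3$ is an injective map $\phi:|\Delta|\to\mathbb R^3$ that is linear on each simplex, and thus determined by the positions of the vertices. It has $2$-fold rotational symmetry if there are a rotation $R$ of $\mathbb R^3$ by the angle $\pi$ about some line and a simplicial automorphism $\sigma$ of $\Delta$ with $R(\phi(|\Delta|))=\phi(|\Delta|)$ and $R\circ\phi=\phi\circ|\sigma|$, where $|\sigma|:|\Delta|\to|\Delta|$ is the map induced by $\sigma$. Theorem. There are at least $28$ pairwise non-isomorphic vertex-minimal triangulations of $M_4$ with $11$ vertices, each of which has a polyhedral embedding in $\mathbb R^3$ with $2$-fold rotational symmetry. -/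

import Mathlib

open scoped BigOperators

noncomputable section

namespace TriangulatedSurface

/-- Euclidean three-space. -/
abbrev E3 : Type := EuclideanSpace ℝ (Fin 3)

/-- A closed surface in the sense of a compact connected `2`-manifold: a compact connected Hausdorff
space that is locally homeomorphic to the Euclidean plane. -/
structure IsClosedConnectedSurface (X : Type*) [TopologicalSpace X] : Prop where
  compact : CompactSpace X
  hausdorff : T2Space X
  connected : ConnectedSpace X
  locally_plane : ∀ x : X,
    ∃ e : OpenPartialHomeomorph X (EuclideanSpace ℝ (Fin 2)), x ∈ e.source

section Complex

variable {V : Type*}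

/-- The underlying topological space `|K|` of a finite simplicial complex, in barycentric
coordinates: all convex weights on the vertex set that are supported on some face of `K`. It carries
the topology induced from `V → ℝ`. -/
def polyhedron [Fintype V] (K : AbstractSimplicialComplex V) : Set (V → ℝ) :=
  {x | x ∈ stdSimplex ℝ V ∧ ∃ s ∈ K.faces, ∀ v, v ∉ s → x v = 0}

/-- `K` is two-dimensional: every face has at most three vertices and some face has three. -/
def IsTwoDimensional (K : AbstractSimplicialComplex V) : Prop :=
  (∀ s ∈ K.faces, s.card ≤ 3) ∧ ∃ s ∈ K.faces, s.card = 3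

/-- The number of `k`-dimensional faces (faces with `k + 1` vertices). -/
def faceCount (K : AbstractSimplicialComplex V) (k : ℕ) : ℕ :=
  Set.ncard {s : Finset V | s ∈ K.faces ∧ s.card = k + 1}

/-- The Euler characteristic `f₀ - f₁ + f₂` of a two-dimensional complex. -/
def eulerChar (K : AbstractSimplicialComplex V) : ℤ :=
  (faceCount K 0 : ℤ) - (faceCount K 1 : ℤ) + (faceCount K 2 : ℤ)

/-- A coherent orientation of the triangles of `K`: for every triangle one of its two cyclic
orderings is chosen (`O` is the set of all triples that list the vertices of a triangle in its
chosen cyclic order), such that no two triangles induce the same direction on a common edge. -/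
structure IsCoherentOrientation [DecidableEq V] (K : AbstractSimplicialComplex V)
    (O : Set (V × V × V)) : Prop where
  triangle : ∀ a b c, (a, b, c) ∈ O →
    a ≠ b ∧ b ≠ c ∧ a ≠ c ∧ ({a, b, c} : Finset V) ∈ K.faces
  cyclic : ∀ a b c, (a, b, c) ∈ O → (b, c, a) ∈ O
  choice : ∀ a b c, a ≠ b → b ≠ c → a ≠ c → ({a, b, c} : Finset V) ∈ K.faces →
    ((a, b, c) ∈ O ↔ (b, a, c) ∉ O)
  coherent : ∀ a b c d, (a, b, c) ∈ O → (a, b, d) ∈ O → c = d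

/-- `K` is a triangulation of the orientable surface of genus `g`: it is a two-dimensional simplicial
complex whose underlying space is a closed connected surface, and this surface is orientable and has
Euler characteristic `2 - 2 g`. -/
structure IsOrientableTriangulation [Fintype V] [DecidableEq V]
    (K : AbstractSimplicialComplex V) (g : ℕ) : Prop where
  two_dimensional : IsTwoDimensional K
  surface : IsClosedConnectedSurface (polyhedron K)
  orientable : ∃ O : Set (V × V × V), IsCoherentOrientation K O
  genus : eulerChar K = 2 - 2 * (g : ℤ)

/-- `K` is a triangulation of the orientable surface of genus `g`, and no triangulation of that
surface has fewer vertices. (All elements of the vertex type are vertices of the complex.) -/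
def IsVertexMinimalTriangulation [Fintype V] [DecidableEq V]
    (K : AbstractSimplicialComplex V) (g : ℕ) : Prop :=
  IsOrientableTriangulation K g ∧
    ∀ (m : ℕ) (L : AbstractSimplicialComplex (Fin m)),
      IsOrientableTriangulation L g → Fintype.card V ≤ m

/-- The bijection `e` of the vertex sets is an isomorphism of simplicial complexes. -/
def IsIsomorphism {W : Type*} (K : AbstractSimplicialComplex V) (L : AbstractSimplicialComplex W)
    (e : V ≃ W) : Prop :=
  ∀ s : Finset V, s ∈ K.faces ↔ s.map e.toEmbedding ∈ L.faces

/-- Combinatorial isomorphism of simplicial complexes. -/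
def Isomorphic {W : Type*} (K : AbstractSimplicialComplex V) (L : AbstractSimplicialComplex W) :
    Prop :=
  ∃ e : V ≃ W, IsIsomorphism K L e

/-- The simplexwise linear map induced by the vertex positions `ψ`. -/
def simplexwiseLinear [Fintype V] (ψ : V → E3) (x : V → ℝ) : E3 :=
  ∑ v, x v • ψ v

/-- The vertex positions `ψ` give a polyhedral embedding of `K` in three-space: the induced
simplexwise linear map on `|K|` is injective. -/
def IsPolyhedralEmbedding [Fintype V] (K : AbstractSimplicialComplex V) (ψ : V → E3) : Prop :=
  Set.InjOn (simplexwiseLinear ψ) (polyhedron K)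

/-- A rotation by the angle `π` about a line of three-space. This is the map that fixes the line
pointwise and is `-1` on the directions orthogonal to it, which Mathlib calls the reflection in
that line. -/
def IsHalfTurn (R : E3 ≃ᵃⁱ[ℝ] E3) : Prop :=
  ∃ (ℓ : AffineSubspace ℝ E3) (_ : Nonempty ℓ),
    Module.finrank ℝ ℓ.direction = 1 ∧ R = EuclideanGeometry.reflection ℓ

/-- The isometry `R` is a geometric symmetry of the realization of `K` given by `ψ`: it maps the
image of `|K|` onto itself, and there it is induced by a simplicial automorphism `σ` of `K`, acting
on `|K|` by `x ↦ x ∘ σ⁻¹`. -/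
def IsGeometricSymmetry [Fintype V] (K : AbstractSimplicialComplex V) (ψ : V → E3)
    (R : E3 ≃ᵃⁱ[ℝ] E3) : Prop :=
  R '' (simplexwiseLinear ψ '' polyhedron K) = simplexwiseLinear ψ '' polyhedron K ∧
    ∃ σ : Equiv.Perm V, IsIsomorphism K K σ ∧
      ∀ x ∈ polyhedron K, R (simplexwiseLinear ψ x) = simplexwiseLinear ψ (fun v => x (σ.symm v))

end Complex

end TriangulatedSurface

end

/-!
Let every vertex carry a cyclically ordered link, so that the resulting triangles are oriented
coherently. The open star of a vertex of degree `k` is homeomorphic to an open regular `k`-gon,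
through the fan of its `k` sectors, so the triangles form an oriented closed surface.

Conversely, in a triangulated surface every edge lies in at least two triangles: otherwise its star
without an interior point of the edge could be deformed into a discrete set, contradicting the
winding number of a small loop around that point in a chart. Thus `2 f₁ ≤ 3 f₂`, and with
`f₀ - f₁ + f₂ = -6` this gives `3 (f₀ + 6) ≤ f₁ ≤ f₀ (f₀ - 1) / 2`, which forces `11 ≤ f₀`.

A simplexwise linear map is injective if every two triangles meet only in their common face. For
integer coordinates there are finite certificates: the two triangles lie in a nondegenerate
tetrahedron, or an integer vector separates them. The surfaces are told apart by an isomorphism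
invariant, which arises from the constant labelling of the vertices by repeatedly summing the
products of labels over the triangles at every vertex.
-/

noncomputable section

namespace TriangulatedSurface

section PuncturedPlane

variable {X : Type*} [TopologicalSpace X]

theorem exists_log_of_homotopic {f g : C(X, {z : ℂ // z ≠ 0})} (hf : IsLocallyConstant f)
    (h : f.Homotopic g) : ∃ L : C(X, ℂ), ∀ x, Complex.exp (L x) = g x := by
  obtain ⟨H⟩ := h
  let L₀ : C(X, ℂ) :=
    ⟨fun x => Complex.log (f x), (hf.comp fun z => Complex.log z.1).continuous⟩
  have hL₀ : ∀ x, H (0, x) = (⟨_, Complex.exp_ne_zero (L₀ x)⟩ : {z : ℂ // z ≠ 0}) := fun x => by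
    rw [H.apply_zero]
    exact Subtype.ext (Complex.exp_log (f x).2).symm
  let L := Complex.isCoveringMap_exp.liftHomotopy H.toContinuousMap L₀ hL₀
  have hL : ∀ x, Complex.exp (L (1, x)) = H (1, x) := fun x => congrArg Subtype.val <|
    congrFun (Complex.isCoveringMap_exp.liftHomotopy_lifts H.toContinuousMap L₀ hL₀) (1, x)
  refine ⟨L.comp ⟨fun x => (1, x), by fun_prop⟩, fun x => ?_⟩
  rw [← H.apply_one x]
  exact hL x

theorem log_circle_two_pi {L : ℝ → ℂ} (hL : Continuous L) {c : ℂ}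
    (h : ∀ t : ℝ, Complex.exp (L t) = c * Complex.exp (t * Complex.I)) :
    L (2 * Real.pi) = L 0 + 2 * Real.pi * Complex.I := by
  have hexp : ∀ t : ℝ, Complex.exp (L t - t * Complex.I) = c := fun t => by
    rw [Complex.exp_sub, h, mul_div_cancel_right₀ _ (Complex.exp_ne_zero _)]
  have hconst := Complex.isCoveringMap_exp.const_of_comp
    (show Continuous fun t : ℝ => L t - t * Complex.I by fun_prop)
    (fun a b => Subtype.ext ((hexp a).trans (hexp b).symm)) (2 * Real.pi) 0
  push_cast at hconst
  linear_combination hconst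

theorem exists_loop_in_chart {x₀ : X} (φ : OpenPartialHomeomorph X ℂ) {N : Set X}
    (hN : IsOpen N) (hx₀ : x₀ ∈ N) (hNφ : N ⊆ φ.source) :
    ∃ (r : ℝ) (γ : C(ℝ, ↥(N \ {x₀}))), γ (2 * Real.pi) = γ 0 ∧
      ∀ t, φ (γ t) = circleMap (φ x₀) r t := by
  obtain ⟨ε, hε, hball⟩ := Metric.isOpen_iff.1 (φ.isOpen_image_of_subset_source hN hNφ) (φ x₀)
    ⟨x₀, hx₀, rfl⟩
  obtain ⟨r, hr, hrε⟩ := exists_between hε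
  have himage : ∀ t, circleMap (φ x₀) r t ∈ φ '' N := fun t => by
    apply hball
    rw [Metric.mem_ball, Metric.mem_sphere.1 (circleMap_mem_sphere _ hr.le t)]
    exact hrε
  have htarget : ∀ t, circleMap (φ x₀) r t ∈ φ.target := fun t => by
    obtain ⟨y, hy, h⟩ := himage t
    exact h ▸ φ.map_source (hNφ hy)
  have hmem : ∀ t, φ.symm (circleMap (φ x₀) r t) ∈ N \ {x₀} := fun t => by
    obtain ⟨y, hy, h⟩ := himage t
    rw [← h, φ.left_inv (hNφ hy)]
    refine ⟨hy, fun hyx => circleMap_ne_center hr.ne' (θ := t) (c := φ x₀) ?_⟩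
    rw [← h, Set.mem_singleton_iff.1 hyx]
  have hcont : Continuous fun t => φ.symm (circleMap (φ x₀) r t) :=
    φ.continuousOn_symm.comp_continuous (continuous_circleMap _ _) htarget
  refine ⟨r, ⟨fun t => ⟨_, hmem t⟩, hcont.subtype_mk _⟩, Subtype.ext ?_,
    fun t => φ.right_inv (htarget t)⟩
  exact congrArg φ.symm (periodic_circleMap _ _).eq

theorem not_homotopic_id_of_isLocallyConstant {x₀ : X} (φ : OpenPartialHomeomorph X ℂ)
    {N : Set X} (hN : IsOpen N) (hx₀ : x₀ ∈ N) (hNφ : N ⊆ φ.source)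
    {c : C(↥(N \ {x₀}), ↥(N \ {x₀}))} (hc : IsLocallyConstant c) :
    ¬ c.Homotopic (ContinuousMap.id _) := by
  intro h
  have hne : ∀ x : ↥(N \ {x₀}), φ x - φ x₀ ≠ 0 := fun x hx =>
    x.2.2 (φ.injOn (hNφ x.2.1) (hNφ hx₀) (sub_eq_zero.1 hx))
  have hcont : Continuous fun x : ↥(N \ {x₀}) => φ x - φ x₀ :=
    (φ.continuousOn.comp_continuous continuous_subtype_val fun x => hNφ x.2.1).sub
      continuous_const
  let g : C(↥(N \ {x₀}), {z : ℂ // z ≠ 0}) := ⟨fun x => ⟨φ x - φ x₀, hne x⟩, hcont.subtype_mk _⟩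
  obtain ⟨L, hL⟩ := exists_log_of_homotopic (f := g.comp c) (hc.comp g)
    ((ContinuousMap.Homotopic.refl g).comp h)
  obtain ⟨r, γ, hγ, hφγ⟩ := exists_loop_in_chart φ hN hx₀ hNφ
  have hcircle : ∀ t : ℝ, Complex.exp (L (γ t)) = r * Complex.exp (t * Complex.I) := fun t => by
    rw [hL]
    change φ (γ t) - φ x₀ = _
    rw [hφγ, circleMap_sub_center, circleMap_zero]
  have hperiod := log_circle_two_pi (L.continuous.comp γ.continuous) hcircle
  simp only [Function.comp_apply, hγ, left_eq_add] at hperiod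
  exact Complex.two_pi_I_ne_zero hperiod

end PuncturedPlane

section Star

theorem homotopic_id_of_segments_avoid {E : Type*} [AddCommGroup E] [Module ℝ E]
    [TopologicalSpace E] [IsTopologicalAddGroup E] [ContinuousSMul ℝ E] {P : Set E} {N : Set P}
    (hN : Convex ℝ (Subtype.val '' N)) {m : P} (c : C(↥(N \ {m}), ↥(N \ {m})))
    (h : ∀ x, ∀ t ∈ Set.Icc (0 : ℝ) 1, AffineMap.lineMap (c x : E) (x : E) t ≠ (m : E)) :
    c.Homotopic (ContinuousMap.id _) := by
  have hmem : ∀ p : unitInterval × ↥(N \ {m}), ∃ y : ↥(N \ {m}),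
      (y : E) = AffineMap.lineMap (c p.2 : E) (p.2 : E) (p.1 : ℝ) := fun p => by
    obtain ⟨y, hy, hyp⟩ := hN.lineMap_mem ⟨_, (c p.2).2.1, rfl⟩ ⟨_, p.2.2.1, rfl⟩ p.1.2
    refine ⟨⟨y, hy, fun hym => h p.2 p.1 p.1.2 ?_⟩, hyp⟩
    rw [← hyp, Set.mem_singleton_iff.1 hym]
  choose H hH using hmem
  have hcont : Continuous fun p => (H p : E) := by
    simp only [hH, AffineMap.lineMap_apply_module]
    fun_prop
  refine ⟨⟨⟨H, (continuous_induced_rng.2 (continuous_induced_rng.2 hcont))⟩, fun x => ?_,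
    fun x => ?_⟩⟩
  · exact Subtype.ext (Subtype.ext ((hH _).trans (AffineMap.lineMap_apply_zero _ _)))
  · exact Subtype.ext (Subtype.ext ((hH _).trans (AffineMap.lineMap_apply_one _ _)))

variable {V : Type*}

theorem mem_faces_of_subset {K : AbstractSimplicialComplex V} {A F : Finset V} (hA : A ∈ K.faces)
    (hF : F.Nonempty) (hFA : F ⊆ A) : F ∈ K.faces :=
  (K.isRelLowerSet_faces hA).2 hFA hF

variable [Fintype V]

/-- The closed cell of the vertex set `A`: the convex weights supported on `A`. -/
def cell (A : Finset V) : Set (V → ℝ) :=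
  {x | x ∈ stdSimplex ℝ V ∧ ∀ v, v ∉ A → x v = 0}

theorem convex_cell (A : Finset V) : Convex ℝ (cell A) := fun x hx y hy a b ha hb hab =>
  ⟨convex_stdSimplex ℝ V hx.1 hy.1 ha hb hab, fun v hv => by simp [hx.2 v hv, hy.2 v hv]⟩

theorem cell_subset_polyhedron {K : AbstractSimplicialComplex V} {A : Finset V}
    (hA : A ∈ K.faces) : cell A ⊆ polyhedron K :=
  fun _ hx => ⟨hx.1, A, hA, hx.2⟩

theorem single_mem_cell [DecidableEq V] {A : Finset V} {v : V} (hv : v ∈ A) :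
    (Pi.single v 1 : V → ℝ) ∈ cell A :=
  ⟨single_mem_stdSimplex ℝ v, fun _ hw => Pi.single_eq_of_ne (ne_of_mem_of_not_mem hv hw).symm 1⟩

/-- The open star of the face `F`. -/
def openStar (K : AbstractSimplicialComplex V) (F : Finset V) : Set (polyhedron K) :=
  {x | ∀ v ∈ F, 0 < x.1 v}

theorem isOpen_openStar (K : AbstractSimplicialComplex V) (F : Finset V) :
    IsOpen (openStar K F) := by
  simp only [openStar, Set.ofPred_forall]
  exact isOpen_biInter_finset fun v _ => isOpen_lt continuous_const <|
    (continuous_apply v).comp continuous_subtype_val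

theorem mem_cell_of_mem_openStar {K : AbstractSimplicialComplex V} {F A : Finset V}
    (hstar : ∀ s ∈ K.faces, F ⊆ s → s ⊆ A) {x : polyhedron K} (hx : x ∈ openStar K F) :
    x.1 ∈ cell A := by
  obtain ⟨hx₀, s, hs, hsupp⟩ := x.2
  have hFs : F ⊆ s := fun v hv => by
    by_contra hvs
    exact (hx v hv).ne' (hsupp v hvs)
  exact ⟨hx₀, fun v hv => hsupp v fun hvs => hv (hstar s hs hFs hvs)⟩

theorem convex_openStar_inter_ball {K : AbstractSimplicialComplex V} {F A : Finset V}
    (hA : A ∈ K.faces) (hstar : ∀ s ∈ K.faces, F ⊆ s → s ⊆ A) (m : polyhedron K) (r : ℝ) :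
    Convex ℝ (Subtype.val '' (openStar K F ∩ Metric.ball m r)) := by
  have himage : Subtype.val '' (openStar K F ∩ Metric.ball m r) =
      (cell A ∩ ⋂ v ∈ F, {x : V → ℝ | 0 < x v}) ∩ Metric.ball m.1 r := by
    ext x
    simp only [Set.mem_image, Set.mem_inter_iff, Set.mem_iInter]
    constructor
    · rintro ⟨y, ⟨hy, hym⟩, rfl⟩
      exact ⟨⟨mem_cell_of_mem_openStar hstar hy, hy⟩, hym⟩
    · rintro ⟨⟨hxA, hxF⟩, hxm⟩
      exact ⟨⟨x, cell_subset_polyhedron hA hxA⟩, ⟨hxF, hxm⟩, rfl⟩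
  rw [himage]
  exact ((convex_cell A).inter (convex_iInter₂ fun v _ =>
    convex_halfSpace_gt (LinearMap.proj (R := ℝ) (φ := fun _ : V => ℝ) v).isLinear 0)).inter
    (convex_ball _ _)

theorem exists_mem_openStar_near_of_lt_one {K : AbstractSimplicialComplex V} {F A : Finset V}
    (hA : A ∈ K.faces) (hstar : ∀ s ∈ K.faces, F ⊆ s → s ⊆ A) {m : polyhedron K}
    (hm : m ∈ openStar K F) {v : V} (hv : v ∈ A) (hmv : m.1 v < 1) {r : ℝ} (hr : 0 < r) :
    ∃ y ∈ openStar K F ∩ Metric.ball m r, m.1 v < y.1 v := by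
  classical
  let line : ℝ → V → ℝ := AffineMap.lineMap m.1 (Pi.single v 1)
  have hline : Filter.Tendsto line (nhds 0) (nhds m.1) := by
    have h : Continuous line := AffineMap.lineMap_continuous
    simpa [line] using h.tendsto 0
  obtain ⟨δ, hδr, hδ₀, hδ₁⟩ : ∃ δ, dist (line δ) m.1 < r ∧ 0 < δ ∧ δ < 1 := by
    have hclose := (hline.eventually (Metric.ball_mem_nhds _ hr)).filter_mono
      (nhdsWithin_le_nhds (s := Set.Ioi 0))
    exact (hclose.and (Ioo_mem_nhdsGT one_pos)).exists
  have hcell : line δ ∈ cell A := (convex_cell A).lineMap_mem (mem_cell_of_mem_openStar hstar hm)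
    (single_mem_cell hv) ⟨hδ₀.le, hδ₁.le⟩
  have hcoord : ∀ w, line δ w = (1 - δ) * m.1 w + δ * (Pi.single v 1 : V → ℝ) w := fun w => by
    simp only [line, AffineMap.lineMap_apply_module, Pi.add_apply, Pi.smul_apply, smul_eq_mul]
  refine ⟨⟨line δ, cell_subset_polyhedron hA hcell⟩, ⟨fun w hw => ?_, hδr⟩, ?_⟩
  · have hsingle : 0 ≤ (Pi.single v 1 : V → ℝ) w := (single_mem_stdSimplex ℝ v).1 w
    exact (add_pos_of_pos_of_nonneg (mul_pos (sub_pos.2 hδ₁) (hm w hw))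
      (mul_nonneg hδ₀.le hsingle)).trans_eq (hcoord w).symm
  · refine lt_of_lt_of_eq ?_ (hcoord v).symm
    rw [Pi.single_eq_same]
    linarith [mul_pos hδ₀ (sub_pos.2 hmv)]

/-- The map `g` names, for every point near `m`, a vertex towards which `m` can be pushed without
meeting the segment to that point; the pushed copies of `m` contract the punctured star. -/
theorem not_mem_chart_source_of_push {K : AbstractSimplicialComplex V} {F A : Finset V}
    (hA : A ∈ K.faces) (hstar : ∀ s ∈ K.faces, F ⊆ s → s ⊆ A) {m : polyhedron K}
    (hm : m ∈ openStar K F) (hm_lt : ∀ v, m.1 v < 1) {g : ↥(openStar K F \ {m}) → A}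
    (hg : IsLocallyConstant g) (hmg : ∀ x, m.1 (g x) ≤ x.1.1 (g x))
    (φ : OpenPartialHomeomorph (polyhedron K) ℂ) : m ∉ φ.source := by
  intro hmφ
  obtain ⟨r, hr, hball⟩ := Metric.isOpen_iff.1 φ.open_source m hmφ
  let N := openStar K F ∩ Metric.ball m r
  choose p hpN hp using fun v : A =>
    exists_mem_openStar_near_of_lt_one hA hstar hm v.2 (hm_lt v) hr
  have hpm : ∀ v, p v ∉ ({m} : Set (polyhedron K)) := fun v h =>
    (hp v).ne' (congrArg (fun y : polyhedron K => y.1 v) h)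
  let incl : C(↥(N \ {m}), ↥(openStar K F \ {m})) :=
    ⟨fun x => ⟨x.1, x.2.1.1, x.2.2⟩, continuous_subtype_val.subtype_mk _⟩
  have hc : IsLocallyConstant fun x : ↥(N \ {m}) =>
      (⟨p (g (incl x)), hpN _, hpm _⟩ : ↥(N \ {m})) :=
    (hg.comp_continuous incl.continuous).comp fun v => (⟨p v, hpN v, hpm v⟩ : ↥(N \ {m}))
  refine not_homotopic_id_of_isLocallyConstant φ ((isOpen_openStar K F).inter Metric.isOpen_ball)
    ⟨hm, Metric.mem_ball_self hr⟩ (fun x hx => hball hx.2) (c := ⟨_, hc.continuous⟩) hc ?_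
  refine homotopic_id_of_segments_avoid (convex_openStar_inter_ball hA hstar m r) _
    fun x t ht h => x.2.2 (Subtype.ext ?_)
  have hcoord := congrFun h (g (incl x))
  simp only [AffineMap.lineMap_apply_module, ContinuousMap.coe_mk, Pi.add_apply, Pi.smul_apply,
    smul_eq_mul] at hcoord
  have ht₁ : t = 1 := by
    have hxm : m.1 (g (incl x)) ≤ x.1.1 (g (incl x)) := hmg (incl x)
    by_contra ht₁
    nlinarith [mul_pos (sub_pos.2 (ht.2.lt_of_ne ht₁)) (sub_pos.2 (hp (g (incl x)))),
      mul_nonneg ht.1 (sub_nonneg.2 hxm)]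
  rwa [ht₁, AffineMap.lineMap_apply_one] at h

theorem exists_chart_complex {X : Type*} [TopologicalSpace X] (hX : IsClosedConnectedSurface X)
    (x : X) : ∃ φ : OpenPartialHomeomorph X ℂ, x ∈ φ.source := by
  obtain ⟨φ, hφ⟩ := hX.locally_plane x
  exact ⟨φ.transHomeomorph Complex.orthonormalBasisOneI.repr.symm.toHomeomorph, hφ⟩

theorem exists_mem_openStar_lt_one {K : AbstractSimplicialComplex V} {F : Finset V}
    (hF : F ∈ K.faces) (hcard : 1 < F.card) :
    ∃ m ∈ openStar K F, m.1 ∈ cell F ∧ ∀ v, m.1 v < 1 := by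
  classical
  have hpos : (1 : ℝ) < F.card := by exact_mod_cast hcard
  let m : V → ℝ := fun v => if v ∈ F then (F.card : ℝ)⁻¹ else 0
  have hm : m ∈ cell F := by
    refine ⟨⟨fun v => ?_, ?_⟩, fun v hv => if_neg hv⟩
    · simp only [m]
      positivity
    · simp only [m, Finset.sum_ite_mem, Finset.univ_inter, Finset.sum_const, nsmul_eq_mul]
      exact mul_inv_cancel₀ (one_pos.trans hpos).ne'
  refine ⟨⟨m, cell_subset_polyhedron hF hm⟩, fun v hv => ?_, hm, fun v => ?_⟩
  · simp only [m, if_pos hv]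
    positivity
  · simp only [m]
    split_ifs
    · exact inv_lt_one_of_one_lt₀ hpos
    · exact one_pos

theorem exists_face_not_subset_of_ssubset {K : AbstractSimplicialComplex V}
    (hK : IsClosedConnectedSurface (polyhedron K)) {F A : Finset V} (hA : A ∈ K.faces)
    (hcard : 1 < F.card) (hFA : F ⊂ A) : ∃ s ∈ K.faces, F ⊆ s ∧ ¬ s ⊆ A := by
  by_contra! hstar
  obtain ⟨w, hwA, hwF⟩ := Finset.exists_of_ssubset hFA
  obtain ⟨m, hm, hmF, hm_lt⟩ := exists_mem_openStar_lt_one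
    (mem_faces_of_subset hA (Finset.card_pos.1 (one_pos.trans hcard)) hFA.subset) hcard
  obtain ⟨φ, hφ⟩ := exists_chart_complex hK m
  refine not_mem_chart_source_of_push hA hstar hm hm_lt (IsLocallyConstant.const ⟨w, hwA⟩)
    (fun x => ?_) φ hφ
  exact (hmF.2 w hwF).trans_le (x.1.2.1.1 w)

theorem exists_face_not_subset_of_pair [DecidableEq V] {K : AbstractSimplicialComplex V}
    (hK : IsClosedConnectedSurface (polyhedron K)) {u v : V} (huv : u ≠ v)
    (he : {u, v} ∈ K.faces) : ∃ s ∈ K.faces, {u, v} ⊆ s ∧ ¬ s ⊆ {u, v} := by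
  by_contra! hstar
  obtain ⟨m, hm, hmF, hm_lt⟩ := exists_mem_openStar_lt_one he (by rw [Finset.card_pair huv]; simp)
  obtain ⟨φ, hφ⟩ := exists_chart_complex hK m
  have hsum : ∀ x ∈ cell {u, v}, x u + x v = 1 := fun x hx => by
    rw [← hx.1.2, ← Finset.sum_pair huv]
    exact Finset.sum_subset (Finset.subset_univ _) fun w _ hw => hx.2 w hw
  have hne : ∀ x : ↥(openStar K {u, v} \ {m}), x.1.1 u ≠ m.1 u := fun x hx => by
    have hxF := mem_cell_of_mem_openStar hstar x.2.1
    refine x.2.2 (Subtype.ext (funext fun w => ?_))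
    by_cases hw : w ∈ ({u, v} : Finset V)
    · have := hsum _ hxF
      have := hsum _ hmF
      rcases Finset.mem_insert.1 hw with rfl | hw
      · exact hx
      · rw [Finset.mem_singleton.1 hw]
        linarith
    · rw [hxF.2 w hw, hmF.2 w hw]
  have hcont : Continuous fun x : ↥(openStar K {u, v} \ {m}) => x.1.1 u :=
    (continuous_apply u).comp (continuous_subtype_val.comp continuous_subtype_val)
  let g : ↥(openStar K {u, v} \ {m}) → ({u, v} : Finset V) := fun x =>
    if m.1 u < x.1.1 u then ⟨u, by simp⟩ else ⟨v, by simp⟩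
  have hg : IsLocallyConstant g := by
    refine (IsLocallyConstant.iff_exists_open g).2 fun x => ?_
    rcases (hne x).lt_or_gt with hx | hx
    · refine ⟨_, isOpen_lt hcont continuous_const, hx, fun y hy => ?_⟩
      simp only [g, if_neg hx.not_gt, if_neg (Set.mem_ofPred.1 hy).not_gt]
    · refine ⟨_, isOpen_lt continuous_const hcont, hx, fun y hy => ?_⟩
      simp only [g, if_pos hx, if_pos (Set.mem_ofPred.1 hy)]
  refine not_mem_chart_source_of_push he hstar hm hm_lt hg (fun x => ?_) φ hφ
  by_cases hx : m.1 u < x.1.1 u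
  · simpa only [g, if_pos hx] using hx.le
  · have := hsum _ (mem_cell_of_mem_openStar hstar x.2.1)
    have := hsum _ hmF
    simp only [g, if_neg hx]
    linarith

theorem exists_two_triangles [DecidableEq V] {K : AbstractSimplicialComplex V}
    (hK : IsClosedConnectedSurface (polyhedron K)) {e : Finset V} (he : e ∈ K.faces)
    (hcard : e.card = 2) :
    ∃ a ∉ e, ∃ b ∉ e, a ≠ b ∧ insert a e ∈ K.faces ∧ insert b e ∈ K.faces := by
  have hpair : ∃ s ∈ K.faces, e ⊆ s ∧ ¬ s ⊆ e := by
    obtain ⟨u, v, huv, rfl⟩ := Finset.card_eq_two.1 hcard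
    exact exists_face_not_subset_of_pair hK huv he
  obtain ⟨s, hs, hes, hse⟩ := hpair
  obtain ⟨a, has, ha⟩ := Finset.not_subset.1 hse
  have hA : insert a e ∈ K.faces :=
    mem_faces_of_subset hs (Finset.insert_nonempty _ _) (Finset.insert_subset has hes)
  obtain ⟨t, ht, het, hte⟩ := exists_face_not_subset_of_ssubset hK hA
    (hcard ▸ one_lt_two) (Finset.ssubset_insert ha)
  obtain ⟨b, hbt, hb⟩ := Finset.not_subset.1 hte
  rw [Finset.mem_insert, not_or] at hb
  exact ⟨a, ha, b, hb.2, Ne.symm hb.1, hA,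
    mem_faces_of_subset ht (Finset.insert_nonempty _ _) (Finset.insert_subset hbt het)⟩

end Star

section Counting

variable {V : Type*} [Fintype V]

open Classical in
/-- The faces of `K` with `n` vertices, as a finite set; the `k`-dimensional ones have
`n = k + 1`. -/
def facesOfCard (K : AbstractSimplicialComplex V) (n : ℕ) : Finset (Finset V) :=
  Finset.univ.filter fun s => s ∈ K.faces ∧ s.card = n

theorem mem_facesOfCard {K : AbstractSimplicialComplex V} {n : ℕ} {s : Finset V} :
    s ∈ facesOfCard K n ↔ s ∈ K.faces ∧ s.card = n := by
  classical
  simp [facesOfCard]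

theorem faceCount_eq_card (K : AbstractSimplicialComplex V) (k : ℕ) :
    faceCount K k = (facesOfCard K (k + 1)).card := by
  rw [faceCount, ← Set.ncard_coe_finset]
  congr 1
  ext s
  simp [mem_facesOfCard]

theorem faceCount_zero (K : AbstractSimplicialComplex V) : faceCount K 0 = Fintype.card V := by
  rw [faceCount_eq_card]
  have : facesOfCard K 1 = Finset.powersetCard 1 Finset.univ := by
    ext s
    simp only [mem_facesOfCard, Finset.mem_powersetCard, Finset.subset_univ, true_and,
      and_iff_right_iff_imp]
    intro h
    obtain ⟨v, rfl⟩ := Finset.card_eq_one.1 h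
    exact K.singleton_mem v
  rw [zero_add, this, Finset.card_powersetCard, Nat.choose_one_right, Finset.card_univ]

theorem faceCount_one_le (K : AbstractSimplicialComplex V) :
    faceCount K 1 ≤ (Fintype.card V).choose 2 := by
  rw [faceCount_eq_card, ← Finset.card_univ, ← Finset.card_powersetCard]
  exact Finset.card_le_card fun s hs => Finset.mem_powersetCard.2
    ⟨Finset.subset_univ _, (mem_facesOfCard.1 hs).2⟩

theorem sum_card_triangles_of_edge [DecidableEq V] (K : AbstractSimplicialComplex V) :
    ∑ e ∈ facesOfCard K 2, ((facesOfCard K 3).filter (e ⊆ ·)).card = 3 * faceCount K 2 := by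
  have hcount := Finset.sum_card_bipartiteAbove_eq_sum_card_bipartiteBelow
    (s := facesOfCard K 2) (t := facesOfCard K 3) (fun e t => e ⊆ t)
  simp only [Finset.bipartiteAbove, Finset.bipartiteBelow] at hcount
  rw [hcount, faceCount_eq_card, mul_comm, ← smul_eq_mul, ← Finset.sum_const]
  refine Finset.sum_congr rfl fun t ht => ?_
  obtain ⟨htK, htcard⟩ := mem_facesOfCard.1 ht
  have hedges : (facesOfCard K 2).filter (· ⊆ t) = Finset.powersetCard 2 t := by
    ext e
    rw [Finset.mem_filter, mem_facesOfCard, Finset.mem_powersetCard]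
    refine ⟨fun h => ⟨h.2, h.1.2⟩, fun h => ⟨⟨mem_faces_of_subset htK ?_ h.1, h.2⟩, h.1⟩⟩
    exact Finset.card_pos.1 (by omega)
  rw [hedges, Finset.card_powersetCard, htcard]
  rfl

theorem two_mul_edges_le {K : AbstractSimplicialComplex V}
    (hK : IsClosedConnectedSurface (polyhedron K)) : 2 * faceCount K 1 ≤ 3 * faceCount K 2 := by
  classical
  rw [← sum_card_triangles_of_edge, faceCount_eq_card, mul_comm, ← smul_eq_mul]
  refine Finset.card_nsmul_le_sum _ _ _ fun e he => ?_
  obtain ⟨heK, hecard⟩ := mem_facesOfCard.1 he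
  obtain ⟨a, ha, b, hb, hab, haK, hbK⟩ := exists_two_triangles hK heK hecard
  have htriangle : ∀ c ∉ e, insert c e ∈ K.faces →
      insert c e ∈ (facesOfCard K 3).filter (e ⊆ ·) := fun c hc hcK => by
    rw [Finset.mem_filter, mem_facesOfCard, Finset.card_insert_of_notMem hc, hecard]
    exact ⟨⟨hcK, rfl⟩, Finset.subset_insert c e⟩
  refine Finset.one_lt_card.2 ⟨_, htriangle a ha haK, _, htriangle b hb hbK, fun h => ?_⟩
  have hmem : a ∈ insert b e := h ▸ Finset.mem_insert_self a e
  exact (Finset.mem_insert.1 hmem).elim hab ha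

omit [Fintype V] in
theorem three_mul_triangles_le [Finite V] [DecidableEq V] {K : AbstractSimplicialComplex V}
    {O : Set (V × V × V)} (hO : IsCoherentOrientation K O) :
    3 * faceCount K 2 ≤ 2 * faceCount K 1 := by
  classical
  have := Fintype.ofFinite V
  rw [← sum_card_triangles_of_edge, faceCount_eq_card, mul_comm, ← smul_eq_mul]
  refine Finset.sum_le_card_nsmul _ _ _ fun e he => ?_
  obtain ⟨u, v, huv, rfl⟩ := Finset.card_eq_two.1 (mem_facesOfCard.1 he).2
  let side : V → V → Finset V := fun a b => Finset.univ.filter fun c => (a, b, c) ∈ O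
  have hside : ∀ a b, (side a b).card ≤ 1 := fun a b =>
    Finset.card_le_one.2 fun c hc d hd =>
      hO.coherent a b c d (Finset.mem_filter.1 hc).2 (Finset.mem_filter.1 hd).2
  have hsub : (facesOfCard K 3).filter ({u, v} ⊆ ·) ⊆
      (side u v ∪ side v u).image fun c => insert c {u, v} := fun t ht => by
    rw [Finset.mem_filter, mem_facesOfCard] at ht
    obtain ⟨w, hw, rfl⟩ := Finset.exists_eq_insert_iff.2
      ⟨ht.2, by rw [Finset.card_pair huv, ht.1.2]⟩
    refine Finset.mem_image_of_mem _ ?_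
    have hwuv : insert w {u, v} = ({u, v, w} : Finset V) := by
      ext; simp only [Finset.mem_insert, Finset.mem_singleton]; tauto
    simp only [Finset.mem_insert, Finset.mem_singleton, not_or] at hw
    have := hO.choice u v w huv (Ne.symm hw.2) (Ne.symm hw.1) (hwuv ▸ ht.1.1)
    simp only [side, Finset.mem_union, Finset.mem_filter, Finset.mem_univ, true_and]
    tauto
  calc ((facesOfCard K 3).filter ({u, v} ⊆ ·)).card
      ≤ (side u v ∪ side v u).card := (Finset.card_le_card hsub).trans Finset.card_image_le
    _ ≤ (side u v).card + (side v u).card := Finset.card_union_le _ _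
    _ ≤ 2 := Nat.add_le_add (hside u v) (hside v u)

theorem eleven_le_card [DecidableEq V] {K : AbstractSimplicialComplex V}
    (hK : IsOrientableTriangulation K 4) : 11 ≤ Fintype.card V := by
  have hedges := two_mul_edges_le hK.surface
  have hpairs := faceCount_one_le K
  have heuler := hK.genus
  rw [eulerChar, faceCount_zero] at heuler
  by_contra! hlt
  generalize Fintype.card V = n at *
  interval_cases n <;> simp only [Nat.choose] at hpairs <;> omega

end Counting

section Fan

open ComplexConjugate

variable (k : ℕ) [NeZero k]

/-- The angle of a regular `k`-gon at its centre. -/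
def fanAngle : ℝ := 2 * Real.pi / k

/-- The function on the plane that is `1` at `1`, vanishes at the other `k`-th roots of unity, and
is linear on the cone over every edge of the regular `k`-gon: a coordinate of the fan of the
`k`-gon. On the two cones at `1` the two entries of the minimum are the linear pieces, and on every
other cone one of them is nonpositive. -/
def hat (y : ℂ) : ℝ :=
  max 0 (min (y * ZMod.stdAddChar (1 : ZMod k)).im (-(y * ZMod.stdAddChar (-1 : ZMod k)).im)) /
    Real.sin (fanAngle k)

theorem continuous_hat : Continuous (hat k) := by
  unfold hat
  fun_prop

theorem mul_fanAngle : k * fanAngle k = 2 * Real.pi :=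
  mul_div_cancel₀ _ (NeZero.ne _)

theorem stdAddChar_intCast (n : ℤ) :
    ZMod.stdAddChar (n : ZMod k) = Complex.exp ((n * fanAngle k : ℝ) * Complex.I) := by
  rw [ZMod.stdAddChar_coe, fanAngle]
  congr 1
  push_cast
  ring

variable {k}

theorem fan_mul_stdAddChar_im (a b : ℝ) (n m : ℤ) :
    ((a * ZMod.stdAddChar (n : ZMod k) + b * ZMod.stdAddChar (n + 1 : ZMod k)) *
      ZMod.stdAddChar (m : ZMod k)).im =
      a * Real.sin ((n + m) * fanAngle k) + b * Real.sin ((n + m + 1) * fanAngle k) := by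
  have hn : (n + 1 : ZMod k) = (n + 1 : ℤ) := by push_cast; rfl
  rw [hn, add_mul, mul_assoc, mul_assoc, ← AddChar.map_add_eq_mul, ← AddChar.map_add_eq_mul,
    ← Int.cast_add, ← Int.cast_add, stdAddChar_intCast, stdAddChar_intCast, Complex.add_im,
    Complex.im_ofReal_mul, Complex.im_ofReal_mul, Complex.exp_ofReal_mul_I_im,
    Complex.exp_ofReal_mul_I_im]
  push_cast
  ring_nf

theorem fanAngle_pos : 0 < fanAngle k :=
  div_pos Real.two_pi_pos (Nat.cast_pos.2 (NeZero.pos k))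

theorem fanAngle_le_pi_div_two (hk : 4 ≤ k) : fanAngle k ≤ Real.pi / 2 := by
  have hk' : (4 : ℝ) ≤ k := by exact_mod_cast hk
  nlinarith [mul_fanAngle k, fanAngle_pos (k := k)]

theorem sin_fanAngle_pos (hk : 4 ≤ k) : 0 < Real.sin (fanAngle k) :=
  Real.sin_pos_of_pos_of_lt_pi fanAngle_pos (by linarith [fanAngle_le_pi_div_two hk, Real.pi_pos])

theorem hat_stdAddChar_intCast (a b : ℝ) (n : ℤ) :
    hat k (a * ZMod.stdAddChar (n : ZMod k) + b * ZMod.stdAddChar (n + 1 : ZMod k)) =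
      max 0 (min (a * Real.sin ((n + 1) * fanAngle k) + b * Real.sin ((n + 2) * fanAngle k))
        (-(a * Real.sin ((n - 1) * fanAngle k) + b * Real.sin (n * fanAngle k)))) /
        Real.sin (fanAngle k) := by
  have hpos := fan_mul_stdAddChar_im (k := k) a b n 1
  have hneg := fan_mul_stdAddChar_im (k := k) a b n (-1)
  push_cast at hpos hneg
  rw [hat, hpos, hneg]
  ring_nf

theorem max_min_sin_eq {α a b : ℝ} (hα : 0 < α) (hα' : α ≤ Real.pi / 2) (ha : 0 ≤ a) (hb : 0 ≤ b)
    {n : ℤ} (hlower : -Real.pi < n * α) (hupper : n * α ≤ Real.pi) :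
    max 0 (min (a * Real.sin ((n + 1) * α) + b * Real.sin ((n + 2) * α))
        (-(a * Real.sin ((n - 1) * α) + b * Real.sin (n * α)))) =
      ((if n = 0 then a else 0) + (if n = -1 then b else 0)) * Real.sin α := by
  have hsin : 0 ≤ Real.sin α := Real.sin_nonneg_of_nonneg_of_le_pi hα.le (by linarith)
  have hsin₂ : 0 ≤ Real.sin (2 * α) :=
    Real.sin_nonneg_of_nonneg_of_le_pi (by linarith) (by linarith)
  rcases (by omega : n = 0 ∨ n = -1 ∨ 1 ≤ n ∨ n ≤ -2) with rfl | rfl | hn | hn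
  · have hmin : a * Real.sin α ≤ a * Real.sin α + b * Real.sin (2 * α) :=
      le_add_of_nonneg_right (by positivity)
    norm_num [min_eq_right hmin, mul_nonneg ha hsin]
  · have hmin : b * Real.sin α ≤ b * Real.sin α + a * Real.sin (2 * α) :=
      le_add_of_nonneg_right (by positivity)
    norm_num [min_eq_left hmin, mul_nonneg hb hsin]
  · have hn' : (1 : ℝ) ≤ n := by exact_mod_cast hn
    have hsin₁ : 0 ≤ Real.sin ((n - 1) * α) :=
      Real.sin_nonneg_of_nonneg_of_le_pi (by nlinarith) (by linarith)
    have hsin₂ : 0 ≤ Real.sin (n * α) :=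
      Real.sin_nonneg_of_nonneg_of_le_pi (by positivity) hupper
    rw [max_eq_left, if_neg (by omega), if_neg (by omega), add_zero, zero_mul]
    exact (min_le_right _ _).trans (neg_nonpos.2 (by positivity))
  · have hn' : (n : ℝ) ≤ -2 := by exact_mod_cast hn
    have hsin₁ : Real.sin ((n + 1) * α) ≤ 0 :=
      Real.sin_nonpos_of_nonpos_of_neg_pi_le (by nlinarith) (by linarith)
    have hsin₂ : Real.sin ((n + 2) * α) ≤ 0 :=
      Real.sin_nonpos_of_nonpos_of_neg_pi_le (by nlinarith) (by linarith)
    rw [max_eq_left, if_neg (by omega), if_neg (by omega), add_zero, zero_mul]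
    exact (min_le_left _ _).trans (add_nonpos (mul_nonpos_of_nonneg_of_nonpos ha hsin₁)
      (mul_nonpos_of_nonneg_of_nonpos hb hsin₂))

theorem hat_stdAddChar_add (hk : 4 ≤ k) {a b : ℝ} (ha : 0 ≤ a) (hb : 0 ≤ b) (i : ZMod k) :
    hat k (a * ZMod.stdAddChar i + b * ZMod.stdAddChar (i + 1)) =
      (if i = 0 then a else 0) + (if i = -1 then b else 0) := by
  obtain ⟨n, hn⟩ : ∃ n, i.valMinAbs = n := ⟨_, rfl⟩
  have hzero : i = 0 ↔ n = 0 := by rw [← hn, ZMod.valMinAbs_eq_zero]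
  have hneg : i = -1 ↔ n = -1 := by
    have hone : (-1 : ZMod k).valMinAbs = -1 :=
      (ZMod.valMinAbs_spec _ _).2 ⟨by simp, by omega, by omega⟩
    rw [← hn, ← hone, ZMod.injective_valMinAbs.eq_iff]
  obtain ⟨hi, hlower, hupper⟩ := (ZMod.valMinAbs_spec i n).1 hn
  have hkα := mul_fanAngle k
  have hα := fanAngle_pos (k := k)
  have h₁ : (-k : ℝ) < n * 2 := by exact_mod_cast hlower
  have h₂ : (n * 2 : ℝ) ≤ k := by exact_mod_cast hupper
  simp only [hzero, hneg]
  rw [hi, hat_stdAddChar_intCast, max_min_sin_eq hα (fanAngle_le_pi_div_two hk) ha hb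
    (by nlinarith) (by nlinarith), mul_div_cancel_right₀ _ (sin_fanAngle_pos hk).ne']

theorem hat_mul_conj_stdAddChar (hk : 4 ≤ k) {a b : ℝ} (ha : 0 ≤ a) (hb : 0 ≤ b) (i j : ZMod k) :
    hat k ((a * ZMod.stdAddChar i + b * ZMod.stdAddChar (i + 1)) * conj (ZMod.stdAddChar j)) =
      (if j = i then a else 0) + (if j = i + 1 then b else 0) := by
  have hrotate : (a * ZMod.stdAddChar i + b * ZMod.stdAddChar (i + 1)) *
      conj (ZMod.stdAddChar j) =
      a * ZMod.stdAddChar (i - j) + b * ZMod.stdAddChar (i - j + 1) := by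
    rw [← AddChar.map_neg_eq_conj, add_mul, mul_assoc, mul_assoc, ← AddChar.map_add_eq_mul,
      ← AddChar.map_add_eq_mul]
    ring_nf
  have hj : i - j = -1 ↔ j = i + 1 := by
    rw [sub_eq_iff_eq_add, eq_comm, neg_add_eq_iff_eq_add, add_comm]
  rw [hrotate, hat_stdAddChar_add hk ha hb]
  simp only [sub_eq_zero, hj, eq_comm (a := i) (b := j)]

theorem sin_mul_exp_eq (α t : ℝ) : Real.sin α * Complex.exp (t * Complex.I) =
    Real.sin (α - t) + Real.sin t * Complex.exp (α * Complex.I) := by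
  apply Complex.ext
  · simp only [Complex.re_ofReal_mul, Complex.add_re, Complex.exp_ofReal_mul_I_re,
      Complex.ofReal_re, Real.sin_sub]
    ring
  · simp only [Complex.im_ofReal_mul, Complex.add_im, Complex.exp_ofReal_mul_I_im,
      Complex.ofReal_im]
    ring

theorem sin_fanAngle_mul_stdAddChar_mul_exp (n : ℤ) (t : ℝ) :
    Real.sin (fanAngle k) * (ZMod.stdAddChar (n : ZMod k) * Complex.exp (t * Complex.I)) =
      Real.sin (fanAngle k - t) * ZMod.stdAddChar (n : ZMod k) +
        Real.sin t * ZMod.stdAddChar (n + 1 : ZMod k) := by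
  have hone : ZMod.stdAddChar (1 : ZMod k) = Complex.exp (fanAngle k * Complex.I) := by
    simpa using stdAddChar_intCast k 1
  rw [AddChar.map_add_eq_mul, hone, mul_left_comm, sin_mul_exp_eq]
  ring

theorem exists_eq_add_stdAddChar (hk : 4 ≤ k) (z : ℂ) : ∃ (i : ZMod k) (a b : ℝ), 0 ≤ a ∧ 0 ≤ b ∧
    z = a * ZMod.stdAddChar i + b * ZMod.stdAddChar (i + 1) := by
  have hα := fanAngle_pos (k := k)
  have hα' := fanAngle_le_pi_div_two hk
  have hsin := sin_fanAngle_pos hk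
  set n := ⌊z.arg / fanAngle k⌋
  set t := z.arg - n * fanAngle k with ht
  have ht₀ : 0 ≤ t := sub_nonneg.2 ((le_div_iff₀ hα).1 (Int.floor_le _))
  have ht₁ : t < fanAngle k := by
    have := (div_lt_iff₀ hα).1 (Int.lt_floor_add_one (z.arg / fanAngle k))
    rw [ht]
    linarith
  have hsin₀ : 0 ≤ Real.sin t :=
    Real.sin_nonneg_of_nonneg_of_le_pi ht₀ (by linarith [Real.pi_pos])
  have hsin₁ : 0 ≤ Real.sin (fanAngle k - t) :=
    Real.sin_nonneg_of_nonneg_of_le_pi (by linarith) (by linarith [Real.pi_pos])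
  refine ⟨n, ‖z‖ * Real.sin (fanAngle k - t) / Real.sin (fanAngle k),
    ‖z‖ * Real.sin t / Real.sin (fanAngle k), by positivity, by positivity, ?_⟩
  have hsin' : (Real.sin (fanAngle k) : ℂ) ≠ 0 := by exact_mod_cast hsin.ne'
  have hz : z = ‖z‖ * (ZMod.stdAddChar (n : ZMod k) * Complex.exp (t * Complex.I)) := by
    rw [stdAddChar_intCast, ← Complex.exp_add, ← add_mul, ← Complex.ofReal_add, ht,
      add_sub_cancel, Complex.norm_mul_exp_arg_mul_I]
  calc z = ‖z‖ * (Real.sin (fanAngle k) *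
        (ZMod.stdAddChar (n : ZMod k) * Complex.exp (t * Complex.I))) / Real.sin (fanAngle k) := by
        rw [mul_left_comm, ← hz, mul_div_cancel_left₀ _ hsin']
    _ = _ := by
        rw [sin_fanAngle_mul_stdAddChar_mul_exp]
        push_cast
        ring

end Fan

section Chart

open ComplexConjugate

variable {V : Type*} [DecidableEq V] {k : ℕ}

/-- The faces of `K` at the vertex `v` are the faces at `v` of the cone with apex `v` over the
`k`-cycle `w`, with `4 ≤ k`. A surface may also have vertices of degree three, which are left
out because the regular triangle has no room for the sectors of `hat`. -/
structure IsCyclicLink (K : AbstractSimplicialComplex V) (v : V) (w : ZMod k → V) : Prop where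
  four_le : 4 ≤ k
  injective : Function.Injective w
  ne : ∀ i, w i ≠ v
  mem_faces : ∀ i, {v, w i, w (i + 1)} ∈ K.faces
  subset_of_mem : ∀ s ∈ K.faces, v ∈ s → ∃ i, s ⊆ {v, w i, w (i + 1)}

/-- The point of the cell of `v, w i, w (i + 1)` with weights `a` at `w i` and `b` at
`w (i + 1)`. -/
def conePoint (v : V) (w : ZMod k → V) (i : ZMod k) (a b : ℝ) : V → ℝ :=
  (1 - a - b) • Pi.single v 1 + (a • Pi.single (w i) 1 + b • Pi.single (w (i + 1)) 1)

theorem conePoint_apex {v : V} {w : ZMod k → V} (hne : ∀ i, w i ≠ v) (i : ZMod k) (a b : ℝ) :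
    conePoint v w i a b v = 1 - a - b := by
  simp [conePoint, (hne _).symm]

theorem conePoint_mem_cell [Fintype V] (v : V) (w : ZMod k → V) (i : ZMod k) {a b : ℝ}
    (ha : 0 ≤ a) (hb : 0 ≤ b) (hab : a + b ≤ 1) :
    conePoint v w i a b ∈ cell {v, w i, w (i + 1)} := by
  have hsum := (convex_cell {v, w i, w (i + 1)}).sum_mem (t := Finset.univ)
    (w := ![1 - a - b, a, b]) (z := fun j => Pi.single (![v, w i, w (i + 1)] j) 1)
    (fun j _ => by fin_cases j <;> simp <;> linarith) (by simp [Fin.sum_univ_three]; ring)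
    (fun j _ => single_mem_cell (by fin_cases j <;> simp))
  simpa [conePoint, Fin.sum_univ_three, add_assoc] using hsum

theorem exists_eq_conePoint [Fintype V] {v : V} {w : ZMod k → V} {i : ZMod k} (hi : w i ≠ v)
    (hi' : w (i + 1) ≠ v) (hne : w i ≠ w (i + 1)) {x : V → ℝ} (hx : x ∈ cell {v, w i, w (i + 1)}) :
    x = conePoint v w i (x (w i)) (x (w (i + 1))) := by
  have hsum : x v + (x (w i) + x (w (i + 1))) = 1 := by
    rw [← hx.1.2, ← Finset.sum_pair hne, ← Finset.sum_insert (by simp [hi.symm, hi'.symm])]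
    exact Finset.sum_subset (Finset.subset_univ _) fun u _ hu => hx.2 u hu
  funext u
  by_cases hu : u ∈ ({v, w i, w (i + 1)} : Finset V)
  · simp only [Finset.mem_insert, Finset.mem_singleton] at hu
    rcases hu with rfl | rfl | rfl
    · simp [conePoint, hi.symm, hi'.symm]
      linarith
    · simp [conePoint, hi, hne]
    · simp [conePoint, hi', hne.symm]
  · rw [hx.2 u hu]
    simp only [Finset.mem_insert, Finset.mem_singleton, not_or] at hu
    simp [conePoint, hu]

theorem IsCyclicLink.exists_eq_conePoint_of_mem_openStar [Fintype V]
    {K : AbstractSimplicialComplex V} {v : V} {w : ZMod k → V} (h : IsCyclicLink K v w)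
    {x : polyhedron K} (hx : x ∈ openStar K {v}) :
    ∃ (i : ZMod k) (a b : ℝ), 0 ≤ a ∧ 0 ≤ b ∧ a + b < 1 ∧ x.1 = conePoint v w i a b := by
  obtain ⟨s, hs, hsupp⟩ := x.2.2
  have hxv : 0 < x.1 v := hx v (Finset.mem_singleton_self v)
  have hv : v ∈ s := by
    by_contra hv
    exact hxv.ne' (hsupp v hv)
  obtain ⟨i, hi⟩ := h.subset_of_mem s hs hv
  have hone : (1 : ZMod k) ≠ 0 := by
    have : Fact (1 < k) := ⟨by linarith [h.four_le]⟩
    exact one_ne_zero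
  have hxi := exists_eq_conePoint (h.ne i) (h.ne (i + 1))
    (h.injective.ne (left_ne_add.2 hone)) ⟨x.2.1, fun u hu => hsupp u fun hus => hu (hi hus)⟩
  refine ⟨i, _, _, x.2.1.1 _, x.2.1.1 _, ?_, hxi⟩
  rw [hxi, conePoint_apex h.ne] at hxv
  linarith

variable [NeZero k]

/-- The map of the star of a vertex with link `w` to the plane that puts the vertex at the origin
and the link on the `k`-th roots of unity. -/
def linkProjection (w : ZMod k → V) (x : V → ℝ) : ℂ :=
  ∑ j, (x (w j) : ℂ) * ZMod.stdAddChar j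

variable (k) in
/-- The gauge function of the regular `k`-gon, as the sum of the coordinates `hat` of its fan. -/
def polygonGauge (z : ℂ) : ℝ :=
  ∑ j : ZMod k, hat k (z * conj (ZMod.stdAddChar j))

/-- The inverse of `linkProjection` on the regular `k`-gon. -/
def coneMap (v : V) (w : ZMod k → V) (z : ℂ) : V → ℝ :=
  (1 - polygonGauge k z) • Pi.single v 1 +
    ∑ j, hat k (z * conj (ZMod.stdAddChar j)) • Pi.single (w j) 1

theorem continuous_polygonGauge : Continuous (polygonGauge k) :=
  continuous_finsetSum _ fun _ _ => (continuous_hat k).comp (continuous_id.mul continuous_const)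

theorem continuous_coneMap (v : V) (w : ZMod k → V) : Continuous (coneMap v w) :=
  ((continuous_const.sub continuous_polygonGauge).smul continuous_const).add
    (continuous_finsetSum _ fun _ _ =>
      ((continuous_hat k).comp (continuous_id.mul continuous_const)).smul continuous_const)

theorem polygonGauge_stdAddChar_add (hk : 4 ≤ k) {a b : ℝ} (ha : 0 ≤ a) (hb : 0 ≤ b)
    (i : ZMod k) :
    polygonGauge k (a * ZMod.stdAddChar i + b * ZMod.stdAddChar (i + 1)) = a + b := by
  simp [polygonGauge, hat_mul_conj_stdAddChar hk ha hb, Finset.sum_add_distrib]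

theorem coneMap_stdAddChar_add (hk : 4 ≤ k) (v : V) (w : ZMod k → V) {a b : ℝ} (ha : 0 ≤ a)
    (hb : 0 ≤ b) (i : ZMod k) :
    coneMap v w (a * ZMod.stdAddChar i + b * ZMod.stdAddChar (i + 1)) = conePoint v w i a b := by
  simp only [coneMap, polygonGauge_stdAddChar_add hk ha hb, hat_mul_conj_stdAddChar hk ha hb,
    add_smul, ite_smul, zero_smul, Finset.sum_add_distrib, Finset.sum_ite_eq', Finset.mem_univ,
    if_true, conePoint, sub_sub]

theorem linkProjection_conePoint {v : V} {w : ZMod k → V} (hw : Function.Injective w)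
    (hne : ∀ i, w i ≠ v) (i : ZMod k) (a b : ℝ) :
    linkProjection w (conePoint v w i a b) =
      a * ZMod.stdAddChar i + b * ZMod.stdAddChar (i + 1) := by
  simp [linkProjection, conePoint, hne, Pi.single_apply, hw.eq_iff, add_mul,
    Finset.sum_add_distrib, apply_ite Complex.ofReal, ite_mul]

namespace IsCyclicLink

variable [Fintype V] {K : AbstractSimplicialComplex V} {v : V} {w : ZMod k → V}

theorem coneMap_linkProjection (h : IsCyclicLink K v w) {x : polyhedron K}
    (hx : x ∈ openStar K {v}) :
    polygonGauge k (linkProjection w x.1) < 1 ∧ coneMap v w (linkProjection w x.1) = x.1 := by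
  obtain ⟨i, a, b, ha, hb, hab, hxi⟩ := h.exists_eq_conePoint_of_mem_openStar hx
  rw [hxi, linkProjection_conePoint h.injective h.ne, polygonGauge_stdAddChar_add h.four_le ha hb,
    coneMap_stdAddChar_add h.four_le v w ha hb]
  exact ⟨hab, rfl⟩

theorem linkProjection_coneMap (h : IsCyclicLink K v w) {z : ℂ} (hz : polygonGauge k z < 1) :
    coneMap v w z ∈ polyhedron K ∧ 0 < coneMap v w z v ∧
      linkProjection w (coneMap v w z) = z := by
  obtain ⟨i, a, b, ha, hb, rfl⟩ := exists_eq_add_stdAddChar h.four_le z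
  rw [polygonGauge_stdAddChar_add h.four_le ha hb] at hz
  rw [coneMap_stdAddChar_add h.four_le v w ha hb, conePoint_apex h.ne]
  exact ⟨cell_subset_polyhedron (h.mem_faces i) (conePoint_mem_cell v w i ha hb hz.le),
    by linarith, linkProjection_conePoint h.injective h.ne i a b⟩

/-- The chart `linkProjection` of the open star of a vertex with cyclic link; its inverse is
`coneMap` on the open polygon and a constant outside. -/
def chart (h : IsCyclicLink K v w) : OpenPartialHomeomorph (polyhedron K) ℂ where
  toFun x := linkProjection w x.1
  invFun z := by
    classical
    exact if hz : coneMap v w z ∈ polyhedron K then ⟨_, hz⟩ else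
      ⟨Pi.single v 1, cell_subset_polyhedron (h.mem_faces 0) (single_mem_cell (by simp))⟩
  source := openStar K {v}
  target := {z | polygonGauge k z < 1}
  map_source' _ hx := (h.coneMap_linkProjection hx).1
  map_target' z hz := by
    obtain ⟨hzK, hzv, -⟩ := h.linkProjection_coneMap hz
    simpa [openStar, dif_pos hzK] using hzv
  left_inv' x hx := by
    have hxv := (h.coneMap_linkProjection hx).2
    rw [dif_pos (show coneMap v w (linkProjection w x.1) ∈ polyhedron K by rw [hxv]; exact x.2)]
    exact Subtype.ext hxv
  right_inv' z hz := by
    obtain ⟨hzK, -, hinv⟩ := h.linkProjection_coneMap hz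
    rw [dif_pos hzK]
    exact hinv
  open_source := isOpen_openStar K {v}
  open_target := isOpen_lt continuous_polygonGauge continuous_const
  continuousOn_toFun := by
    refine Continuous.continuousOn (continuous_finsetSum _ fun j _ => Continuous.mul ?_ ?_)
    · exact Complex.continuous_ofReal.comp ((continuous_apply (w j)).comp continuous_subtype_val)
    · exact continuous_const
  continuousOn_invFun := by
    rw [Topology.IsInducing.subtypeVal.continuousOn_iff]
    refine (continuous_coneMap v w).continuousOn.congr fun z hz => ?_
    simp only [Function.comp_apply, dif_pos (h.linkProjection_coneMap hz).1]

theorem exists_chart (h : IsCyclicLink K v w) :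
    ∃ e : OpenPartialHomeomorph (polyhedron K) (EuclideanSpace ℝ (Fin 2)),
      e.source = openStar K {v} :=
  ⟨h.chart.transHomeomorph Complex.orthonormalBasisOneI.repr.toHomeomorph, rfl⟩

end IsCyclicLink

end Chart

section CyclicPairs

variable {V : Type*}

/-- The pairs of cyclically consecutive entries of a list. -/
def cyclicPairs (l : List V) : List (V × V) :=
  l.zip (l.rotate 1)

theorem mem_cyclicPairs {l : List V} [NeZero l.length] {p : V × V} :
    p ∈ cyclicPairs l ↔ ∃ j : ZMod l.length, p.1 = l[j.val]'(ZMod.val_lt j) ∧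
      p.2 = l[(j + 1).val]'(ZMod.val_lt (j + 1)) := by
  have hval (j : ZMod l.length) : (j + 1).val = (j.val + 1) % l.length := by
    rw [ZMod.val_add, ZMod.val_one_eq_one_mod, Nat.add_mod_mod]
  simp only [cyclicPairs, List.mem_iff_getElem, List.getElem_zip, List.getElem_rotate, Prod.ext_iff,
    hval]
  constructor
  · rintro ⟨i, hi, hp⟩
    have hi' : (i : ZMod l.length).val = i := ZMod.val_cast_of_lt (by simpa using hi)
    exact ⟨i, by simp only [hi', hp.1], by simp only [hi', hp.2]⟩
  · rintro ⟨j, hp⟩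
    exact ⟨j.val, by simpa using ZMod.val_lt j, hp.1.symm, hp.2.symm⟩

end CyclicPairs

/-- An oriented rotation system: every vertex `v` has a cyclically ordered link of at least four
other vertices, and the triples `(v, b, c)` with consecutive `b`, `c` in the link of `v` are closed
under cyclic permutations. -/
structure RotationSystem (V : Type*) where
  link : V → List V
  four_le_length : ∀ v, 4 ≤ (link v).length
  nodup : ∀ v, (v :: link v).Nodup
  cyclic : ∀ a, ∀ p ∈ cyclicPairs (link a), (p.2, a) ∈ cyclicPairs (link p.1)

namespace RotationSystem

section Triples

variable {V : Type*} (R : RotationSystem V)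

/-- The oriented triangles of a rotation system. -/
def triples : Set (V × V × V) :=
  {t | t.2 ∈ cyclicPairs (R.link t.1)}

variable {R} in
theorem rotate_mem {a b c : V} (h : (a, b, c) ∈ R.triples) : (b, c, a) ∈ R.triples :=
  R.cyclic a _ h

instance (v : V) : NeZero (R.link v).length :=
  ⟨by have := R.four_le_length v; omega⟩

instance (v : V) : Fact (2 < (R.link v).length) :=
  ⟨by have := R.four_le_length v; omega⟩

/-- The link of a vertex as a cyclic sequence. -/
def nbr (v : V) (j : ZMod (R.link v).length) : V :=
  (R.link v)[j.val]'(ZMod.val_lt j)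

theorem nbr_injective (v : V) : Function.Injective (R.nbr v) := fun _ _ h =>
  ZMod.val_injective _ ((List.nodup_cons.1 (R.nodup v)).2.getElem_inj_iff.1 h)

theorem mem_link_iff {v u : V} : u ∈ R.link v ↔ ∃ j, R.nbr v j = u := by
  constructor
  · intro h
    obtain ⟨i, hi, rfl⟩ := List.mem_iff_getElem.1 h
    exact ⟨(i : ZMod _), by simp only [nbr, ZMod.val_cast_of_lt hi]⟩
  · rintro ⟨j, rfl⟩
    exact List.getElem_mem _

theorem nbr_ne (v : V) (j : ZMod (R.link v).length) : R.nbr v j ≠ v := fun h =>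
  (List.nodup_cons.1 (R.nodup v)).1 (R.mem_link_iff.2 ⟨j, h⟩)

theorem mem_triples_iff {a b c : V} :
    (a, b, c) ∈ R.triples ↔ ∃ j, b = R.nbr a j ∧ c = R.nbr a (j + 1) :=
  mem_cyclicPairs

theorem nbr_mem_triples (v : V) (j : ZMod (R.link v).length) :
    (v, R.nbr v j, R.nbr v (j + 1)) ∈ R.triples :=
  R.mem_triples_iff.2 ⟨j, rfl, rfl⟩

variable {R}

theorem ne_of_mem_triples {a b c : V} (h : (a, b, c) ∈ R.triples) : a ≠ b ∧ b ≠ c ∧ a ≠ c := by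
  obtain ⟨j, rfl, rfl⟩ := R.mem_triples_iff.1 h
  have : Fact (1 < (R.link a).length) := ⟨one_lt_two.trans Fact.out⟩
  exact ⟨(R.nbr_ne a j).symm, (R.nbr_injective a).ne (left_ne_add.2 one_ne_zero),
    (R.nbr_ne a _).symm⟩

theorem not_swap_mem {a b c : V} (h : (a, b, c) ∈ R.triples) : (a, c, b) ∉ R.triples := by
  intro h'
  obtain ⟨j, rfl, rfl⟩ := R.mem_triples_iff.1 h
  obtain ⟨i, hi, hj⟩ := R.mem_triples_iff.1 h'
  have hi := R.nbr_injective a hi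
  have hj := R.nbr_injective a hj
  have hone : (-1 : ZMod (R.link a).length) = 1 := by linear_combination hj - hi
  exact ZMod.neg_one_ne_one hone

end Triples

variable {V : Type*} [DecidableEq V] (R : RotationSystem V)

/-- The simplicial complex of the triangles of a rotation system. -/
def complex : AbstractSimplicialComplex V where
  faces := {s | s.Nonempty ∧ ∃ a b c, (a, b, c) ∈ R.triples ∧ s ⊆ {a, b, c}}
  isRelLowerSet_faces := by
    rintro s ⟨hs, a, b, c, h, hsub⟩
    exact ⟨hs, fun t hts ht => ⟨ht, a, b, c, h, hts.trans hsub⟩⟩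
  singleton_mem v := ⟨Finset.singleton_nonempty v, v, _, _, R.nbr_mem_triples v 0, by simp⟩

variable {R}

theorem mem_complex_of_mem_triples {a b c : V} (h : (a, b, c) ∈ R.triples) :
    {a, b, c} ∈ R.complex.faces :=
  ⟨by simp, a, b, c, h, subset_rfl⟩

theorem exists_mem_triples_of_mem {s : Finset V} (hs : s ∈ R.complex.faces) {v : V} (hv : v ∈ s) :
    ∃ b c, (v, b, c) ∈ R.triples ∧ s ⊆ {v, b, c} := by
  obtain ⟨-, a, b, c, h, hsub⟩ := hs
  have hv' := hsub hv
  simp only [Finset.mem_insert, Finset.mem_singleton] at hv'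
  rcases hv' with rfl | rfl | rfl
  · exact ⟨b, c, h, hsub⟩
  · exact ⟨c, a, rotate_mem h, hsub.trans fun x => by simp; tauto⟩
  · exact ⟨a, b, rotate_mem (rotate_mem h), hsub.trans fun x => by simp; tauto⟩

theorem card_le_three {s : Finset V} (hs : s ∈ R.complex.faces) : s.card ≤ 3 := by
  obtain ⟨-, a, b, c, -, hsub⟩ := hs
  exact (Finset.card_le_card hsub).trans Finset.card_le_three

variable (R)

theorem isTwoDimensional [Nonempty V] : IsTwoDimensional R.complex := by
  refine ⟨fun s => card_le_three, ?_⟩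
  have h := R.nbr_mem_triples (Classical.arbitrary V) 0
  obtain ⟨hab, hbc, hac⟩ := ne_of_mem_triples h
  exact ⟨_, mem_complex_of_mem_triples h, Finset.card_eq_three.2 ⟨_, _, _, hab, hac, hbc, rfl⟩⟩

theorem isCoherentOrientation : IsCoherentOrientation R.complex R.triples where
  triangle a b c h := by
    obtain ⟨hab, hbc, hac⟩ := ne_of_mem_triples h
    exact ⟨hab, hbc, hac, mem_complex_of_mem_triples h⟩
  cyclic a b c h := rotate_mem h
  choice a b c hab hbc hac hf := by
    refine ⟨fun h h' => not_swap_mem h (rotate_mem h'), fun h => ?_⟩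
    obtain ⟨p, q, hpq, hsub⟩ := exists_mem_triples_of_mem hf (v := a) (by simp)
    have hb : b ∈ ({a, p, q} : Finset V) := hsub (by simp)
    have hc : c ∈ ({a, p, q} : Finset V) := hsub (by simp)
    simp only [Finset.mem_insert, Finset.mem_singleton, hab.symm, hac.symm, false_or] at hb hc
    rcases hb with rfl | rfl <;> rcases hc with rfl | rfl
    · exact absurd rfl hbc
    · exact hpq
    · exact absurd (rotate_mem (rotate_mem hpq)) h
    · exact absurd rfl hbc
  coherent a b c d h h' := by
    obtain ⟨j, rfl, rfl⟩ := R.mem_triples_iff.1 h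
    obtain ⟨i, hi, rfl⟩ := R.mem_triples_iff.1 h'
    rw [R.nbr_injective a hi]

theorem isCyclicLink (v : V) : IsCyclicLink R.complex v (R.nbr v) where
  four_le := R.four_le_length v
  injective := R.nbr_injective v
  ne := R.nbr_ne v
  mem_faces i := mem_complex_of_mem_triples (R.nbr_mem_triples v i)
  subset_of_mem s hs hv := by
    obtain ⟨b, c, h, hsub⟩ := exists_mem_triples_of_mem hs hv
    obtain ⟨j, rfl, rfl⟩ := R.mem_triples_iff.1 h
    exact ⟨j, hsub⟩

theorem pair_mem_complex {u v : V} (h : u ∈ R.link v) : {u, v} ∈ R.complex.faces := by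
  obtain ⟨j, rfl⟩ := R.mem_link_iff.1 h
  exact mem_faces_of_subset (mem_complex_of_mem_triples (R.nbr_mem_triples v j))
    (by simp) fun x => by simp; tauto

theorem mem_link_of_mem_complex {s : Finset V} (hs : s ∈ R.complex.faces) {u v : V} (hu : u ∈ s)
    (hv : v ∈ s) (huv : u ≠ v) : u ∈ R.link v := by
  obtain ⟨b, c, h, hsub⟩ := exists_mem_triples_of_mem hs hv
  obtain ⟨j, rfl, rfl⟩ := R.mem_triples_iff.1 h
  have hu' := hsub hu
  simp only [Finset.mem_insert, Finset.mem_singleton, huv, false_or] at hu'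
  rcases hu' with rfl | rfl <;> exact R.mem_link_iff.2 ⟨_, rfl⟩

end RotationSystem

section Topology

variable {V : Type*} [Fintype V] (K : AbstractSimplicialComplex V)

theorem isClosed_cell (A : Finset V) : IsClosed (cell A) := by
  have hzero : IsClosed {x : V → ℝ | ∀ v, v ∉ A → x v = 0} := by
    simp only [Set.ofPred_forall]
    exact isClosed_iInter fun v => isClosed_iInter fun _ =>
      isClosed_eq (continuous_apply v) continuous_const
  exact (isClosed_stdSimplex ℝ V).inter hzero

theorem isCompact_polyhedron : IsCompact (polyhedron K) := by
  have hunion : polyhedron K = ⋃ A ∈ K.faces, cell A := by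
    ext x
    simp [polyhedron, cell]
  rw [hunion]
  exact (Set.toFinite K.faces).isCompact_biUnion fun A _ =>
    (isCompact_stdSimplex ℝ V).of_isClosed_subset (isClosed_cell A) fun _ hx => hx.1

theorem isConnected_polyhedron [DecidableEq V] (o : V) (ho : ∀ u, {u, o} ∈ K.faces) :
    IsConnected (polyhedron K) := by
  have ho' : Pi.single o 1 ∈ polyhedron K :=
    cell_subset_polyhedron (ho o) (single_mem_cell (by simp))
  refine ⟨⟨_, ho'⟩, isPreconnected_of_forall (Pi.single o 1) fun x ⟨hx, A, hA, hxA⟩ => ?_⟩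
  obtain ⟨u, hu⟩ := (K.isRelLowerSet_faces hA).1
  exact ⟨cell A ∪ cell {u, o},
    Set.union_subset (cell_subset_polyhedron hA) (cell_subset_polyhedron (ho u)),
    .inr (single_mem_cell (by simp)), .inl ⟨hx, hxA⟩,
    .union (Pi.single u 1) (single_mem_cell hu) (single_mem_cell (by simp))
      (convex_cell A).isPreconnected (convex_cell _).isPreconnected⟩

end Topology

namespace RotationSystem

variable {V : Type*} [DecidableEq V] [Fintype V] (R : RotationSystem V)

theorem isClosedConnectedSurface (o : V) (ho : ∀ u, u ≠ o → u ∈ R.link o) :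
    IsClosedConnectedSurface (polyhedron R.complex) where
  compact := isCompact_iff_compactSpace.1 (isCompact_polyhedron _)
  hausdorff := inferInstance
  connected := by
    refine isConnected_iff_connectedSpace.1 (isConnected_polyhedron _ o fun u => ?_)
    obtain rfl | hu := eq_or_ne u o
    · simpa using R.complex.singleton_mem u
    · exact R.pair_mem_complex (ho u hu)
  locally_plane x := by
    obtain ⟨v, -, hv⟩ : ∃ v ∈ Finset.univ, 0 < x.1 v :=
      Finset.exists_lt_of_sum_lt (f := fun _ => 0) (by simp [x.2.1.2])
    obtain ⟨e, he⟩ := (R.isCyclicLink v).exists_chart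
    exact ⟨e, he ▸ by simpa [openStar] using hv⟩

theorem card_edges_at (v : V) :
    ((facesOfCard R.complex 2).filter (v ∈ ·)).card = (R.link v).length := by
  obtain ⟨hv, hnodup⟩ := List.nodup_cons.1 (R.nodup v)
  have hne : ∀ u ∈ R.link v, u ≠ v := fun u hu h => hv (h ▸ hu)
  have hedges : (facesOfCard R.complex 2).filter (v ∈ ·) =
      (R.link v).toFinset.image fun u => {u, v} := by
    ext s
    simp only [Finset.mem_filter, mem_facesOfCard, Finset.mem_image, List.mem_toFinset]
    constructor
    · rintro ⟨⟨hs, hcard⟩, hvs⟩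
      obtain ⟨u, hu⟩ := Finset.card_eq_one.1 ((Finset.card_erase_of_mem hvs).trans (by omega))
      have hus : u ∈ s.erase v := hu ▸ Finset.mem_singleton_self u
      rw [Finset.mem_erase] at hus
      refine ⟨u, R.mem_link_of_mem_complex hs hus.2 hvs hus.1, ?_⟩
      rw [Finset.pair_comm, ← hu, Finset.insert_erase hvs]
    · rintro ⟨u, hu, rfl⟩
      exact ⟨⟨R.pair_mem_complex hu, Finset.card_pair (hne u hu)⟩, by simp⟩
  rw [hedges, Finset.card_image_of_injOn, List.toFinset_card_of_nodup hnodup]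
  intro x hx y _ hxy
  have hxy' : x ∈ ({y, v} : Finset V) := by
    rw [← show ({x, v} : Finset V) = {y, v} from hxy]
    simp
  simpa [hne x (List.mem_toFinset.1 hx)] using hxy'

theorem two_mul_edges : 2 * faceCount R.complex 1 = ∑ v, (R.link v).length := by
  have hcount := Finset.sum_card_bipartiteAbove_eq_sum_card_bipartiteBelow
    (s := (Finset.univ : Finset V)) (t := facesOfCard R.complex 2) (fun v e => v ∈ e)
  simp only [Finset.bipartiteAbove, Finset.bipartiteBelow, R.card_edges_at] at hcount
  rw [hcount, faceCount_eq_card, mul_comm, ← smul_eq_mul, ← Finset.sum_const]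
  refine Finset.sum_congr rfl fun e he => ?_
  rw [Finset.filter_univ_mem, (mem_facesOfCard.1 he).2]

theorem isOrientableTriangulation (o : V) (ho : ∀ u, u ≠ o → u ∈ R.link o) {g : ℕ}
    (hg : 6 * Fintype.card V + 12 * g = ∑ v, (R.link v).length + 12) :
    IsOrientableTriangulation R.complex g where
  two_dimensional := haveI : Nonempty V := ⟨o⟩; R.isTwoDimensional
  surface := R.isClosedConnectedSurface o ho
  orientable := ⟨_, R.isCoherentOrientation⟩
  genus := by
    have hle := two_mul_edges_le (R.isClosedConnectedSurface o ho)
    have hge := three_mul_triangles_le R.isCoherentOrientation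
    have hedges := R.two_mul_edges
    rw [eulerChar, faceCount_zero]
    omega

end RotationSystem

section Injectivity

variable {V : Type*} [Fintype V] {ψ : V → E3} {x y : V → ℝ}

theorem sum_sum_mul_sub (hx : x ∈ stdSimplex ℝ V) (hy : y ∈ stdSimplex ℝ V) (h : V → ℝ) :
    ∑ v, ∑ w, x v * y w * (h v - h w) = ∑ v, x v * h v - ∑ w, y w * h w := by
  have hv (v : V) : ∑ w, x v * y w * (h v - h w) = x v * h v - x v * ∑ w, y w * h w := by
    simp only [mul_sub, Finset.sum_sub_distrib, mul_assoc, ← Finset.mul_sum, ← Finset.sum_mul, hy.2,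
      one_mul]
  simp only [hv, Finset.sum_sub_distrib, ← Finset.sum_mul, hx.2, one_mul]

theorem exists_ne_zero_of_mem_stdSimplex (hx : x ∈ stdSimplex ℝ V) : ∃ v, x v ≠ 0 := by
  by_contra! h
  simpa [h] using hx.2

theorem eq_single_of_mem_stdSimplex [DecidableEq V] (hx : x ∈ stdSimplex ℝ V) {v : V}
    (h : ∀ w, x w ≠ 0 → w = v) : x = Pi.single v 1 := by
  have h₀ (w : V) (hw : w ≠ v) : x w = 0 := not_imp_comm.1 (h w) hw
  have h₁ : x v = 1 := (Fintype.sum_eq_single v h₀).symm.trans hx.2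
  ext w
  obtain rfl | hw := eq_or_ne w v
  · simp [h₁]
  · simp [h₀ w hw, hw]

theorem eq_of_sum_mul_eq (hx : x ∈ stdSimplex ℝ V) (hy : y ∈ stdSimplex ℝ V) {h : V → ℝ}
    (heq : ∑ v, x v * h v = ∑ v, y v * h v)
    (hsep : ∀ v w, x v ≠ 0 → y w ≠ 0 → v = w ∨ h w < h v) : x = y := by
  classical
  have hnonneg (v w : V) : 0 ≤ x v * y w * (h v - h w) := by
    by_cases hv : x v = 0
    · simp [hv]
    by_cases hw : y w = 0
    · simp [hw]
    obtain rfl | hlt := hsep v w hv hw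
    · simp
    · exact mul_nonneg (mul_nonneg (hx.1 v) (hy.1 w)) (sub_nonneg.2 hlt.le)
  have hzero (v w : V) : x v * y w * (h v - h w) = 0 := by
    have hsum := (sum_sum_mul_sub hx hy h).trans (sub_eq_zero.2 heq)
    rw [Fintype.sum_eq_zero_iff_of_nonneg fun v => Finset.sum_nonneg fun w _ => hnonneg v w] at hsum
    have hv := congrFun hsum v
    rw [Pi.zero_apply, Fintype.sum_eq_zero_iff_of_nonneg (hnonneg v)] at hv
    exact congrFun hv w
  have hvw (v w : V) (hv : x v ≠ 0) (hw : y w ≠ 0) : v = w :=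
    (hsep v w hv hw).resolve_right fun hlt =>
      mul_ne_zero (mul_ne_zero hv hw) (sub_pos.2 hlt).ne' (hzero v w)
  obtain ⟨v, hv⟩ := exists_ne_zero_of_mem_stdSimplex hx
  obtain ⟨w, hw⟩ := exists_ne_zero_of_mem_stdSimplex hy
  obtain rfl := hvw v w hv hw
  rw [eq_single_of_mem_stdSimplex hx fun u hu => hvw u v hu hw,
    eq_single_of_mem_stdSimplex hy fun u hu => (hvw v u hv hu).symm]

theorem map_simplexwiseLinear {M : Type*} [AddCommGroup M] [Module ℝ M] (f : E3 →ₗ[ℝ] M)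
    (x : V → ℝ) : f (simplexwiseLinear ψ x) = ∑ v, x v • f (ψ v) := by
  simp [simplexwiseLinear]

theorem eq_of_separated (hx : x ∈ stdSimplex ℝ V) (hy : y ∈ stdSimplex ℝ V)
    (hxy : simplexwiseLinear ψ x = simplexwiseLinear ψ y) (f : E3 →ₗ[ℝ] ℝ)
    (hsep : ∀ v w, x v ≠ 0 → y w ≠ 0 → v = w ∨ f (ψ w) < f (ψ v)) : x = y := by
  refine eq_of_sum_mul_eq hx hy ?_ hsep
  simpa only [map_simplexwiseLinear, smul_eq_mul] using congrArg f hxy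

theorem eq_of_affineIndependent {ι : Type*} [Finite ι] {g : ι → V}
    (hg : AffineIndependent ℝ (ψ ∘ g)) (hx : x ∈ stdSimplex ℝ V) (hy : y ∈ stdSimplex ℝ V)
    (hxy : simplexwiseLinear ψ x = simplexwiseLinear ψ y) (hxg : ∀ v, x v ≠ 0 → v ∈ Set.range g)
    (hyg : ∀ v, y v ≠ 0 → v ∈ Set.range g) : x = y := by
  have := Fintype.ofFinite ι
  have hinj : Function.Injective g := hg.injective.of_comp
  have h₀ (v : V) (hv : v ∉ Set.range g) : x v - y v = 0 := by
    rw [not_imp_comm.1 (hxg v) hv, not_imp_comm.1 (hyg v) hv, sub_self]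
  have hsum : ∑ i, (x (g i) - y (g i)) = 0 := by
    rw [Fintype.sum_of_injective g hinj _ _ h₀ fun _ => rfl, Finset.sum_sub_distrib, hx.2, hy.2,
      sub_self]
  have hcomb : ∑ i, (x (g i) - y (g i)) • (ψ ∘ g) i = 0 := by
    refine (Fintype.sum_of_injective g hinj _ (fun v => (x v - y v) • ψ v)
      (fun v hv => by rw [h₀ v hv, zero_smul]) fun _ => rfl).trans ?_
    simpa only [sub_smul, Finset.sum_sub_distrib, simplexwiseLinear] using sub_eq_zero.2 hxy
  ext v
  by_cases hv : v ∈ Set.range g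
  · obtain ⟨i, rfl⟩ := hv
    exact sub_eq_zero.1 (affineIndependent_iff.1 hg Finset.univ _ hsum hcomb i (Finset.mem_univ i))
  · exact sub_eq_zero.1 (h₀ v hv)

end Injectivity

section IntPoint

theorem affineIndependent_of_det_ne_zero {n : ℕ} {p : Fin (n + 1) → EuclideanSpace ℝ (Fin n)}
    (h : (Matrix.of fun i j => p (Fin.succ i) j - p 0 j).det ≠ 0) : AffineIndependent ℝ p := by
  rw [affineIndependent_iff_linearIndependent_vsub ℝ p 0,
    ← linearIndependent_equiv (finSuccAboveEquiv 0)]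
  exact .of_comp (WithLp.linearEquiv 2 ℝ (Fin n → ℝ)).toLinearMap
    (Matrix.linearIndependent_rows_of_det_ne_zero h)

/-- The points of three-space with integer coordinates, also used as normal vectors of planes. -/
structure IntPoint where
  x : ℤ
  y : ℤ
  z : ℤ
  deriving DecidableEq

namespace IntPoint

/-- The point of Euclidean space with given integer coordinates. -/
def toE3 (p : IntPoint) : E3 := !₂[(p.x : ℝ), (p.y : ℝ), (p.z : ℝ)]

/-- The scalar product of integer vectors. -/
def dot (n p : IntPoint) : ℤ := n.x * p.x + n.y * p.y + n.z * p.z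

/-- Six times the signed volume of a tetrahedron, whose vanishing decides coplanarity. -/
def volume (a b c d : IntPoint) : ℤ :=
  (b.x - a.x) * ((c.y - a.y) * (d.z - a.z) - (c.z - a.z) * (d.y - a.y)) -
    (b.y - a.y) * ((c.x - a.x) * (d.z - a.z) - (c.z - a.z) * (d.x - a.x)) +
    (b.z - a.z) * ((c.x - a.x) * (d.y - a.y) - (c.y - a.y) * (d.x - a.x))

theorem inner_toE3 (n p : IntPoint) : inner ℝ n.toE3 p.toE3 = n.dot p := by
  simp [toE3, dot, PiLp.inner_apply, Fin.sum_univ_three, mul_comm]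

theorem affineIndependent_toE3 {a b c d : IntPoint} (h : volume a b c d ≠ 0) :
    AffineIndependent ℝ ![a.toE3, b.toE3, c.toE3, d.toE3] := by
  apply affineIndependent_of_det_ne_zero
  convert Int.cast_ne_zero (α := ℝ).2 h using 1
  simp [Matrix.det_fin_three, toE3, volume]
  ring

end IntPoint

end IntPoint

section Isomorphism

variable {V W : Type*} {K : AbstractSimplicialComplex V} {L : AbstractSimplicialComplex W}
  {e : V ≃ W}

theorem IsIsomorphism.symm (he : IsIsomorphism K L e) : IsIsomorphism L K e.symm := fun s => by
  rw [he (s.map e.symm.toEmbedding)]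
  simp [Finset.map_map]

theorem comp_symm_mem_polyhedron [Fintype V] [Fintype W] (he : IsIsomorphism K L e) {x : V → ℝ}
    (hx : x ∈ polyhedron K) : (fun w => x (e.symm w)) ∈ polyhedron L := by
  obtain ⟨hx, s, hs, hsupp⟩ := hx
  refine ⟨⟨fun w => hx.1 _, (Equiv.sum_comp e.symm x).trans hx.2⟩, _, (he s).1 hs,
    fun w hw => hsupp _ fun h => hw ?_⟩
  exact Finset.mem_map.2 ⟨_, h, e.apply_symm_apply w⟩

end Isomorphism

section Symmetry

variable {V : Type*} [Fintype V] {K : AbstractSimplicialComplex V} {ψ : V → E3}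
  {R : E3 ≃ᵃⁱ[ℝ] E3} {σ : Equiv.Perm V}

theorem map_simplexwiseLinear_eq_comp_symm (hψ : ∀ v, R (ψ v) = ψ (σ v)) {x : V → ℝ}
    (hx : ∑ v, x v = 1) :
    R (simplexwiseLinear ψ x) = simplexwiseLinear ψ fun v => x (σ.symm v) := calc
  R (simplexwiseLinear ψ x) = ∑ v, x v • ψ (σ v) := by
    have h := Finset.univ.map_affineCombination ψ x hx R.toAffineEquiv.toAffineMap
    simp only [Finset.affineCombination_eq_linear_combination _ _ _ hx] at h
    exact h.trans (Finset.sum_congr rfl fun v _ => congrArg (x v • ·) (hψ v))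
  _ = simplexwiseLinear ψ fun v => x (σ.symm v) := by
    refine Fintype.sum_equiv σ _ _ fun v => ?_
    simp only [Equiv.symm_apply_apply]

theorem isGeometricSymmetry (hσ : IsIsomorphism K K σ) (hψ : ∀ v, R (ψ v) = ψ (σ v)) :
    IsGeometricSymmetry K ψ R := by
  have hR (x) (hx : x ∈ polyhedron K) := map_simplexwiseLinear_eq_comp_symm hψ hx.1.2
  refine ⟨Set.Subset.antisymm ?_ ?_, σ, hσ, hR⟩
  · rintro _ ⟨_, ⟨x, hx, rfl⟩, rfl⟩
    exact ⟨_, comp_symm_mem_polyhedron hσ hx, (hR x hx).symm⟩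
  · rintro _ ⟨x, hx, rfl⟩
    have hx' := comp_symm_mem_polyhedron hσ.symm hx
    refine ⟨_, ⟨_, hx', rfl⟩, (hR _ hx').trans ?_⟩
    simp

/-- The third coordinate axis. -/
def verticalAxis : AffineSubspace ℝ E3 :=
  (Submodule.span ℝ {(EuclideanSpace.single 2 1 : E3)}).toAffineSubspace

instance : Nonempty verticalAxis := ⟨⟨0, Submodule.zero_mem _⟩⟩

/-- The half-turn about the third coordinate axis. -/
def halfTurn : E3 ≃ᵃⁱ[ℝ] E3 := EuclideanGeometry.reflection verticalAxis

theorem isHalfTurn_halfTurn : IsHalfTurn halfTurn := by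
  refine ⟨verticalAxis, inferInstance, ?_, rfl⟩
  rw [verticalAxis, Submodule.toAffineSubspace_direction]
  exact finrank_span_singleton (by simp)

theorem halfTurn_apply (q : E3) : halfTurn q = !₂[-q 0, -q 1, q 2] := by
  have hmem : (EuclideanSpace.single 2 (q 2) : E3) ∈ verticalAxis :=
    Submodule.mem_span_singleton.2 ⟨q 2, by ext i; fin_cases i <;> simp⟩
  have horth : (!₂[q 0, q 1, 0] : E3) ∈ verticalAxis.directionᗮ := by
    rw [verticalAxis, Submodule.toAffineSubspace_direction,
      Submodule.mem_orthogonal_singleton_iff_inner_right, EuclideanSpace.inner_single_left]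
    simp
  have hq : (!₂[q 0, q 1, 0] : E3) +ᵥ (EuclideanSpace.single 2 (q 2) : E3) = q := by
    ext i
    fin_cases i <;> simp
  have h := EuclideanGeometry.reflection_orthogonal_vadd hmem horth
  rw [hq] at h
  rw [halfTurn, h]
  ext i
  fin_cases i <;> simp

/-- The image of an integer point under `halfTurn`. -/
def IntPoint.halfTurn (p : IntPoint) : IntPoint := ⟨-p.x, -p.y, p.z⟩

theorem halfTurn_toE3 (p : IntPoint) : halfTurn p.toE3 = p.halfTurn.toE3 := by
  rw [halfTurn_apply]
  ext i
  fin_cases i <;> simp [IntPoint.toE3, IntPoint.halfTurn]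

end Symmetry

section Invariant

variable {V W : Type*} [Fintype V] [DecidableEq V] [Fintype W] [DecidableEq W]
  {K : AbstractSimplicialComplex V} {L : AbstractSimplicialComplex W}

/-- The sum over the triangles at `v` of the product of the values of `f` at the vertices, which is
one step in the refinement of a vertex labelling to an isomorphism invariant. -/
def triangleSum (K : AbstractSimplicialComplex V) (f : V → ℕ) (v : V) : ℕ :=
  ∑ s ∈ (facesOfCard K 3).filter (v ∈ ·), ∏ u ∈ s, f u

theorem triangleSum_of_isIsomorphism {e : V ≃ W} (he : IsIsomorphism K L e) {f : V → ℕ}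
    {g : W → ℕ} (hfg : ∀ v, g (e v) = f v) (v : V) :
    triangleSum L g (e v) = triangleSum K f v := by
  refine (Finset.sum_equiv e.finsetCongr (fun s => ?_) fun s _ => ?_).symm
  · simp [mem_facesOfCard, he s]
  · simp [Finset.prod_map, hfg]

theorem iterate_triangleSum_of_isIsomorphism {e : V ≃ W} (he : IsIsomorphism K L e) (n : ℕ)
    (v : V) :
    (triangleSum L)^[n] (fun _ => 1) (e v) = (triangleSum K)^[n] (fun _ => 1) v := by
  induction n generalizing v with
  | zero => rfl
  | succ n ih =>
    rw [Function.iterate_succ_apply', Function.iterate_succ_apply']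
    exact triangleSum_of_isIsomorphism he ih v

/-- An isomorphism invariant of complexes, obtained by iterating `triangleSum`. Four steps are
needed for it to distinguish all complexes in `surfaces`. -/
def triangleInvariant (K : AbstractSimplicialComplex V) : ℕ :=
  ∑ v, (triangleSum K)^[4] (fun _ => 1) v

theorem triangleInvariant_eq_of_isomorphic (h : Isomorphic K L) :
    triangleInvariant K = triangleInvariant L := by
  obtain ⟨e, he⟩ := h
  rw [triangleInvariant, triangleInvariant, ← Equiv.sum_comp e]
  simp only [iterate_triangleSum_of_isIsomorphism he]

end Invariant

namespace RotationSystem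

variable {V : Type*} (R : RotationSystem V)

theorem nodup_cyclicPairs (v : V) : (cyclicPairs (R.link v)).Nodup := by
  refine .of_map Prod.fst ?_
  rw [cyclicPairs, List.map_fst_zip (by simp)]
  exact (List.nodup_cons.1 (R.nodup v)).2

variable [DecidableEq V]

theorem injOn_cyclicPairs (v : V) :
    Set.InjOn (fun p : V × V => ({v, p.1, p.2} : Finset V)) {p | p ∈ cyclicPairs (R.link v)} := by
  rintro ⟨b, c⟩ hbc ⟨b', c'⟩ hbc' (hsets : ({v, b, c} : Finset V) = {v, b', c'})
  obtain ⟨hvb, hne, hvc⟩ := R.ne_of_mem_triples hbc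
  have hb : b ∈ ({v, b', c'} : Finset V) := hsets ▸ (by simp)
  have hc : c ∈ ({v, b', c'} : Finset V) := hsets ▸ (by simp)
  simp only [Finset.mem_insert, Finset.mem_singleton, hvb.symm, hvc.symm, false_or] at hb hc
  rcases hb with rfl | rfl <;> rcases hc with rfl | rfl
  · exact absurd rfl hne
  · rfl
  · exact absurd hbc' (R.not_swap_mem hbc)
  · exact absurd rfl hne

variable [Fintype V]

theorem filter_mem_facesOfCard_three (v : V) :
    (facesOfCard R.complex 3).filter (v ∈ ·) =
      (cyclicPairs (R.link v)).toFinset.image fun p => {v, p.1, p.2} := by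
  ext s
  simp only [Finset.mem_filter, mem_facesOfCard, Finset.mem_image, List.mem_toFinset]
  constructor
  · rintro ⟨⟨hs, hcard⟩, hv⟩
    obtain ⟨b, c, h, hsub⟩ := exists_mem_triples_of_mem hs hv
    exact ⟨(b, c), h,
      (Finset.eq_of_subset_of_card_le hsub (hcard ▸ Finset.card_le_three)).symm⟩
  · rintro ⟨⟨b, c⟩, h, rfl⟩
    obtain ⟨hvb, hbc, hvc⟩ := R.ne_of_mem_triples h
    exact ⟨⟨mem_complex_of_mem_triples h, Finset.card_eq_three.2 ⟨_, _, _, hvb, hvc, hbc, rfl⟩⟩,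
      by simp⟩

theorem triangleSum_complex (f : V → ℕ) (v : V) :
    triangleSum R.complex f v =
      f v * ((cyclicPairs (R.link v)).map fun p => f p.1 * f p.2).sum := by
  have hinj := R.injOn_cyclicPairs v
  rw [triangleSum, R.filter_mem_facesOfCard_three,
    Finset.sum_image (by simpa [Set.InjOn] using hinj),
    ← List.sum_toFinset _ (R.nodup_cyclicPairs v), Finset.mul_sum]
  refine Finset.sum_congr rfl fun p hp => ?_
  obtain ⟨hvb, hbc, hvc⟩ :=
    ne_of_mem_triples (R := R) (a := v) (b := p.1) (c := p.2) (List.mem_toFinset.1 hp)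
  rw [Finset.prod_insert (by simp [hvb, hvc]), Finset.prod_pair hbc]

end RotationSystem

section CompatibleTriangles

variable {V : Type*}

/-- Whether a list consists of the four vertices of a nondegenerate tetrahedron. -/
def isTetrahedron (p : V → IntPoint) : List V → Bool
  | [a, b, c, d] => decide (IntPoint.volume (p a) (p b) (p c) (p d) ≠ 0)
  | _ => false

/-- In the direction `n`, all vertices in `s` lie above the vertices in `t` different from them. The
simplices spanned by `s` and `t` then meet at most in a common vertex. -/
def IsAbove (p : V → IntPoint) (n : IntPoint) (s t : List V) : Prop :=
  ∀ v ∈ s, ∀ w ∈ t, v = w ∨ n.dot (p w) < n.dot (p v)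

/-- The two ways in which two triangles of a complex are seen to meet in a common face only: they
are contained in a nondegenerate tetrahedron, or they are separated by a plane through at most one
vertex. -/
def AreCompatible (p : V → IntPoint) (s t : List V) : Prop :=
  (∃ l, s ⊆ l ∧ t ⊆ l ∧ isTetrahedron p l) ∨ ∃ n, IsAbove p n s t ∨ IsAbove p n t s

instance (p : V → IntPoint) : Std.Symm (AreCompatible p) where
  symm _ _ := Or.imp (fun ⟨l, hs, ht, hl⟩ => ⟨l, ht, hs, hl⟩) fun ⟨n, hn⟩ => ⟨n, hn.symm⟩

variable [Fintype V] {p : V → IntPoint} {x y : V → ℝ}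

theorem eq_of_isTetrahedron {l : List V} (hl : isTetrahedron p l) (hx : x ∈ stdSimplex ℝ V)
    (hy : y ∈ stdSimplex ℝ V)
    (hxy : simplexwiseLinear (fun v => (p v).toE3) x = simplexwiseLinear (fun v => (p v).toE3) y)
    (hxl : ∀ v, x v ≠ 0 → v ∈ l) (hyl : ∀ v, y v ≠ 0 → v ∈ l) : x = y := by
  match l, hl with
  | [a, b, c, d], hl =>
    have hrange (v : V) (hv : v ∈ [a, b, c, d]) : v ∈ Set.range ![a, b, c, d] := by
      simpa [or_comm, or_assoc, or_left_comm] using hv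
    refine eq_of_affineIndependent (g := ![a, b, c, d]) ?_ hx hy hxy
      (fun v hv => hrange v (hxl v hv)) fun v hv => hrange v (hyl v hv)
    convert IntPoint.affineIndependent_toE3 (of_decide_eq_true hl) using 1
    ext i : 1
    fin_cases i <;> rfl

theorem eq_of_isAbove {n : IntPoint} {s t : List V} (h : IsAbove p n s t)
    (hx : x ∈ stdSimplex ℝ V) (hy : y ∈ stdSimplex ℝ V)
    (hxy : simplexwiseLinear (fun v => (p v).toE3) x = simplexwiseLinear (fun v => (p v).toE3) y)
    (hxs : ∀ v, x v ≠ 0 → v ∈ s) (hyt : ∀ v, y v ≠ 0 → v ∈ t) : x = y := by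
  refine eq_of_separated hx hy hxy (innerₗ E3 n.toE3) fun v w hv hw => ?_
  simpa only [innerₗ_apply_apply, IntPoint.inner_toE3, Int.cast_lt] using
    h v (hxs v hv) w (hyt w hw)

theorem eq_of_areCompatible {s t : List V} (h : AreCompatible p s t) (hx : x ∈ stdSimplex ℝ V)
    (hy : y ∈ stdSimplex ℝ V)
    (hxy : simplexwiseLinear (fun v => (p v).toE3) x = simplexwiseLinear (fun v => (p v).toE3) y)
    (hxs : ∀ v, x v ≠ 0 → v ∈ s) (hyt : ∀ v, y v ≠ 0 → v ∈ t) : x = y := by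
  rcases h with ⟨l, hsl, htl, hl⟩ | ⟨n, hn | hn⟩
  · exact eq_of_isTetrahedron hl hx hy hxy (fun v hv => hsl (hxs v hv)) fun v hv => htl (hyt v hv)
  · exact eq_of_isAbove hn hx hy hxy hxs hyt
  · exact (eq_of_isAbove hn hy hx hxy.symm hyt hxs).symm

theorem isPolyhedralEmbedding_of_areCompatible {K : AbstractSimplicialComplex V}
    {T : List (List V)} (hK : ∀ s ∈ K.faces, ∃ t ∈ T, ∀ v ∈ s, v ∈ t)
    (hT : ∀ s ∈ T, ∀ t ∈ T, AreCompatible p s t) :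
    IsPolyhedralEmbedding K fun v => (p v).toE3 := by
  have hcarrier (x) (hx : x ∈ polyhedron K) : ∃ t ∈ T, ∀ v, x v ≠ 0 → v ∈ t := by
    obtain ⟨-, s, hs, hxs⟩ := hx
    obtain ⟨t, ht, hst⟩ := hK s hs
    exact ⟨t, ht, fun v hv => hst v (not_imp_comm.1 (hxs v) hv)⟩
  intro x hx y hy hxy
  obtain ⟨s, hs, hxs⟩ := hcarrier x hx
  obtain ⟨t, ht, hyt⟩ := hcarrier y hy
  exact eq_of_areCompatible (hT s hs t ht) hx.1 hy.1 hxy hxs hyt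

end CompatibleTriangles

section IsSubset

variable {α : Type*} [Encodable α] {l l' : List α}

/-- The number whose binary digits mark the entries of a list. -/
def bits (l : List α) : ℕ :=
  l.foldr (fun a m => 2 ^ Encodable.encode a ||| m) 0

/-- Inclusion of lists, tested on numbers for the sake of fast evaluation in the kernel. -/
def isSubset (l l' : List α) : Bool :=
  bits l &&& bits l' == bits l

theorem testBit_bits {a : α} : (bits l).testBit (Encodable.encode a) = true ↔ a ∈ l := by
  induction l with
  | nil => simp [bits]
  | cons b l ih =>
    change (2 ^ Encodable.encode b ||| bits l).testBit _ = true ↔ _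
    rw [Nat.testBit_or, Bool.or_eq_true, ih, Nat.testBit_two_pow, decide_eq_true_iff,
      Encodable.encode_inj, List.mem_cons, eq_comm]

theorem subset_of_isSubset (h : isSubset l l') : l ⊆ l' := fun a ha => by
  have hbits : bits l &&& bits l' = bits l := eq_of_beq h
  rw [← testBit_bits, ← hbits, Nat.testBit_and, Bool.and_eq_true] at ha
  exact testBit_bits.1 ha.2

end IsSubset

/-- The involution of the vertices that fixes `0` and swaps `2 k + 1` and `2 k + 2`. It is induced
by the half-turn. -/
def swapPairs : Equiv.Perm (Fin 11) :=
  Function.Involutive.toPerm (fun v => [0, 2, 1, 4, 3, 6, 5, 8, 7, 10, 9].getD v 0)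
    fun v => by revert v; decide

/-- A symmetric polyhedral surface with eleven vertices, given by the cyclic links and the integer
positions of its vertices. The triangles and the normals of separating planes are redundant; they
serve to verify the embedding. -/
structure SurfaceData where
  links : List (List (Fin 11))
  triangles : List (List (Fin 11))
  positions : List IntPoint
  normals : List IntPoint

namespace SurfaceData

variable (D : SurfaceData)

/-- The cyclic link of a vertex. -/
def link (v : Fin 11) : List (Fin 11) := D.links.getD v []

/-- The position of a vertex. -/
def position (v : Fin 11) : IntPoint := D.positions.getD v ⟨0, 0, 0⟩

/-- The conditions under which the data describe a triangulation of genus four with a polyhedral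
embedding that is symmetric under the half-turn. -/
structure IsValid : Prop where
  four_le_length : ∀ v, 4 ≤ (D.link v).length
  nodup : ∀ v, (v :: D.link v).Nodup
  cyclic : ∀ v, ∀ p ∈ cyclicPairs (D.link v), (p.2, v) ∈ cyclicPairs (D.link p.1)
  swapPairs_mem : ∀ v, ∀ p ∈ cyclicPairs (D.link v),
    (swapPairs p.1, swapPairs p.2) ∈ cyclicPairs (D.link (swapPairs v))
  exists_hub : ∃ o, ∀ u, u ≠ o → u ∈ D.link o
  sum_length : ∑ v, (D.link v).length = 102
  exists_triangle : ∀ v, ∀ p ∈ cyclicPairs (D.link v),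
    ∃ t ∈ D.triangles, v ∈ t ∧ p.1 ∈ t ∧ p.2 ∈ t
  areCompatible : ∀ s ∈ D.triangles, ∀ t ∈ D.triangles, AreCompatible D.position s t
  position_swapPairs : ∀ v, D.position (swapPairs v) = (D.position v).halfTurn

/-- The eleven vertices, listed explicitly since the kernel evaluates explicit lists fastest. -/
def vertices : List (Fin 11) := [0, 1, 2, 3, 4, 5, 6, 7, 8, 9, 10]

/-- One step of `triangleSum` for labellings given as lists. -/
def triangleSums (l : List ℕ) : List ℕ :=
  vertices.map fun v : Fin 11 =>
    l.getD v 0 * ((cyclicPairs (D.link v)).map fun p => l.getD p.1 0 * l.getD p.2 0).sum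

/-- The value of `triangleInvariant`, computed with lists. -/
def invariant : ℕ := (D.triangleSums^[4] (List.replicate 11 1)).sum

theorem mem_vertices (v : Fin 11) : v ∈ vertices := by
  revert v
  decide

theorem getD_map_vertices (f : Fin 11 → ℕ) (v : Fin 11) : (vertices.map f).getD v 0 = f v := by
  fin_cases v <;> rfl

theorem sum_map_vertices (f : Fin 11 → ℕ) : (vertices.map f).sum = ∑ v, f v := by
  simp [Fin.sum_univ_succ, vertices]

namespace IsValid

variable {D} (hD : D.IsValid)

/-- The rotation system given by the links of valid data. -/
def rotationSystem : RotationSystem (Fin 11) where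
  link := D.link
  four_le_length := hD.four_le_length
  nodup := hD.nodup
  cyclic := hD.cyclic

/-- The simplicial complex described by valid data. -/
def complex : AbstractSimplicialComplex (Fin 11) := hD.rotationSystem.complex

theorem isVertexMinimalTriangulation : IsVertexMinimalTriangulation hD.complex 4 := by
  obtain ⟨o, ho⟩ := hD.exists_hub
  have hsum : ∑ v, (hD.rotationSystem.link v).length = 102 := hD.sum_length
  refine ⟨hD.rotationSystem.isOrientableTriangulation o ho (by simp [hsum]), fun m L hL => ?_⟩
  simpa using eleven_le_card hL

theorem map_swapPairs_mem {s : Finset (Fin 11)} (hs : s ∈ hD.complex.faces) :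
    s.map swapPairs.toEmbedding ∈ hD.complex.faces := by
  obtain ⟨hne, a, b, c, h, hsub⟩ := hs
  refine ⟨hne.map, swapPairs a, swapPairs b, swapPairs c, hD.swapPairs_mem a (b, c) h, ?_⟩
  simpa using Finset.map_subset_map (f := swapPairs.toEmbedding).2 hsub

theorem isIsomorphism_swapPairs : IsIsomorphism hD.complex hD.complex swapPairs := by
  refine fun s => ⟨hD.map_swapPairs_mem, fun hs => ?_⟩
  have hinv (v : Fin 11) : swapPairs.symm (swapPairs.symm v) = v := swapPairs.left_inv v
  convert hD.map_swapPairs_mem hs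
  ext v
  simp [hinv]

theorem isGeometricSymmetry :
    IsGeometricSymmetry hD.complex (fun v => (D.position v).toE3) halfTurn :=
  TriangulatedSurface.isGeometricSymmetry hD.isIsomorphism_swapPairs fun v => by
    rw [halfTurn_toE3, hD.position_swapPairs]

theorem isPolyhedralEmbedding :
    IsPolyhedralEmbedding hD.complex fun v => (D.position v).toE3 := by
  refine isPolyhedralEmbedding_of_areCompatible (fun s hs => ?_) hD.areCompatible
  obtain ⟨-, a, b, c, h, hsub⟩ := hs
  obtain ⟨t, ht, hat, hbt, hct⟩ := hD.exists_triangle a (b, c) h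
  refine ⟨t, ht, fun v hv => ?_⟩
  have hv' := hsub hv
  simp only [Finset.mem_insert, Finset.mem_singleton] at hv'
  rcases hv' with rfl | rfl | rfl <;> assumption

theorem getD_triangleSums {l : List ℕ} {f : Fin 11 → ℕ} (hl : ∀ v : Fin 11, l.getD v 0 = f v)
    (v : Fin 11) : (D.triangleSums l).getD v 0 = triangleSum hD.complex f v := by
  rw [triangleSums, getD_map_vertices, complex, RotationSystem.triangleSum_complex]
  simp only [hl]
  rfl

theorem triangleInvariant_complex : triangleInvariant hD.complex = D.invariant := by
  have hiter (n : ℕ) (v : Fin 11) : (D.triangleSums^[n] (List.replicate 11 1)).getD v 0 =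
      (triangleSum hD.complex)^[n] (fun _ => 1) v := by
    induction n generalizing v with
    | zero => fin_cases v <;> rfl
    | succ n ih =>
      rw [Function.iterate_succ_apply', Function.iterate_succ_apply']
      exact hD.getD_triangleSums ih v
  rw [triangleInvariant, invariant, Function.iterate_succ_apply' D.triangleSums, triangleSums,
    sum_map_vertices]
  refine Finset.sum_congr rfl fun v _ => ?_
  rw [← hiter, Function.iterate_succ_apply' D.triangleSums, triangleSums, getD_map_vertices]

end IsValid

end SurfaceData

set_option maxHeartbeats 4000000 in
-- The list has several thousand numerals, each of which is elaborated separately.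
/-- Twenty-eight surfaces that are symmetric under the half-turn. The normals are in greedy order
for the number of pairs of triangles they separate, so that few of them are tried per pair. -/
def surfaces : List SurfaceData := [
  { links := [[5, 7, 10, 6, 8, 9], [2, 4, 7, 9, 6, 10, 8, 5, 3], [1, 3, 8, 10, 5, 9, 7, 6, 4],
      [1, 5, 4, 6, 9, 10, 7, 8, 2], [1, 2, 6, 3, 5, 10, 9, 8, 7], [0, 9, 2, 10, 4, 3, 1, 8, 6, 7],
      [0, 10, 1, 9, 3, 4, 2, 7, 5, 8], [0, 5, 6, 2, 9, 1, 4, 8, 3, 10],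
      [0, 6, 5, 1, 10, 2, 3, 7, 4, 9], [0, 8, 4, 10, 3, 6, 1, 7, 2, 5],
      [0, 7, 3, 9, 4, 5, 2, 8, 1, 6]]
    triangles := [[0, 5, 7], [0, 6, 8], [0, 5, 9], [0, 6, 10], [0, 7, 10], [0, 8, 9], [1, 2, 3],
      [1, 2, 4], [3, 4, 5], [3, 4, 6], [5, 6, 7], [5, 6, 8], [3, 7, 8], [4, 7, 8], [3, 9, 10],
      [4, 9, 10], [1, 3, 5], [2, 4, 6], [1, 6, 9], [2, 5, 10], [1, 6, 10], [2, 5, 9], [1, 5, 8],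
      [2, 6, 7], [3, 6, 9], [4, 5, 10], [1, 8, 10], [2, 7, 9], [3, 7, 10], [4, 8, 9], [1, 4, 7],
      [2, 3, 8], [1, 7, 9], [2, 8, 10]]
    positions := [⟨0, 0, -5⟩, ⟨-4, 0, 5⟩, ⟨4, 0, 5⟩, ⟨-1, 1, 1⟩, ⟨1, -1, 1⟩, ⟨3, 4, -4⟩,
      ⟨-3, -4, -4⟩, ⟨-3, -1, 2⟩, ⟨3, 1, 2⟩, ⟨2, -3, 0⟩, ⟨-2, 3, 0⟩]
    normals := [⟨5, 1, -5⟩, ⟨5, 1, 5⟩, ⟨1, 9, -4⟩, ⟨-1, -7, -4⟩, ⟨1, -4, 0⟩, ⟨2, 3, -5⟩,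
      ⟨2, 3, 5⟩, ⟨1, 0, 0⟩, ⟨-33, 25, 12⟩, ⟨33, -25, 12⟩, ⟨5, 3, 5⟩, ⟨5, 3, -5⟩, ⟨1, 5, 2⟩,
      ⟨3, -1, -1⟩, ⟨3, -1, 1⟩, ⟨2, 3, -3⟩, ⟨0, 1, -5⟩, ⟨1, -2, 0⟩, ⟨1, -4, 3⟩, ⟨1, 5, -1⟩,
      ⟨-1, 17, 5⟩, ⟨1, -17, 5⟩, ⟨2, 3, 3⟩, ⟨1, -4, -3⟩, ⟨1, 7, -4⟩, ⟨0, 1, 3⟩, ⟨3, 2, -5⟩,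
      ⟨3, 2, 5⟩, ⟨-1, -9, -4⟩, ⟨13, 14, 19⟩, ⟨-13, -14, 19⟩, ⟨3, -2, -2⟩, ⟨3, -2, 2⟩, ⟨4, 3, -1⟩,
      ⟨5, -1, -1⟩, ⟨5, -1, 1⟩, ⟨2, 3, -4⟩, ⟨2, 3, 4⟩, ⟨7, -3, 2⟩, ⟨-7, 3, 2⟩, ⟨1, -26, -6⟩,
      ⟨-1, 26, -6⟩, ⟨1, 2, 1⟩, ⟨2, -1, -1⟩, ⟨2, -1, 1⟩, ⟨4, 3, 1⟩, ⟨0, 5, -2⟩, ⟨0, 5, 2⟩,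
      ⟨1, 5, -2⟩] },
  { links := [[1, 9, 3, 8, 5, 2, 10, 4, 7, 6], [0, 6, 10, 8, 2, 7, 4, 9],
      [0, 5, 9, 7, 1, 8, 3, 10], [0, 9, 6, 4, 5, 7, 10, 2, 8], [0, 10, 5, 3, 6, 8, 9, 1, 7],
      [0, 8, 6, 7, 3, 4, 10, 9, 2], [0, 7, 5, 8, 4, 3, 9, 10, 1], [0, 4, 1, 2, 9, 8, 10, 3, 5, 6],
      [0, 3, 2, 1, 10, 7, 9, 4, 6, 5], [0, 1, 4, 8, 7, 2, 5, 10, 6, 3],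
      [0, 2, 3, 7, 8, 1, 6, 9, 5, 4]]
    triangles := [[1, 2, 7], [1, 2, 8], [3, 4, 5], [3, 4, 6], [5, 6, 7], [5, 6, 8], [7, 8, 9],
      [7, 8, 10], [5, 9, 10], [6, 9, 10], [1, 4, 7], [2, 3, 8], [0, 1, 9], [0, 2, 10], [1, 4, 9],
      [2, 3, 10], [0, 1, 6], [0, 2, 5], [1, 6, 10], [2, 5, 9], [1, 8, 10], [2, 7, 9], [0, 3, 9],
      [0, 4, 10], [3, 6, 9], [4, 5, 10], [3, 7, 10], [4, 8, 9], [3, 5, 7], [4, 6, 8], [0, 3, 8],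
      [0, 4, 7], [0, 5, 8], [0, 6, 7]]
    positions := [⟨0, 0, -8⟩, ⟨6, -3, -2⟩, ⟨-6, 3, -2⟩, ⟨-3, 8, -9⟩, ⟨3, -8, -9⟩, ⟨-7, 7, -7⟩,
      ⟨7, -7, -7⟩, ⟨-4, 1, -1⟩, ⟨4, -1, -1⟩, ⟨8, 6, 8⟩, ⟨-8, -6, 8⟩]
    normals := [⟨2, -3, -2⟩, ⟨2, -3, 2⟩, ⟨18, 35, 33⟩, ⟨4, 3, -3⟩, ⟨3, -1, -1⟩, ⟨3, 1, 3⟩,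
      ⟨16, 15, 8⟩, ⟨2, 1, -3⟩, ⟨5, 3, 4⟩, ⟨-18, -35, 33⟩, ⟨-16, -15, 8⟩, ⟨-7, -30, -27⟩,
      ⟨-3, -10, -8⟩, ⟨7, 29, -26⟩, ⟨3, 1, -2⟩, ⟨4, -6, 5⟩, ⟨7, 2, 4⟩, ⟨-5, -15, 13⟩, ⟨2, 1, -5⟩,
      ⟨2, 1, 5⟩, ⟨-4, 6, 5⟩, ⟨4, 3, 3⟩, ⟨5, 3, -2⟩, ⟨1, 5, -4⟩, ⟨1, 2, 0⟩, ⟨1, 2, -3⟩, ⟨1, 2, 3⟩,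
      ⟨5, 2, 4⟩, ⟨-7, -2, 4⟩, ⟨6, 4, -5⟩, ⟨21, 22, 9⟩, ⟨-21, -22, 9⟩, ⟨3, -5, -4⟩, ⟨3, -5, 4⟩,
      ⟨3, 5, -5⟩, ⟨3, 5, 5⟩, ⟨3, 9, 8⟩, ⟨-13, 16, 14⟩, ⟨13, -16, 14⟩, ⟨5, 22, -20⟩, ⟨2, 1, 1⟩,
      ⟨1, -2, -2⟩, ⟨1, -2, 2⟩, ⟨4, 3, -2⟩, ⟨4, 3, 2⟩, ⟨2, 5, -1⟩, ⟨2, 5, 1⟩, ⟨-6, -4, -5⟩] },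
  { links := [[3, 6, 8, 10, 4, 5, 7, 9], [2, 5, 4, 9, 10, 8, 7, 6], [1, 6, 3, 10, 9, 7, 8, 5],
      [0, 9, 5, 8, 4, 7, 10, 2, 6], [0, 10, 6, 7, 3, 8, 9, 1, 5], [0, 4, 1, 2, 8, 3, 9, 6, 10, 7],
      [0, 3, 2, 1, 7, 4, 10, 5, 9, 8], [0, 5, 10, 3, 4, 6, 1, 8, 2, 9],
      [0, 6, 9, 4, 3, 5, 2, 7, 1, 10], [0, 7, 2, 10, 1, 4, 8, 6, 5, 3],
      [0, 8, 1, 9, 2, 3, 7, 5, 6, 4]]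
    triangles := [[1, 2, 5], [1, 2, 6], [3, 4, 7], [3, 4, 8], [5, 6, 9], [5, 6, 10], [1, 7, 8],
      [2, 7, 8], [1, 9, 10], [2, 9, 10], [1, 4, 5], [2, 3, 6], [1, 6, 7], [2, 5, 8], [1, 4, 9],
      [2, 3, 10], [1, 8, 10], [2, 7, 9], [3, 5, 8], [4, 6, 7], [0, 3, 6], [0, 4, 5], [0, 3, 9],
      [0, 4, 10], [3, 5, 9], [4, 6, 10], [3, 7, 10], [4, 8, 9], [0, 7, 9], [0, 8, 10], [0, 5, 7],
      [0, 6, 8], [5, 7, 10], [6, 8, 9]]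
    positions := [⟨0, 0, -4⟩, ⟨-1, -1, 0⟩, ⟨1, 1, 0⟩, ⟨5, 3, 5⟩, ⟨-5, -3, 5⟩, ⟨5, -6, -5⟩,
      ⟨-5, 6, -5⟩, ⟨-3, 1, -2⟩, ⟨3, -1, -2⟩, ⟨4, 1, 1⟩, ⟨-4, -1, 1⟩]
    normals := [⟨1, 0, 0⟩, ⟨4, 18, 9⟩, ⟨-4, -18, 9⟩, ⟨2, 3, -3⟩, ⟨2, 3, 3⟩, ⟨3, 2, 0⟩, ⟨1, -3, 0⟩,
      ⟨7, 6, -6⟩, ⟨-7, -6, -6⟩, ⟨7, -8, 17⟩, ⟨-7, 8, 17⟩, ⟨-8, 2, -9⟩, ⟨8, -2, -9⟩, ⟨-11, 18, 7⟩,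
      ⟨11, -18, 7⟩, ⟨1, -5, 0⟩, ⟨0, 1, -3⟩, ⟨13, -12, 27⟩, ⟨-13, 12, 27⟩, ⟨2, 2, -1⟩, ⟨0, 1, 3⟩,
      ⟨1, -3, -1⟩, ⟨1, -3, 1⟩, ⟨13, 11, 10⟩, ⟨-13, -11, 10⟩, ⟨4, 2, -3⟩, ⟨4, 2, 3⟩, ⟨5, 16, 12⟩,
      ⟨4, 3, -4⟩, ⟨4, 3, 4⟩, ⟨-7, -5, 6⟩, ⟨7, 5, 6⟩, ⟨7, -10, 4⟩, ⟨9, 7, -8⟩, ⟨-9, -7, -8⟩,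
      ⟨-8, 6, -15⟩, ⟨8, -6, -15⟩, ⟨1, 3, -3⟩, ⟨1, 5, -2⟩, ⟨1, 5, 2⟩, ⟨1, 5, -3⟩, ⟨1, 5, 3⟩,
      ⟨5, 3, -3⟩, ⟨5, 3, 3⟩, ⟨-7, 10, 4⟩, ⟨16, 13, 13⟩, ⟨-16, -13, 13⟩] },
  { links := [[3, 9, 7, 5, 4, 10, 8, 6], [2, 5, 7, 8, 4, 9, 10, 6], [1, 6, 8, 7, 3, 10, 9, 5],
      [0, 6, 5, 10, 2, 7, 4, 8, 9], [0, 5, 6, 9, 1, 8, 3, 7, 10], [0, 7, 1, 2, 9, 8, 10, 3, 6, 4],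
      [0, 8, 2, 1, 10, 7, 9, 4, 5, 3], [0, 9, 6, 10, 4, 3, 2, 8, 1, 5],
      [0, 10, 5, 9, 3, 4, 1, 7, 2, 6], [0, 3, 8, 5, 2, 10, 1, 4, 6, 7],
      [0, 4, 7, 6, 1, 9, 2, 3, 5, 8]]
    triangles := [[1, 2, 5], [1, 2, 6], [3, 4, 7], [3, 4, 8], [3, 5, 6], [4, 5, 6], [1, 7, 8],
      [2, 7, 8], [1, 9, 10], [2, 9, 10], [1, 5, 7], [2, 6, 8], [1, 4, 9], [2, 3, 10], [1, 4, 8],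
      [2, 3, 7], [1, 6, 10], [2, 5, 9], [3, 5, 10], [4, 6, 9], [0, 3, 6], [0, 4, 5], [0, 3, 9],
      [0, 4, 10], [3, 8, 9], [4, 7, 10], [0, 5, 7], [0, 6, 8], [5, 8, 9], [6, 7, 10], [0, 7, 9],
      [0, 8, 10], [5, 8, 10], [6, 7, 9]]
    positions := [⟨0, 0, 1⟩, ⟨6, 6, 6⟩, ⟨-6, -6, 6⟩, ⟨-4, -1, 3⟩, ⟨4, 1, 3⟩, ⟨-5, 1, 2⟩,
      ⟨5, -1, 2⟩, ⟨2, 4, 4⟩, ⟨-2, -4, 4⟩, ⟨-2, 6, -5⟩, ⟨2, -6, -5⟩]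
    normals := [⟨11, 8, -4⟩, ⟨3, -3, 5⟩, ⟨5, -1, -1⟩, ⟨3, -3, -5⟩, ⟨2, 4, 5⟩, ⟨-4, -7, 11⟩,
      ⟨2, 0, 1⟩, ⟨0, 1, -6⟩, ⟨0, 3, 2⟩, ⟨0, 3, 8⟩, ⟨2, 1, 1⟩, ⟨1, 3, -3⟩, ⟨6, 11, 18⟩, ⟨4, 1, -2⟩,
      ⟨0, -3, 8⟩, ⟨4, -3, -3⟩, ⟨0, -1, -6⟩, ⟨0, 3, 4⟩, ⟨2, 1, -1⟩, ⟨0, 3, -1⟩, ⟨3, -2, 3⟩,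
      ⟨0, 3, -4⟩, ⟨1, 3, 3⟩, ⟨-11, -8, -4⟩, ⟨-9, 10, 15⟩, ⟨9, -10, 15⟩, ⟨51, 55, 61⟩, ⟨2, -3, -2⟩,
      ⟨2, -3, 2⟩, ⟨3, 2, -3⟩, ⟨1, 3, -4⟩, ⟨8, 2, -5⟩, ⟨-8, -2, -5⟩, ⟨25, 8, -18⟩, ⟨-25, -8, -18⟩,
      ⟨-43, -46, 51⟩, ⟨1, 0, -1⟩, ⟨1, 0, 1⟩, ⟨3, 0, 1⟩, ⟨2, -1, -4⟩, ⟨2, -1, 4⟩, ⟨1, 3, 4⟩,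
      ⟨-1, -6, 4⟩, ⟨1, 6, 4⟩, ⟨39, 29, -11⟩, ⟨-39, -29, -11⟩, ⟨43, 46, 51⟩, ⟨-51, -55, 61⟩] },
  { links := [[3, 5, 10, 7, 4, 6, 9, 8], [2, 5, 7, 8, 10, 4, 9, 6], [1, 6, 8, 7, 9, 3, 10, 5],
      [0, 8, 4, 7, 6, 10, 2, 9, 5], [0, 7, 3, 8, 5, 9, 1, 10, 6], [0, 3, 9, 4, 8, 6, 7, 1, 2, 10],
      [0, 4, 10, 3, 7, 5, 8, 2, 1, 9], [0, 10, 9, 2, 8, 1, 5, 6, 3, 4],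
      [0, 9, 10, 1, 7, 2, 6, 5, 4, 3], [0, 6, 1, 4, 5, 3, 2, 7, 10, 8],
      [0, 5, 2, 3, 6, 4, 1, 8, 9, 7]]
    triangles := [[1, 2, 5], [1, 2, 6], [3, 4, 7], [3, 4, 8], [5, 6, 7], [5, 6, 8], [1, 7, 8],
      [2, 7, 8], [7, 9, 10], [8, 9, 10], [1, 5, 7], [2, 6, 8], [1, 6, 9], [2, 5, 10], [1, 4, 9],
      [2, 3, 10], [1, 4, 10], [2, 3, 9], [1, 8, 10], [2, 7, 9], [3, 6, 7], [4, 5, 8], [0, 3, 8],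
      [0, 4, 7], [0, 7, 10], [0, 8, 9], [0, 3, 5], [0, 4, 6], [0, 5, 10], [0, 6, 9], [3, 5, 9],
      [4, 6, 10], [3, 6, 10], [4, 5, 9]]
    positions := [⟨0, 0, -1⟩, ⟨-4, -4, 4⟩, ⟨4, 4, 4⟩, ⟨-4, 4, -5⟩, ⟨4, -4, -5⟩, ⟨1, 3, 2⟩,
      ⟨-1, -3, 2⟩, ⟨-1, -2, 1⟩, ⟨1, 2, 1⟩, ⟨5, 0, 0⟩, ⟨-5, 0, 0⟩]
    normals := [⟨1, 0, -5⟩, ⟨2, -5, 0⟩, ⟨3, 4, -2⟩, ⟨0, 3, 4⟩, ⟨3, 5, 3⟩, ⟨4, -5, 4⟩, ⟨4, -5, -4⟩,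
      ⟨3, 1, 0⟩, ⟨-3, -15, 16⟩, ⟨10, 37, 35⟩, ⟨15, -20, -13⟩, ⟨-10, -37, 35⟩, ⟨-15, 20, -13⟩,
      ⟨0, 1, 4⟩, ⟨2, -1, -2⟩, ⟨2, -1, 2⟩, ⟨17, -9, 10⟩, ⟨-6, 33, 31⟩, ⟨0, 1, -3⟩, ⟨-9, -4, -6⟩,
      ⟨3, 12, 11⟩, ⟨6, -33, 31⟩, ⟨2, 3, -2⟩, ⟨3, 5, 1⟩, ⟨3, -1, -2⟩, ⟨5, -2, 1⟩, ⟨5, 3, -5⟩,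
      ⟨5, 3, 5⟩, ⟨9, 4, -6⟩, ⟨-3, -12, 11⟩, ⟨25, -13, 16⟩, ⟨-25, 13, 16⟩, ⟨3, 5, -1⟩,
      ⟨-20, 27, -18⟩, ⟨20, -27, -18⟩, ⟨0, 2, -3⟩, ⟨1, -2, -3⟩, ⟨1, -2, 3⟩, ⟨3, -1, 2⟩,
      ⟨5, -2, -1⟩, ⟨1, 6, 6⟩, ⟨9, 8, 4⟩, ⟨-9, -8, 4⟩, ⟨-18, 25, -16⟩, ⟨18, -25, -16⟩] },
  { links := [[3, 7, 9, 5, 4, 8, 10, 6], [2, 6, 8, 3, 4, 9, 7, 10, 5],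
      [1, 5, 7, 4, 3, 10, 8, 9, 6], [0, 6, 9, 10, 2, 4, 1, 8, 7], [0, 5, 10, 9, 1, 3, 2, 7, 8],
      [0, 9, 8, 6, 7, 2, 1, 10, 4], [0, 10, 7, 5, 8, 1, 2, 9, 3], [0, 3, 8, 4, 2, 5, 6, 10, 1, 9],
      [0, 4, 7, 3, 1, 6, 5, 9, 2, 10], [0, 7, 1, 4, 10, 3, 6, 2, 8, 5],
      [0, 8, 2, 3, 9, 4, 5, 1, 7, 6]]
    triangles := [[1, 3, 4], [2, 3, 4], [5, 6, 7], [5, 6, 8], [1, 2, 5], [1, 2, 6], [3, 7, 8],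
      [4, 7, 8], [3, 9, 10], [4, 9, 10], [0, 3, 6], [0, 4, 5], [0, 3, 7], [0, 4, 8], [0, 5, 9],
      [0, 6, 10], [0, 7, 9], [0, 8, 10], [1, 3, 8], [2, 4, 7], [3, 6, 9], [4, 5, 10], [1, 4, 9],
      [2, 3, 10], [1, 5, 10], [2, 6, 9], [1, 7, 9], [2, 8, 10], [1, 6, 8], [2, 5, 7], [1, 7, 10],
      [2, 8, 9], [5, 8, 9], [6, 7, 10]]
    positions := [⟨0, 0, -2⟩, ⟨5, -6, -7⟩, ⟨-5, 6, -7⟩, ⟨2, -1, 5⟩, ⟨-2, 1, 5⟩, ⟨1, 0, -6⟩,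
      ⟨-1, 0, -6⟩, ⟨4, 7, 6⟩, ⟨-4, -7, 6⟩, ⟨1, -2, -1⟩, ⟨-1, 2, -1⟩]
    normals := [⟨2, -2, -5⟩, ⟨0, 5, -3⟩, ⟨6, 11, 3⟩, ⟨33, 12, 8⟩, ⟨1, 0, 5⟩, ⟨4, 3, -1⟩,
      ⟨1, -6, -3⟩, ⟨-17, -8, 4⟩, ⟨2, -3, 1⟩, ⟨-15, -8, -3⟩, ⟨5, 0, -3⟩, ⟨3, -2, -1⟩, ⟨3, 1, 2⟩,
      ⟨7, 12, -3⟩, ⟨1, 1, -3⟩, ⟨3, -2, 1⟩, ⟨2, 4, 3⟩, ⟨4, 3, 1⟩, ⟨1, 4, 0⟩, ⟨38, 15, -9⟩,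
      ⟨5, 3, -1⟩, ⟨2, -3, -1⟩, ⟨1, 3, -3⟩, ⟨2, 4, -3⟩, ⟨5, 0, 3⟩, ⟨-7, -12, -3⟩, ⟨17, 8, 4⟩,
      ⟨-1, 6, -3⟩, ⟨-25, -9, 6⟩, ⟨1, 1, 3⟩, ⟨2, -1, -3⟩, ⟨1, 3, 3⟩, ⟨2, 5, 0⟩, ⟨0, 5, 3⟩,
      ⟨-1, 1, -7⟩, ⟨1, -1, -7⟩, ⟨-2, 7, 3⟩, ⟨2, -7, 3⟩, ⟨-6, -11, 3⟩, ⟨-38, -15, -9⟩, ⟨1, 1, -1⟩,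
      ⟨1, 1, 1⟩, ⟨1, -1, 2⟩, ⟨5, -1, -1⟩, ⟨5, -1, 1⟩, ⟨3, -4, -4⟩, ⟨3, -4, 4⟩] },
  { links := [[3, 7, 9, 5, 4, 8, 10, 6], [2, 5, 7, 8, 4, 10, 9, 6], [1, 6, 8, 7, 3, 9, 10, 5],
      [0, 6, 4, 5, 10, 8, 9, 2, 7], [0, 5, 3, 6, 9, 7, 10, 1, 8], [0, 9, 8, 6, 7, 1, 2, 10, 3, 4],
      [0, 10, 7, 5, 8, 2, 1, 9, 4, 3], [0, 3, 2, 8, 1, 5, 6, 10, 4, 9],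
      [0, 4, 1, 7, 2, 6, 5, 9, 3, 10], [0, 7, 4, 6, 1, 10, 2, 3, 8, 5],
      [0, 8, 3, 5, 2, 9, 1, 4, 7, 6]]
    triangles := [[1, 2, 5], [1, 2, 6], [3, 4, 5], [3, 4, 6], [5, 6, 7], [5, 6, 8], [1, 7, 8],
      [2, 7, 8], [1, 9, 10], [2, 9, 10], [1, 5, 7], [2, 6, 8], [1, 6, 9], [2, 5, 10], [1, 4, 8],
      [2, 3, 7], [1, 4, 10], [2, 3, 9], [3, 5, 10], [4, 6, 9], [0, 3, 6], [0, 4, 5], [0, 5, 9],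
      [0, 6, 10], [5, 8, 9], [6, 7, 10], [0, 3, 7], [0, 4, 8], [3, 8, 9], [4, 7, 10], [0, 7, 9],
      [0, 8, 10], [3, 8, 10], [4, 7, 9]]
    positions := [⟨0, 0, 1⟩, ⟨-1, 5, 5⟩, ⟨1, -5, 5⟩, ⟨2, -2, 2⟩, ⟨-2, 2, 2⟩, ⟨1, -3, 4⟩,
      ⟨-1, 3, 4⟩, ⟨5, 4, 6⟩, ⟨-5, -4, 6⟩, ⟨3, 2, -5⟩, ⟨-3, -2, -5⟩]
    normals := [⟨-8, 4, 1⟩, ⟨1, 0, 5⟩, ⟨-3, 16, -3⟩, ⟨3, 0, -5⟩, ⟨1, 4, 4⟩, ⟨1, 5, -4⟩,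
      ⟨1, -4, -1⟩, ⟨3, 0, 4⟩, ⟨7, -9, 0⟩, ⟨8, 11, 8⟩, ⟨-7, -10, 7⟩, ⟨2, -2, 1⟩, ⟨3, 2, 5⟩,
      ⟨4, -3, -2⟩, ⟨2, 1, -5⟩, ⟨4, -1, 1⟩, ⟨1, 4, 3⟩, ⟨-1, -30, 17⟩, ⟨4, 1, -1⟩, ⟨3, 2, -3⟩,
      ⟨2, -5, 2⟩, ⟨1, -1, -3⟩, ⟨1, 1, 4⟩, ⟨4, 1, 1⟩, ⟨8, -4, 1⟩, ⟨1, 30, 17⟩, ⟨2, -2, -1⟩,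
      ⟨3, -1, -1⟩, ⟨0, 3, -2⟩, ⟨0, 3, 2⟩, ⟨0, 1, -4⟩, ⟨0, 1, 4⟩, ⟨2, -5, -2⟩, ⟨1, -6, -1⟩,
      ⟨4, -5, -3⟩, ⟨4, -5, 3⟩, ⟨4, 5, -4⟩, ⟨0, -1, -10⟩, ⟨0, 1, -10⟩, ⟨2, 1, 0⟩, ⟨1, 1, -4⟩,
      ⟨4, 1, -3⟩, ⟨4, 1, 3⟩, ⟨2, 1, 5⟩, ⟨4, 5, 4⟩, ⟨-6, -5, 3⟩, ⟨6, 5, 3⟩] },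
  { links := [[1, 7, 10, 4, 5, 2, 8, 9, 3, 6], [0, 6, 9, 4, 10, 8, 2, 7],
      [0, 5, 10, 3, 9, 7, 1, 8], [0, 9, 2, 10, 7, 8, 5, 4, 6], [0, 10, 1, 9, 8, 7, 6, 3, 5],
      [0, 4, 3, 8, 6, 7, 9, 10, 2], [0, 3, 4, 7, 5, 8, 10, 9, 1], [0, 1, 2, 9, 5, 6, 4, 8, 3, 10],
      [0, 2, 1, 10, 6, 5, 3, 7, 4, 9], [0, 8, 4, 1, 6, 10, 5, 7, 2, 3],
      [0, 7, 3, 2, 5, 9, 6, 8, 1, 4]]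
    triangles := [[1, 2, 7], [1, 2, 8], [3, 4, 5], [3, 4, 6], [5, 6, 7], [5, 6, 8], [3, 7, 8],
      [4, 7, 8], [5, 9, 10], [6, 9, 10], [0, 1, 7], [0, 2, 8], [1, 4, 9], [2, 3, 10], [1, 6, 9],
      [2, 5, 10], [0, 1, 6], [0, 2, 5], [1, 4, 10], [2, 3, 9], [1, 8, 10], [2, 7, 9], [3, 5, 8],
      [4, 6, 7], [0, 3, 6], [0, 4, 5], [5, 7, 9], [6, 8, 10], [0, 3, 9], [0, 4, 10], [0, 7, 10],
      [0, 8, 9], [3, 7, 10], [4, 8, 9]]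
    positions := [⟨0, 0, -7⟩, ⟨2, -1, 1⟩, ⟨-2, 1, 1⟩, ⟨-7, -1, 7⟩, ⟨7, 1, 7⟩, ⟨-2, -7, 5⟩,
      ⟨2, 7, 5⟩, ⟨-2, 0, 6⟩, ⟨2, 0, 6⟩, ⟨1, 5, 4⟩, ⟨-1, -5, 4⟩]
    normals := [⟨14, 3, 2⟩, ⟨1, -1, 5⟩, ⟨3, -1, 0⟩, ⟨1, -1, -5⟩, ⟨4, -1, -5⟩, ⟨12, -13, 5⟩,
      ⟨-11, 2, -10⟩, ⟨-12, 13, 5⟩, ⟨-11, 2, 9⟩, ⟨2, -1, 4⟩, ⟨4, 3, -5⟩, ⟨4, 3, 5⟩, ⟨0, 1, -3⟩,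
      ⟨0, 1, 5⟩, ⟨1, -3, 0⟩, ⟨-1, 0, -6⟩, ⟨2, -1, -4⟩, ⟨4, -1, 5⟩, ⟨-11, -3, 2⟩, ⟨1, 0, -6⟩,
      ⟨6, -1, -6⟩, ⟨-1, 1, -6⟩, ⟨1, -9, -2⟩, ⟨7, -8, 3⟩, ⟨-7, 8, 3⟩, ⟨10, -11, 4⟩, ⟨-10, 11, 4⟩,
      ⟨1, 3, 0⟩, ⟨4, -1, 0⟩, ⟨-6, 1, -6⟩, ⟨4, 9, 1⟩, ⟨-4, -9, 1⟩, ⟨11, 3, 2⟩, ⟨-13, -3, 2⟩,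
      ⟨0, 1, 2⟩, ⟨1, -1, -6⟩, ⟨5, -4, -2⟩, ⟨5, -4, 2⟩, ⟨2, 0, -1⟩, ⟨2, 0, 1⟩, ⟨4, -1, -1⟩,
      ⟨4, -1, 1⟩, ⟨0, 1, -5⟩, ⟨5, 1, -1⟩, ⟨5, 1, 1⟩, ⟨1, -5, -5⟩, ⟨1, -5, 5⟩, ⟨-1, 8, -2⟩,
      ⟨-11, 12, 5⟩, ⟨11, -12, 5⟩] },
  { links := [[1, 6, 3, 8, 10, 2, 5, 4, 7, 9], [0, 9, 4, 10, 8, 2, 7, 6],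
      [0, 10, 3, 9, 7, 1, 8, 5], [0, 6, 4, 5, 9, 2, 10, 7, 8], [0, 5, 3, 6, 10, 1, 9, 8, 7],
      [0, 2, 8, 6, 7, 10, 9, 3, 4], [0, 1, 7, 5, 8, 9, 10, 4, 3], [0, 4, 8, 3, 10, 5, 6, 1, 2, 9],
      [0, 3, 7, 4, 9, 6, 5, 2, 1, 10], [0, 7, 2, 3, 5, 10, 6, 8, 4, 1],
      [0, 8, 1, 4, 6, 9, 5, 7, 3, 2]]
    triangles := [[1, 2, 7], [1, 2, 8], [3, 4, 5], [3, 4, 6], [5, 6, 7], [5, 6, 8], [3, 7, 8],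
      [4, 7, 8], [5, 9, 10], [6, 9, 10], [1, 6, 7], [2, 5, 8], [0, 1, 9], [0, 2, 10], [1, 4, 9],
      [2, 3, 10], [0, 1, 6], [0, 2, 5], [1, 4, 10], [2, 3, 9], [1, 8, 10], [2, 7, 9], [3, 5, 9],
      [4, 6, 10], [0, 3, 6], [0, 4, 5], [5, 7, 10], [6, 8, 9], [3, 7, 10], [4, 8, 9], [0, 3, 8],
      [0, 4, 7], [0, 7, 9], [0, 8, 10]]
    positions := [⟨0, 0, -12⟩, ⟨-3, -1, 4⟩, ⟨3, 1, 4⟩, ⟨-5, -12, -13⟩, ⟨5, 12, -13⟩, ⟨7, -5, -2⟩,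
      ⟨-7, 5, -2⟩, ⟨-1, -1, -3⟩, ⟨1, 1, -3⟩, ⟨-8, -3, 12⟩, ⟨8, 3, 12⟩]
    normals := [⟨5, -2, -2⟩, ⟨5, -2, 2⟩, ⟨3, -7, 0⟩, ⟨-7, 19, 0⟩, ⟨1, -3, -2⟩, ⟨1, -3, 2⟩,
      ⟨1, 3, 0⟩, ⟨3, 4, -3⟩, ⟨3, 4, 3⟩, ⟨4, -5, -4⟩, ⟨4, -5, 4⟩, ⟨16, 15, 4⟩, ⟨-16, -15, 4⟩,
      ⟨2, -1, 0⟩, ⟨5, -14, -1⟩, ⟨-5, 14, -1⟩, ⟨0, 1, -2⟩, ⟨0, 1, 2⟩, ⟨4, -3, -1⟩, ⟨4, -3, 1⟩,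
      ⟨1, 1, -5⟩, ⟨-97, -168, -103⟩, ⟨97, 168, -103⟩, ⟨5, 2, -1⟩, ⟨22, 6, 15⟩, ⟨-22, -6, 15⟩,
      ⟨2, 2, -1⟩, ⟨2, 2, 1⟩, ⟨1, 1, 5⟩, ⟨5, 2, 1⟩, ⟨-4, 10, -1⟩, ⟨4, -10, -1⟩, ⟨1, -1, -1⟩,
      ⟨1, -1, 1⟩, ⟨1, -4, -2⟩, ⟨1, -4, 2⟩, ⟨4, -5, -1⟩, ⟨4, -5, 1⟩, ⟨1, -6, -3⟩, ⟨-1, 6, -3⟩,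
      ⟨2, -3, -1⟩, ⟨2, -3, 1⟩, ⟨7, -3, -6⟩, ⟨-7, 3, -6⟩, ⟨11, -5, -9⟩, ⟨-11, 5, -9⟩] },
  { links := [[3, 10, 6, 7, 4, 9, 5, 8], [2, 5, 4, 7, 8, 10, 9, 6], [1, 6, 3, 8, 7, 9, 10, 5],
      [0, 8, 2, 6, 4, 5, 9, 7, 10], [0, 7, 1, 5, 3, 6, 10, 8, 9], [0, 9, 3, 4, 1, 2, 10, 7, 6, 8],
      [0, 10, 4, 3, 2, 1, 9, 8, 5, 7], [0, 6, 5, 10, 3, 9, 2, 8, 1, 4],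
      [0, 5, 6, 9, 4, 10, 1, 7, 2, 3], [0, 4, 8, 6, 1, 10, 2, 7, 3, 5],
      [0, 3, 7, 5, 2, 9, 1, 8, 4, 6]]
    triangles := [[1, 2, 5], [1, 2, 6], [3, 4, 5], [3, 4, 6], [5, 6, 7], [5, 6, 8], [1, 7, 8],
      [2, 7, 8], [1, 9, 10], [2, 9, 10], [1, 4, 5], [2, 3, 6], [1, 4, 7], [2, 3, 8], [1, 6, 9],
      [2, 5, 10], [1, 8, 10], [2, 7, 9], [3, 7, 9], [4, 8, 10], [3, 7, 10], [4, 8, 9], [0, 3, 10],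
      [0, 4, 9], [5, 7, 10], [6, 8, 9], [0, 3, 8], [0, 4, 7], [0, 5, 8], [0, 6, 7], [0, 5, 9],
      [0, 6, 10], [3, 5, 9], [4, 6, 10]]
    positions := [⟨0, 0, 12⟩, ⟨-1, 1, -4⟩, ⟨1, -1, -4⟩, ⟨6, -6, -5⟩, ⟨-6, 6, -5⟩, ⟨6, -11, -10⟩,
      ⟨-6, 11, -10⟩, ⟨-11, -2, -3⟩, ⟨11, 2, -3⟩, ⟨-3, 0, 0⟩, ⟨3, 0, 0⟩]
    normals := [⟨3, -3, -4⟩, ⟨1, -3, 4⟩, ⟨3, 4, 0⟩, ⟨2, -21, -7⟩, ⟨-1, -3, -16⟩, ⟨0, 2, -5⟩,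
      ⟨-1, -10, -11⟩, ⟨5, -1, 2⟩, ⟨1, 14, -15⟩, ⟨25, 23, 18⟩, ⟨-25, -23, 18⟩, ⟨3, 2, 0⟩,
      ⟨-8, 6, -5⟩, ⟨9, -7, -6⟩, ⟨-2, -21, -22⟩, ⟨1, -1, 1⟩, ⟨2, 1, -2⟩, ⟨-2, -1, -6⟩, ⟨1, -5, 0⟩,
      ⟨1, -6, -3⟩, ⟨4, 5, 4⟩, ⟨1, 10, -11⟩, ⟨11, 93, -92⟩, ⟨-11, -93, -92⟩, ⟨2, 1, 2⟩, ⟨1, -5, 2⟩,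
      ⟨5, 5, -4⟩, ⟨1, 0, -3⟩, ⟨1, 1, -2⟩, ⟨1, 1, 2⟩, ⟨2, -1, -1⟩, ⟨0, 1, -4⟩, ⟨0, 1, 4⟩,
      ⟨1, 5, 0⟩, ⟨-1, 6, -3⟩, ⟨5, 5, 4⟩, ⟨-1, 11, -4⟩, ⟨1, -14, -4⟩, ⟨-1, 14, -4⟩, ⟨-14, 10, -9⟩,
      ⟨14, -10, -9⟩, ⟨1, 0, -1⟩, ⟨1, 0, 1⟩, ⟨2, 0, -1⟩, ⟨8, -6, -5⟩, ⟨-9, 7, -6⟩] },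
  { links := [[3, 9, 6, 7, 4, 10, 5, 8], [2, 5, 4, 9, 10, 8, 7, 6], [1, 6, 3, 10, 9, 7, 8, 5],
      [0, 8, 4, 7, 10, 2, 6, 5, 9], [0, 7, 3, 8, 9, 1, 5, 6, 10], [0, 10, 7, 9, 3, 6, 4, 1, 2, 8],
      [0, 9, 8, 10, 4, 5, 3, 2, 1, 7], [0, 6, 1, 8, 2, 9, 5, 10, 3, 4],
      [0, 5, 2, 7, 1, 10, 6, 9, 4, 3], [0, 3, 5, 7, 2, 10, 1, 4, 8, 6],
      [0, 4, 6, 8, 1, 9, 2, 3, 7, 5]]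
    triangles := [[1, 2, 5], [1, 2, 6], [3, 4, 7], [3, 4, 8], [3, 5, 6], [4, 5, 6], [1, 7, 8],
      [2, 7, 8], [1, 9, 10], [2, 9, 10], [1, 4, 5], [2, 3, 6], [1, 6, 7], [2, 5, 8], [1, 4, 9],
      [2, 3, 10], [1, 8, 10], [2, 7, 9], [3, 7, 10], [4, 8, 9], [0, 3, 8], [0, 4, 7], [0, 3, 9],
      [0, 4, 10], [3, 5, 9], [4, 6, 10], [5, 7, 9], [6, 8, 10], [0, 5, 8], [0, 6, 7], [0, 5, 10],
      [0, 6, 9], [5, 7, 10], [6, 8, 9]]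
    positions := [⟨0, 0, 14⟩, ⟨-1, 0, -3⟩, ⟨1, 0, -3⟩, ⟨14, 6, -13⟩, ⟨-14, -6, -13⟩, ⟨7, 5, -4⟩,
      ⟨-7, -5, -4⟩, ⟨1, -13, -2⟩, ⟨-1, 13, -2⟩, ⟨0, -3, 4⟩, ⟨0, 3, 4⟩]
    normals := [⟨8, 7, -6⟩, ⟨9, -2, 6⟩, ⟨2, -5, -2⟩, ⟨-14, 3, 10⟩, ⟨14, 1, 0⟩, ⟨1, -2, 5⟩,
      ⟨4, 4, 3⟩, ⟨2, -1, -4⟩, ⟨-12, 17, -7⟩, ⟨-1, 0, -9⟩, ⟨4, 0, 5⟩, ⟨12, 1, -2⟩, ⟨11, -12, -7⟩,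
      ⟨1, -2, 0⟩, ⟨2, 1, 1⟩, ⟨1, -3, 2⟩, ⟨-11, 11, -7⟩, ⟨2, -1, 0⟩, ⟨2, 2, -1⟩, ⟨5, -1, -4⟩,
      ⟨-14, -1, -2⟩, ⟨2, 3, -2⟩, ⟨1, 5, 2⟩, ⟨1, 0, -7⟩, ⟨-9, 1, -7⟩, ⟨1, -2, -1⟩, ⟨2, 1, -1⟩,
      ⟨2, 2, 1⟩, ⟨-9, 2, 6⟩, ⟨25, -6, -20⟩, ⟨-25, 6, -20⟩, ⟨1, -2, 1⟩, ⟨4, 4, -3⟩, ⟨9, -1, -7⟩,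
      ⟨14, 1, -3⟩, ⟨-11, 12, -7⟩, ⟨107, 1, -15⟩, ⟨-107, -1, -15⟩, ⟨188, 2, -27⟩, ⟨-188, -2, -27⟩,
      ⟨4, 5, -3⟩, ⟨4, 5, 3⟩, ⟨-1, 0, -7⟩, ⟨-8, -1, -2⟩, ⟨5, -7, -3⟩, ⟨-8, -7, -6⟩] },
  { links := [[3, 6, 10, 8, 4, 5, 9, 7], [2, 5, 7, 8, 10, 4, 9, 6], [1, 6, 8, 7, 9, 3, 10, 5],
      [0, 7, 10, 2, 9, 8, 5, 4, 6], [0, 8, 9, 1, 10, 7, 6, 3, 5], [0, 4, 3, 8, 6, 7, 1, 2, 10, 9],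
      [0, 3, 4, 7, 5, 8, 2, 1, 9, 10], [0, 9, 2, 8, 1, 5, 6, 4, 10, 3],
      [0, 10, 1, 7, 2, 6, 5, 3, 9, 4], [0, 5, 10, 6, 1, 4, 8, 3, 2, 7],
      [0, 6, 9, 5, 2, 3, 7, 4, 1, 8]]
    triangles := [[1, 2, 5], [1, 2, 6], [3, 4, 5], [3, 4, 6], [5, 6, 7], [5, 6, 8], [1, 7, 8],
      [2, 7, 8], [5, 9, 10], [6, 9, 10], [1, 5, 7], [2, 6, 8], [1, 6, 9], [2, 5, 10], [1, 4, 9],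
      [2, 3, 10], [1, 4, 10], [2, 3, 9], [1, 8, 10], [2, 7, 9], [3, 5, 8], [4, 6, 7], [0, 3, 6],
      [0, 4, 5], [0, 5, 9], [0, 6, 10], [0, 3, 7], [0, 4, 8], [0, 7, 9], [0, 8, 10], [3, 7, 10],
      [4, 8, 9], [3, 8, 9], [4, 7, 10]]
    positions := [⟨0, 0, 5⟩, ⟨-5, -3, -5⟩, ⟨5, 3, -5⟩, ⟨3, -2, 0⟩, ⟨-3, 2, 0⟩, ⟨-5, 3, -2⟩,
      ⟨5, -3, -2⟩, ⟨2, 3, -3⟩, ⟨-2, -3, -3⟩, ⟨-3, -5, 6⟩, ⟨3, 5, 6⟩]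
    normals := [⟨1, -1, -4⟩, ⟨1, -1, 3⟩, ⟨-11, 7, 0⟩, ⟨22, 25, -34⟩, ⟨-12, -17, -21⟩, ⟨-1, 21, 4⟩,
      ⟨3, -1, 0⟩, ⟨11, -9, -11⟩, ⟨6, -3, 5⟩, ⟨4, 3, 5⟩, ⟨8, 11, -14⟩, ⟨1, -21, 4⟩, ⟨4, 3, -5⟩,
      ⟨-7, -11, 0⟩, ⟨-6, 3, 5⟩, ⟨-6, 5, -6⟩, ⟨0, 1, -3⟩, ⟨1, 2, 3⟩, ⟨2, -3, 0⟩, ⟨3, 0, -2⟩,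
      ⟨3, 0, 2⟩, ⟨0, 1, 7⟩, ⟨0, -1, 7⟩, ⟨1, 2, -3⟩, ⟨2, -1, -2⟩, ⟨2, -1, 2⟩, ⟨0, 1, 3⟩,
      ⟨3, 0, -1⟩, ⟨3, 0, 1⟩, ⟨1, -3, -2⟩, ⟨1, -3, 2⟩, ⟨-1, 11, 2⟩, ⟨1, -11, 2⟩, ⟨1, -15, 3⟩,
      ⟨-1, 15, 3⟩, ⟨19, 21, -29⟩, ⟨-19, -21, -29⟩, ⟨-22, -25, -34⟩, ⟨1, -1, -2⟩, ⟨1, -3, 1⟩,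
      ⟨1, -2, -3⟩, ⟨1, -2, 3⟩, ⟨1, 0, 4⟩, ⟨3, -2, -2⟩, ⟨3, -2, 2⟩, ⟨-9, 5, 8⟩, ⟨9, -5, 8⟩] },
  { links := [[3, 6, 7, 10, 4, 5, 8, 9], [2, 5, 4, 7, 8, 10, 9, 6], [1, 6, 3, 8, 7, 9, 10, 5],
      [0, 9, 5, 10, 7, 4, 8, 2, 6], [0, 10, 6, 9, 8, 3, 7, 1, 5], [0, 4, 1, 2, 10, 3, 9, 7, 6, 8],
      [0, 3, 2, 1, 9, 4, 10, 8, 5, 7], [0, 6, 5, 9, 2, 8, 1, 4, 3, 10],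
      [0, 5, 6, 10, 1, 7, 2, 3, 4, 9], [0, 8, 4, 6, 1, 10, 2, 7, 5, 3],
      [0, 7, 3, 5, 2, 9, 1, 8, 6, 4]]
    triangles := [[1, 2, 5], [1, 2, 6], [3, 4, 7], [3, 4, 8], [5, 6, 7], [5, 6, 8], [1, 7, 8],
      [2, 7, 8], [1, 9, 10], [2, 9, 10], [1, 4, 5], [2, 3, 6], [1, 4, 7], [2, 3, 8], [1, 6, 9],
      [2, 5, 10], [1, 8, 10], [2, 7, 9], [3, 5, 9], [4, 6, 10], [3, 5, 10], [4, 6, 9], [0, 3, 9],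
      [0, 4, 10], [5, 7, 9], [6, 8, 10], [0, 3, 6], [0, 4, 5], [0, 5, 8], [0, 6, 7], [0, 7, 10],
      [0, 8, 9], [3, 7, 10], [4, 8, 9]]
    positions := [⟨0, 0, 2⟩, ⟨5, 5, -5⟩, ⟨-5, -5, -5⟩, ⟨1, -2, -1⟩, ⟨-1, 2, -1⟩, ⟨-5, 1, 1⟩,
      ⟨5, -1, 1⟩, ⟨-2, -1, -2⟩, ⟨2, 1, -2⟩, ⟨2, -1, 5⟩, ⟨-2, 1, 5⟩]
    normals := [⟨1, -5, 0⟩, ⟨0, 1, -4⟩, ⟨4, 3, 1⟩, ⟨2, 5, 2⟩, ⟨2, 5, -2⟩, ⟨3, -3, -4⟩, ⟨3, -3, 4⟩,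
      ⟨1, 4, 0⟩, ⟨2, 2, -1⟩, ⟨-17, -8, -40⟩, ⟨4, -5, 1⟩, ⟨-2, -11, -3⟩, ⟨2, 13, -4⟩, ⟨17, 8, -40⟩,
      ⟨2, 3, 1⟩, ⟨2, -1, -2⟩, ⟨2, 1, 2⟩, ⟨3, 2, 0⟩, ⟨1, 4, -2⟩, ⟨1, 4, 2⟩, ⟨10, 23, 6⟩,
      ⟨3, -4, -3⟩, ⟨-5, -11, 3⟩, ⟨1, -2, 1⟩, ⟨3, -2, 0⟩, ⟨0, 1, 4⟩, ⟨4, -3, 4⟩, ⟨1, 3, 0⟩,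
      ⟨1, 3, -1⟩, ⟨1, 3, 1⟩, ⟨1, 5, 2⟩, ⟨3, -4, 3⟩, ⟨3, 4, -3⟩, ⟨3, 4, 3⟩, ⟨4, -3, -4⟩,
      ⟨3, 5, -3⟩, ⟨3, 5, 3⟩, ⟨-12, -29, 8⟩, ⟨12, 29, 8⟩, ⟨35, 83, 20⟩, ⟨-35, -83, 20⟩, ⟨2, -1, 2⟩,
      ⟨2, -3, 0⟩, ⟨1, 5, -2⟩, ⟨1, 6, -3⟩, ⟨-1, -6, -3⟩, ⟨-15, -38, 11⟩, ⟨15, 38, 11⟩,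
      ⟨37, 88, 21⟩, ⟨-37, -88, 21⟩] },
  { links := [[1, 7, 5, 4, 10, 2, 8, 6, 3, 9], [0, 9, 6, 10, 4, 8, 2, 7],
      [0, 10, 5, 9, 3, 7, 1, 8], [0, 6, 4, 5, 10, 8, 7, 2, 9], [0, 5, 3, 6, 9, 7, 8, 1, 10],
      [0, 7, 6, 8, 9, 2, 10, 3, 4], [0, 8, 5, 7, 10, 1, 9, 4, 3], [0, 1, 2, 3, 8, 4, 9, 10, 6, 5],
      [0, 2, 1, 4, 7, 3, 10, 9, 5, 6], [0, 3, 2, 5, 8, 10, 7, 4, 6, 1],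
      [0, 4, 1, 6, 7, 9, 8, 3, 5, 2]]
    triangles := [[1, 2, 7], [1, 2, 8], [3, 4, 5], [3, 4, 6], [5, 6, 7], [5, 6, 8], [3, 7, 8],
      [4, 7, 8], [7, 9, 10], [8, 9, 10], [0, 1, 7], [0, 2, 8], [0, 1, 9], [0, 2, 10], [1, 6, 9],
      [2, 5, 10], [1, 4, 8], [2, 3, 7], [1, 4, 10], [2, 3, 9], [1, 6, 10], [2, 5, 9], [3, 5, 10],
      [4, 6, 9], [0, 3, 9], [0, 4, 10], [5, 8, 9], [6, 7, 10], [3, 8, 10], [4, 7, 9], [0, 3, 6],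
      [0, 4, 5], [0, 5, 7], [0, 6, 8]]
    positions := [⟨0, 0, -4⟩, ⟨-8, 1, 9⟩, ⟨8, -1, 9⟩, ⟨2, 1, 7⟩, ⟨-2, -1, 7⟩, ⟨0, 5, 0⟩,
      ⟨0, -5, 0⟩, ⟨-3, -8, 8⟩, ⟨3, 8, 8⟩, ⟨6, -8, -8⟩, ⟨-6, 8, -8⟩]
    normals := [⟨5, 3, -1⟩, ⟨0, -1, 13⟩, ⟨1, 2, 0⟩, ⟨5, -2, 4⟩, ⟨5, 4, 3⟩, ⟨116, 54, -67⟩,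
      ⟨4, -1, 0⟩, ⟨5, 4, -3⟩, ⟨-116, -54, -67⟩, ⟨0, 1, 2⟩, ⟨-15, 1, 5⟩, ⟨15, -1, 5⟩,
      ⟨-19, 40, 29⟩, ⟨1, -1, 1⟩, ⟨0, 1, -2⟩, ⟨3, 4, -1⟩, ⟨11, -1, 2⟩, ⟨-17, 2, 3⟩, ⟨-7, -5, 3⟩,
      ⟨-145, -67, -84⟩, ⟨145, 67, -84⟩, ⟨3, 2, -2⟩, ⟨3, 2, 2⟩, ⟨7, 5, 3⟩, ⟨0, 1, 13⟩, ⟨1, 0, -4⟩,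
      ⟨2, 4, 1⟩, ⟨-9, -5, -5⟩, ⟨9, 5, -5⟩, ⟨-10, 21, -15⟩, ⟨2, 0, -1⟩, ⟨2, 0, 1⟩, ⟨1, 3, 2⟩,
      ⟨3, 3, 1⟩, ⟨2, 4, -1⟩, ⟨4, 3, 1⟩, ⟨16, -1, 4⟩, ⟨10, -21, -15⟩, ⟨40, -5, 7⟩, ⟨-40, 5, 7⟩,
      ⟨33, 16, 19⟩, ⟨-33, -16, 19⟩, ⟨0, 2, -1⟩, ⟨0, 2, 1⟩, ⟨1, 0, 2⟩, ⟨2, -1, -1⟩, ⟨6, 5, 4⟩,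
      ⟨-6, -5, 4⟩, ⟨227, -29, 38⟩, ⟨-227, 29, 38⟩] },
  { links := [[1, 6, 7, 3, 10, 2, 5, 8, 4, 9], [0, 9, 8, 2, 7, 4, 10, 6],
      [0, 10, 7, 1, 8, 3, 9, 5], [0, 7, 9, 2, 8, 6, 4, 5, 10], [0, 8, 10, 1, 7, 5, 3, 6, 9],
      [0, 2, 9, 6, 10, 3, 4, 7, 8], [0, 1, 10, 5, 9, 4, 3, 8, 7], [0, 6, 8, 5, 4, 1, 2, 10, 9, 3],
      [0, 5, 7, 6, 3, 2, 1, 9, 10, 4], [0, 4, 6, 5, 2, 3, 7, 10, 8, 1],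
      [0, 3, 5, 6, 1, 4, 8, 9, 7, 2]]
    triangles := [[1, 2, 7], [1, 2, 8], [3, 4, 5], [3, 4, 6], [5, 6, 9], [5, 6, 10], [5, 7, 8],
      [6, 7, 8], [7, 9, 10], [8, 9, 10], [1, 4, 7], [2, 3, 8], [0, 1, 9], [0, 2, 10], [1, 8, 9],
      [2, 7, 10], [0, 1, 6], [0, 2, 5], [1, 4, 10], [2, 3, 9], [1, 6, 10], [2, 5, 9], [3, 7, 9],
      [4, 8, 10], [0, 3, 10], [0, 4, 9], [3, 5, 10], [4, 6, 9], [0, 3, 7], [0, 4, 8], [3, 6, 8],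
      [4, 5, 7], [0, 5, 8], [0, 6, 7]]
    positions := [⟨0, 0, 2⟩, ⟨3, 2, -1⟩, ⟨-3, -2, -1⟩, ⟨-8, 8, 9⟩, ⟨8, -8, 9⟩, ⟨6, -5, 8⟩,
      ⟨-6, 5, 8⟩, ⟨1, 3, -7⟩, ⟨-1, -3, -7⟩, ⟨-7, -8, -9⟩, ⟨7, 8, -9⟩]
    normals := [⟨0, 1, -4⟩, ⟨5, 3, 0⟩, ⟨42, 43, -28⟩, ⟨3, 4, 3⟩, ⟨11, -13, -3⟩, ⟨3, -2, -2⟩,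
      ⟨-27, 40, -16⟩, ⟨11, 3, 9⟩, ⟨-11, 13, -3⟩, ⟨5, -2, 3⟩, ⟨27, -40, -16⟩, ⟨1, 2, -1⟩,
      ⟨-11, -3, 9⟩, ⟨0, 1, 4⟩, ⟨-10, 3, 5⟩, ⟨6, 7, 2⟩, ⟨1, 5, -4⟩, ⟨1, 5, 4⟩, ⟨-6, -7, 2⟩,
      ⟨10, -3, 5⟩, ⟨-11, -8, -4⟩, ⟨5, -3, 4⟩, ⟨-9, 11, -3⟩, ⟨9, -11, -3⟩, ⟨1, -1, 0⟩, ⟨1, -1, -1⟩,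
      ⟨2, 2, -3⟩, ⟨2, 2, 3⟩, ⟨5, 0, -2⟩, ⟨5, 0, 2⟩, ⟨-7, -7, -6⟩, ⟨11, 8, -4⟩, ⟨0, 1, 0⟩,
      ⟨1, -1, -2⟩, ⟨1, -1, 2⟩, ⟨2, -2, -1⟩, ⟨2, -2, 1⟩, ⟨4, 1, -1⟩, ⟨4, 1, 1⟩, ⟨7, 7, -6⟩,
      ⟨10, 2, 9⟩, ⟨-10, -2, 9⟩, ⟨9, -13, -5⟩, ⟨-9, 13, -5⟩] },
  { links := [[3, 9, 5, 8, 4, 10, 6, 7], [2, 8, 5, 6, 3, 4, 9, 10, 7],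
      [1, 7, 6, 5, 4, 3, 10, 9, 8], [0, 7, 8, 10, 2, 4, 1, 6, 9], [0, 8, 7, 9, 1, 3, 2, 5, 10],
      [0, 9, 7, 10, 4, 2, 6, 1, 8], [0, 10, 8, 9, 3, 1, 5, 2, 7], [0, 6, 2, 1, 10, 5, 9, 4, 8, 3],
      [0, 5, 1, 2, 9, 6, 10, 3, 7, 4], [0, 3, 6, 8, 2, 10, 1, 4, 7, 5],
      [0, 4, 5, 7, 1, 9, 2, 3, 8, 6]]
    triangles := [[1, 3, 4], [2, 3, 4], [1, 5, 6], [2, 5, 6], [1, 2, 7], [1, 2, 8], [3, 7, 8],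
      [4, 7, 8], [1, 9, 10], [2, 9, 10], [0, 3, 7], [0, 4, 8], [0, 3, 9], [0, 4, 10], [0, 5, 8],
      [0, 6, 7], [0, 5, 9], [0, 6, 10], [1, 3, 6], [2, 4, 5], [1, 5, 8], [2, 6, 7], [1, 4, 9],
      [2, 3, 10], [1, 7, 10], [2, 8, 9], [3, 6, 9], [4, 5, 10], [3, 8, 10], [4, 7, 9], [5, 7, 9],
      [6, 8, 10], [5, 7, 10], [6, 8, 9]]
    positions := [⟨0, 0, -3⟩, ⟨1, 6, 10⟩, ⟨-1, -6, 10⟩, ⟨1, 2, -1⟩, ⟨-1, -2, -1⟩, ⟨-10, -12, 11⟩,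
      ⟨10, 12, 11⟩, ⟨9, -10, -11⟩, ⟨-9, 10, -11⟩, ⟨-4, 0, 2⟩, ⟨4, 0, 2⟩]
    normals := [⟨2, -3, -5⟩, ⟨6, 1, -5⟩, ⟨66, -13, 35⟩, ⟨1, -2, 1⟩, ⟨3, -2, -1⟩, ⟨1, 19, 14⟩,
      ⟨3, -2, 3⟩, ⟨1, -2, -1⟩, ⟨3, 2, 1⟩, ⟨-23, -4, -20⟩, ⟨-198, -31, 174⟩, ⟨-290, 47, 147⟩,
      ⟨8, 38, -39⟩, ⟨5, -2, 2⟩, ⟨-1, -19, 14⟩, ⟨4, -4, 3⟩, ⟨-1, 29, 21⟩, ⟨-4, -20, -21⟩,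
      ⟨1, -28, 20⟩, ⟨2, -1, -2⟩, ⟨3, -1, 0⟩, ⟨1, 3, 2⟩, ⟨-26, 4, -13⟩, ⟨1, 3, -2⟩, ⟨-6, -1, -5⟩,
      ⟨-15, 7, 11⟩, ⟨26, -4, -13⟩, ⟨150, -241, 88⟩, ⟨3, 2, -1⟩, ⟨-1, 1, 13⟩, ⟨1, -1, 13⟩,
      ⟨-26, -4, 23⟩, ⟨26, 4, 23⟩, ⟨198, 31, 174⟩, ⟨-150, 241, 88⟩, ⟨290, -47, 147⟩, ⟨1, 1, -1⟩,
      ⟨0, 15, -11⟩, ⟨18, -8, 13⟩, ⟨-18, 8, 13⟩, ⟨23, 4, -20⟩, ⟨-8, -38, -39⟩, ⟨158, -253, 92⟩,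
      ⟨-158, 253, 92⟩] },
  { links := [[1, 7, 6, 9, 3, 2, 8, 5, 10, 4], [0, 4, 9, 6, 10, 8, 2, 7],
      [0, 3, 10, 5, 9, 7, 1, 8], [0, 9, 5, 4, 6, 8, 7, 10, 2], [0, 10, 6, 3, 5, 7, 8, 9, 1],
      [0, 8, 6, 7, 4, 3, 9, 2, 10], [0, 7, 5, 8, 3, 4, 10, 1, 9], [0, 1, 2, 9, 10, 3, 8, 4, 5, 6],
      [0, 2, 1, 10, 9, 4, 7, 3, 6, 5], [0, 6, 1, 4, 8, 10, 7, 2, 5, 3],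
      [0, 5, 2, 3, 7, 9, 8, 1, 6, 4]]
    triangles := [[1, 2, 7], [1, 2, 8], [3, 4, 5], [3, 4, 6], [5, 6, 7], [5, 6, 8], [3, 7, 8],
      [4, 7, 8], [7, 9, 10], [8, 9, 10], [0, 1, 7], [0, 2, 8], [1, 4, 9], [2, 3, 10], [1, 6, 9],
      [2, 5, 10], [0, 1, 4], [0, 2, 3], [1, 6, 10], [2, 5, 9], [1, 8, 10], [2, 7, 9], [3, 7, 10],
      [4, 8, 9], [3, 6, 8], [4, 5, 7], [0, 5, 8], [0, 6, 7], [0, 5, 10], [0, 6, 9], [0, 3, 9],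
      [0, 4, 10], [3, 5, 9], [4, 6, 10]]
    positions := [⟨0, 0, 4⟩, ⟨-2, 5, 5⟩, ⟨2, -5, 5⟩, ⟨-2, -2, -5⟩, ⟨2, 2, -5⟩, ⟨-3, -5, -6⟩,
      ⟨3, 5, -6⟩, ⟨5, -1, -4⟩, ⟨-5, 1, -4⟩, ⟨2, 0, -2⟩, ⟨-2, 0, -2⟩]
    normals := [⟨1, 4, 0⟩, ⟨3, -2, -4⟩, ⟨3, -2, 4⟩, ⟨2, -3, 0⟩, ⟨1, 2, -4⟩, ⟨1, 2, 4⟩, ⟨6, 2, 3⟩,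
      ⟨-6, -2, 3⟩, ⟨3, 4, -2⟩, ⟨3, 4, 2⟩, ⟨4, -3, 0⟩, ⟨-1, -8, 0⟩, ⟨-1, 28, -18⟩, ⟨1, -28, -18⟩,
      ⟨0, 1, -4⟩, ⟨5, -2, -5⟩, ⟨5, -2, 5⟩, ⟨4, 0, -1⟩, ⟨4, 0, 1⟩, ⟨0, 1, 4⟩, ⟨1, 0, -5⟩,
      ⟨1, 0, 5⟩, ⟨12, 5, 6⟩, ⟨-12, -5, 6⟩, ⟨1, 1, -2⟩, ⟨1, 1, 2⟩, ⟨-1, 22, -13⟩, ⟨1, -22, -13⟩,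
      ⟨24, 9, 7⟩, ⟨-24, -9, 7⟩, ⟨2, -1, -1⟩, ⟨2, -1, 1⟩, ⟨1, 2, -2⟩, ⟨1, 2, 2⟩, ⟨5, 1, -2⟩,
      ⟨5, 1, 2⟩, ⟨2, -1, -4⟩, ⟨2, -1, 4⟩, ⟨1, -1, -5⟩, ⟨1, -1, 5⟩, ⟨-9, -2, -4⟩, ⟨9, 2, -4⟩,
      ⟨9, 4, 5⟩, ⟨-9, -4, 5⟩] },
  { links := [[1, 7, 4, 9, 5, 2, 8, 3, 10, 6], [0, 6, 9, 4, 10, 8, 2, 7],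
      [0, 5, 10, 3, 9, 7, 1, 8], [0, 8, 7, 6, 4, 5, 9, 2, 10], [0, 7, 8, 5, 3, 6, 10, 1, 9],
      [0, 9, 3, 4, 8, 6, 7, 10, 2], [0, 10, 4, 3, 7, 5, 8, 9, 1], [0, 1, 2, 9, 10, 5, 6, 3, 8, 4],
      [0, 2, 1, 10, 9, 6, 5, 4, 7, 3], [0, 4, 1, 6, 8, 10, 7, 2, 3, 5],
      [0, 3, 2, 5, 7, 9, 8, 1, 4, 6]]
    triangles := [[1, 2, 7], [1, 2, 8], [3, 4, 5], [3, 4, 6], [5, 6, 7], [5, 6, 8], [3, 7, 8],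
      [4, 7, 8], [7, 9, 10], [8, 9, 10], [0, 1, 7], [0, 2, 8], [1, 4, 9], [2, 3, 10], [1, 6, 9],
      [2, 5, 10], [0, 1, 6], [0, 2, 5], [1, 4, 10], [2, 3, 9], [1, 8, 10], [2, 7, 9], [3, 6, 7],
      [4, 5, 8], [0, 3, 8], [0, 4, 7], [5, 7, 10], [6, 8, 9], [0, 3, 10], [0, 4, 9], [0, 5, 9],
      [0, 6, 10], [3, 5, 9], [4, 6, 10]]
    positions := [⟨0, 0, 3⟩, ⟨0, -5, 4⟩, ⟨0, 5, 4⟩, ⟨-4, 1, -3⟩, ⟨4, -1, -3⟩, ⟨-1, 0, -2⟩,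
      ⟨1, 0, -2⟩, ⟨4, 5, -4⟩, ⟨-4, -5, -4⟩, ⟨1, 1, -1⟩, ⟨-1, -1, -1⟩]
    normals := [⟨-11, 9, 0⟩, ⟨1, 3, -4⟩, ⟨2, 1, 3⟩, ⟨1, -1, -3⟩, ⟨1, -3, 0⟩, ⟨1, -1, 5⟩,
      ⟨5, -1, -2⟩, ⟨13, -1, 6⟩, ⟨1, -4, 5⟩, ⟨1, 3, 4⟩, ⟨3, 2, -2⟩, ⟨-11, 0, 2⟩, ⟨-1, 5, 9⟩,
      ⟨7, -8, -4⟩, ⟨4, -2, 1⟩, ⟨5, -2, -2⟩, ⟨-1, 6, -13⟩, ⟨3, -4, 3⟩, ⟨-6, 7, -4⟩, ⟨3, 2, 2⟩,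
      ⟨3, 0, 4⟩, ⟨-16, 14, 1⟩, ⟨27, 1, 6⟩, ⟨-40, -5, 26⟩, ⟨2, 1, -3⟩, ⟨3, 2, -1⟩, ⟨1, 0, -4⟩,
      ⟨1, 5, 0⟩, ⟨3, -4, -3⟩, ⟨1, -6, -13⟩, ⟨3, 2, 1⟩, ⟨1, 5, -4⟩, ⟨1, 5, 4⟩, ⟨1, 0, 9⟩,
      ⟨-1, 0, 9⟩, ⟨-13, 1, 6⟩, ⟨32, 4, 21⟩, ⟨0, 1, 3⟩, ⟨1, 5, -1⟩, ⟨1, 5, 1⟩, ⟨0, 3, -7⟩,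
      ⟨11, 0, 2⟩, ⟨71, 8, 46⟩, ⟨-71, -8, 46⟩] },
  { links := [[1, 4, 5, 8, 10, 2, 3, 6, 7, 9], [0, 9, 6, 10, 8, 2, 7, 4],
      [0, 10, 5, 9, 7, 1, 8, 3], [0, 2, 8, 7, 10, 9, 5, 4, 6], [0, 1, 7, 8, 9, 10, 6, 3, 5],
      [0, 4, 3, 9, 2, 10, 7, 6, 8], [0, 3, 4, 10, 1, 9, 8, 5, 7], [0, 6, 5, 10, 3, 8, 4, 1, 2, 9],
      [0, 5, 6, 9, 4, 7, 3, 2, 1, 10], [0, 7, 2, 5, 3, 10, 4, 8, 6, 1],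
      [0, 8, 1, 6, 4, 9, 3, 7, 5, 2]]
    triangles := [[1, 2, 7], [1, 2, 8], [3, 4, 5], [3, 4, 6], [5, 6, 7], [5, 6, 8], [3, 7, 8],
      [4, 7, 8], [3, 9, 10], [4, 9, 10], [1, 4, 7], [2, 3, 8], [0, 1, 9], [0, 2, 10], [1, 6, 9],
      [2, 5, 10], [0, 1, 4], [0, 2, 3], [1, 6, 10], [2, 5, 9], [1, 8, 10], [2, 7, 9], [3, 5, 9],
      [4, 6, 10], [0, 3, 6], [0, 4, 5], [3, 7, 10], [4, 8, 9], [5, 7, 10], [6, 8, 9], [0, 5, 8],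
      [0, 6, 7], [0, 7, 9], [0, 8, 10]]
    positions := [⟨0, 0, 9⟩, ⟨-10, -1, -10⟩, ⟨10, 1, -10⟩, ⟨6, 4, 11⟩, ⟨-6, -4, 11⟩, ⟨12, 10, 6⟩,
      ⟨-12, -10, 6⟩, ⟨7, 6, 0⟩, ⟨-7, -6, 0⟩, ⟨-11, 11, 12⟩, ⟨11, -11, 12⟩]
    normals := [⟨5, 1, 0⟩, ⟨1, -3, -4⟩, ⟨1, -3, 4⟩, ⟨-11, 13, 1⟩, ⟨9, -11, 1⟩, ⟨-3, 35, 19⟩,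
      ⟨-1, -1, -120⟩, ⟨3, -35, 19⟩, ⟨3, 4, -4⟩, ⟨5, -4, -3⟩, ⟨5, -4, 3⟩, ⟨-4, 0, 15⟩, ⟨3, 2, 4⟩,
      ⟨27, 9, -4⟩, ⟨26, -30, 3⟩, ⟨1, -4, 2⟩, ⟨-11, 16, 5⟩, ⟨-28, -9, -4⟩, ⟨8, 0, 29⟩,
      ⟨1, 1, -120⟩, ⟨5, -7, 2⟩, ⟨-25, 29, 3⟩, ⟨1, -3, -1⟩, ⟨11, -13, 0⟩, ⟨-16, 28, -7⟩,
      ⟨16, -28, -7⟩, ⟨-143, 171, -3⟩, ⟨143, -171, -3⟩, ⟨1, 0, 0⟩, ⟨1, 1, 1⟩, ⟨1, 2, 0⟩,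
      ⟨-2, 0, 7⟩, ⟨1, -9, 5⟩, ⟨-1, 9, 5⟩, ⟨-27, -9, -4⟩, ⟨1, -1, -1⟩, ⟨1, -1, 1⟩, ⟨3, -4, 0⟩,
      ⟨3, -32, 17⟩, ⟨-3, 32, 17⟩] },
  { links := [[3, 7, 9, 5, 4, 8, 10, 6], [2, 3, 6, 8, 7, 10, 5, 9, 4],
      [1, 4, 5, 7, 8, 9, 6, 10, 3], [0, 6, 1, 2, 10, 9, 8, 4, 7], [0, 5, 2, 1, 9, 10, 7, 3, 8],
      [0, 9, 1, 10, 8, 6, 7, 2, 4], [0, 10, 2, 9, 7, 5, 8, 1, 3], [0, 3, 4, 10, 1, 8, 2, 5, 6, 9],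
      [0, 4, 3, 9, 2, 7, 1, 6, 5, 10], [0, 7, 6, 2, 8, 3, 10, 4, 1, 5],
      [0, 8, 5, 1, 7, 4, 9, 3, 2, 6]]
    triangles := [[3, 4, 7], [3, 4, 8], [5, 6, 7], [5, 6, 8], [1, 2, 3], [1, 2, 4], [1, 7, 8],
      [2, 7, 8], [3, 9, 10], [4, 9, 10], [0, 3, 6], [0, 4, 5], [0, 3, 7], [0, 4, 8], [0, 5, 9],
      [0, 6, 10], [0, 7, 9], [0, 8, 10], [1, 3, 6], [2, 4, 5], [3, 8, 9], [4, 7, 10], [1, 4, 9],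
      [2, 3, 10], [1, 5, 9], [2, 6, 10], [1, 6, 8], [2, 5, 7], [1, 5, 10], [2, 6, 9], [1, 7, 10],
      [2, 8, 9], [5, 8, 10], [6, 7, 9]]
    positions := [⟨0, 0, 7⟩, ⟨-8, 4, -8⟩, ⟨8, -4, -8⟩, ⟨7, 6, 6⟩, ⟨-7, -6, 6⟩, ⟨-5, -2, -1⟩,
      ⟨5, 2, -1⟩, ⟨-3, 0, -2⟩, ⟨3, 0, -2⟩, ⟨0, 8, 8⟩, ⟨0, -8, 8⟩]
    normals := [⟨2, 5, -3⟩, ⟨-5, -10, -7⟩, ⟨5, -3, 0⟩, ⟨-3, 7, -7⟩, ⟨3, -7, -7⟩, ⟨4, 2, -1⟩,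
      ⟨1, 0, -4⟩, ⟨1, -21, 16⟩, ⟨5, -2, 4⟩, ⟨5, -2, 0⟩, ⟨1, 23, 18⟩, ⟨1, -3, 0⟩, ⟨5, -2, -4⟩,
      ⟨1, 3, 0⟩, ⟨3, 5, -5⟩, ⟨1, 0, 4⟩, ⟨1, -5, -4⟩, ⟨35, -39, 12⟩, ⟨-35, 39, 12⟩, ⟨9, 17, -12⟩,
      ⟨2, 5, 3⟩, ⟨-1, -23, 18⟩, ⟨2, 3, 0⟩, ⟨1, -5, 4⟩, ⟨-1, 13, 9⟩, ⟨1, -2, -5⟩, ⟨-17, 20, -6⟩,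
      ⟨17, -20, -6⟩, ⟨2, -2, 1⟩, ⟨1, -2, 5⟩, ⟨4, -4, -5⟩, ⟨4, -4, 5⟩, ⟨3, -1, 9⟩, ⟨-3, 1, 9⟩,
      ⟨5, 1, 9⟩, ⟨-5, -1, 9⟩, ⟨-7, -15, 10⟩, ⟨7, 15, 10⟩, ⟨-9, -17, -12⟩, ⟨2, -2, -1⟩,
      ⟨3, -1, -1⟩, ⟨3, -1, 1⟩, ⟨2, 3, 3⟩, ⟨-7, 1, 4⟩, ⟨7, -1, 4⟩, ⟨5, 10, -7⟩] },
  { links := [[3, 6, 10, 8, 4, 5, 9, 7], [2, 8, 6, 3, 4, 9, 5, 10, 7],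
      [1, 7, 5, 4, 3, 10, 6, 9, 8], [0, 7, 8, 9, 10, 2, 4, 1, 6], [0, 8, 7, 10, 9, 1, 3, 2, 5],
      [0, 4, 2, 7, 6, 8, 10, 1, 9], [0, 3, 1, 8, 5, 7, 9, 2, 10], [0, 9, 6, 5, 2, 1, 10, 4, 8, 3],
      [0, 10, 5, 6, 1, 2, 9, 3, 7, 4], [0, 5, 1, 4, 10, 3, 8, 2, 6, 7],
      [0, 6, 2, 3, 9, 4, 7, 1, 5, 8]]
    triangles := [[1, 3, 4], [2, 3, 4], [5, 6, 7], [5, 6, 8], [1, 2, 7], [1, 2, 8], [3, 7, 8],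
      [4, 7, 8], [3, 9, 10], [4, 9, 10], [0, 3, 6], [0, 4, 5], [0, 3, 7], [0, 4, 8], [0, 5, 9],
      [0, 6, 10], [0, 7, 9], [0, 8, 10], [1, 3, 6], [2, 4, 5], [3, 8, 9], [4, 7, 10], [1, 4, 9],
      [2, 3, 10], [1, 5, 9], [2, 6, 10], [1, 6, 8], [2, 5, 7], [1, 5, 10], [2, 6, 9], [1, 7, 10],
      [2, 8, 9], [5, 8, 10], [6, 7, 9]]
    positions := [⟨0, 0, -2⟩, ⟨-7, -3, 7⟩, ⟨7, 3, 7⟩, ⟨1, -7, -7⟩, ⟨-1, 7, -7⟩, ⟨-6, 2, 4⟩,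
      ⟨6, -2, 4⟩, ⟨-3, -1, 3⟩, ⟨3, 1, 3⟩, ⟨-1, -5, -3⟩, ⟨1, 5, -3⟩]
    normals := [⟨1, -4, -2⟩, ⟨1, -4, 2⟩, ⟨-18, -3, -10⟩, ⟨1, 0, -2⟩, ⟨-40, -7, 22⟩, ⟨1, 0, 2⟩,
      ⟨2, -1, 0⟩, ⟨-27, 5, -14⟩, ⟨-15, 4, 9⟩, ⟨0, 1, -4⟩, ⟨31, 22, 24⟩, ⟨3, 1, -3⟩, ⟨-7, 19, -14⟩,
      ⟨-29, -20, 22⟩, ⟨3, 1, 3⟩, ⟨1, 2, 2⟩, ⟨1, -11, 4⟩, ⟨7, -19, -14⟩, ⟨-1, 11, 4⟩, ⟨1, 2, -2⟩,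
      ⟨4, 2, 3⟩, ⟨12, -4, 7⟩, ⟨1, 16, -10⟩, ⟨-1, -16, -10⟩, ⟨-8, -1, -4⟩, ⟨8, 1, -4⟩, ⟨-5, 12, 0⟩,
      ⟨-12, 4, 7⟩, ⟨-7, -20, -38⟩, ⟨7, 20, -38⟩, ⟨0, 1, 4⟩, ⟨4, 2, -3⟩, ⟨3, -5, -3⟩, ⟨3, -5, 3⟩,
      ⟨16, 9, 20⟩, ⟨-16, -9, 20⟩, ⟨22, 13, 28⟩, ⟨-22, -13, 28⟩, ⟨0, 1, 0⟩, ⟨7, -2, 4⟩, ⟨-7, 2, 4⟩,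
      ⟨18, 3, -10⟩, ⟨-19, -3, -10⟩] },
  { links := [[1, 9, 8, 4, 5, 2, 10, 7, 3, 6], [0, 6, 10, 8, 2, 7, 4, 9],
      [0, 5, 9, 7, 1, 8, 3, 10], [0, 7, 9, 10, 2, 8, 5, 4, 6], [0, 8, 10, 9, 1, 7, 6, 3, 5],
      [0, 4, 3, 8, 7, 10, 6, 9, 2], [0, 3, 4, 7, 8, 9, 5, 10, 1], [0, 10, 5, 8, 6, 4, 1, 2, 9, 3],
      [0, 9, 6, 7, 5, 3, 2, 1, 10, 4], [0, 1, 4, 10, 3, 7, 2, 5, 6, 8],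
      [0, 2, 3, 9, 4, 8, 1, 6, 5, 7]]
    triangles := [[1, 2, 7], [1, 2, 8], [3, 4, 5], [3, 4, 6], [5, 6, 9], [5, 6, 10], [5, 7, 8],
      [6, 7, 8], [3, 9, 10], [4, 9, 10], [1, 4, 7], [2, 3, 8], [0, 1, 9], [0, 2, 10], [1, 4, 9],
      [2, 3, 10], [0, 1, 6], [0, 2, 5], [1, 6, 10], [2, 5, 9], [1, 8, 10], [2, 7, 9], [3, 5, 8],
      [4, 6, 7], [0, 3, 6], [0, 4, 5], [5, 7, 10], [6, 8, 9], [0, 7, 10], [0, 8, 9], [0, 3, 7],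
      [0, 4, 8], [3, 7, 9], [4, 8, 10]]
    positions := [⟨0, 0, 7⟩, ⟨-5, -3, -6⟩, ⟨5, 3, -6⟩, ⟨1, 7, -8⟩, ⟨-1, -7, -8⟩, ⟨7, -4, -4⟩,
      ⟨-7, 4, -4⟩, ⟨-2, 5, -5⟩, ⟨2, -5, -5⟩, ⟨3, -2, 0⟩, ⟨-3, 2, 0⟩]
    normals := [⟨5, 1, -2⟩, ⟨5, 3, 3⟩, ⟨11, 18, -1⟩, ⟨2, -13, -6⟩, ⟨8, -7, 31⟩, ⟨-2, 15, -7⟩,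
      ⟨-8, 7, 31⟩, ⟨3, 5, 1⟩, ⟨0, 1, -10⟩, ⟨3, 2, -3⟩, ⟨4, -1, 3⟩, ⟨-5, -6, 4⟩, ⟨-7, -11, -11⟩,
      ⟨0, -1, -10⟩, ⟨1, -2, 0⟩, ⟨4, -1, -3⟩, ⟨-9, -15, 14⟩, ⟨4, 0, 1⟩, ⟨2, -15, -7⟩,
      ⟨-5, -12, -12⟩, ⟨5, 12, -12⟩, ⟨1, 1, 2⟩, ⟨5, 6, 4⟩, ⟨3, 7, -6⟩, ⟨-2, 10, -5⟩, ⟨-3, -7, -6⟩,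
      ⟨-7, -12, 0⟩, ⟨1, 1, -2⟩, ⟨0, 1, -3⟩, ⟨0, 1, 3⟩, ⟨0, 3, -1⟩, ⟨0, 3, 1⟩, ⟨3, 2, 3⟩,
      ⟨2, -6, -3⟩, ⟨-2, 6, -3⟩, ⟨4, 5, -4⟩, ⟨4, 5, 4⟩, ⟨2, -10, -5⟩, ⟨1, 0, -3⟩, ⟨1, 0, 3⟩,
      ⟨4, 1, -2⟩, ⟨4, 1, 2⟩, ⟨-2, 13, -6⟩, ⟨3, -20, -9⟩, ⟨-3, 20, -9⟩, ⟨9, 15, 14⟩] },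
  { links := [[1, 7, 10, 6, 3, 2, 8, 9, 5, 4], [0, 4, 9, 6, 10, 8, 2, 7],
      [0, 3, 10, 5, 9, 7, 1, 8], [0, 6, 4, 5, 8, 7, 9, 10, 2], [0, 5, 3, 6, 7, 8, 10, 9, 1],
      [0, 9, 2, 10, 7, 6, 8, 3, 4], [0, 10, 1, 9, 8, 5, 7, 4, 3], [0, 1, 2, 9, 3, 8, 4, 6, 5, 10],
      [0, 2, 1, 10, 4, 7, 3, 5, 6, 9], [0, 8, 6, 1, 4, 10, 3, 7, 2, 5],
      [0, 7, 5, 2, 3, 9, 4, 8, 1, 6]]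
    triangles := [[1, 2, 7], [1, 2, 8], [3, 4, 5], [3, 4, 6], [5, 6, 7], [5, 6, 8], [3, 7, 8],
      [4, 7, 8], [3, 9, 10], [4, 9, 10], [0, 1, 7], [0, 2, 8], [1, 4, 9], [2, 3, 10], [1, 6, 9],
      [2, 5, 10], [0, 1, 4], [0, 2, 3], [1, 6, 10], [2, 5, 9], [1, 8, 10], [2, 7, 9], [3, 5, 8],
      [4, 6, 7], [0, 3, 6], [0, 4, 5], [3, 7, 9], [4, 8, 10], [0, 5, 9], [0, 6, 10], [0, 7, 10],
      [0, 8, 9], [5, 7, 10], [6, 8, 9]]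
    positions := [⟨0, 0, -7⟩, ⟨-2, 2, 0⟩, ⟨2, -2, 0⟩, ⟨7, 8, 7⟩, ⟨-7, -8, 7⟩, ⟨7, -4, 6⟩,
      ⟨-7, 4, 6⟩, ⟨3, -2, 5⟩, ⟨-3, 2, 5⟩, ⟨-3, -4, 3⟩, ⟨3, 4, 3⟩]
    normals := [⟨1, 0, 11⟩, ⟨-16, 1, -4⟩, ⟨5, -4, 0⟩, ⟨1, -1, -5⟩, ⟨2, -13, 5⟩, ⟨-1, -1, 6⟩,
      ⟨-2, 13, 5⟩, ⟨3, 2, 15⟩, ⟨3, -2, -4⟩, ⟨1, -3, 5⟩, ⟨3, -2, 5⟩, ⟨1, 2, 4⟩, ⟨1, 3, 0⟩,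
      ⟨2, -9, 4⟩, ⟨-2, 9, 4⟩, ⟨2, 1, -1⟩, ⟨2, 0, 5⟩, ⟨15, -1, -4⟩, ⟨4, 1, 4⟩, ⟨-1, 0, 6⟩,
      ⟨2, -1, -4⟩, ⟨1, -4, -4⟩, ⟨2, -5, 2⟩, ⟨4, 1, -4⟩, ⟨-1, 9, 3⟩, ⟨1, -9, 3⟩, ⟨2, 1, 1⟩,
      ⟨3, -3, -1⟩, ⟨3, 4, 0⟩, ⟨3, 5, -1⟩, ⟨14, 16, 1⟩, ⟨-14, -16, 1⟩, ⟨1, -1, 4⟩, ⟨2, -5, -2⟩,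
      ⟨-7, 1, -2⟩, ⟨1, 0, 16⟩, ⟨-1, 0, 16⟩, ⟨3, 2, 19⟩, ⟨1, -1, 1⟩, ⟨0, 1, -3⟩, ⟨3, -1, -1⟩,
      ⟨3, -1, 1⟩, ⟨1, 2, -3⟩, ⟨3, 5, 1⟩, ⟨7, -1, -2⟩, ⟨2, 1, -10⟩, ⟨-1, 10, 4⟩, ⟨1, -10, 4⟩] },
  { links := [[3, 7, 5, 10, 4, 8, 6, 9], [2, 8, 3, 6, 10, 5, 4, 9, 7],
      [1, 7, 4, 5, 9, 6, 3, 10, 8], [0, 9, 10, 2, 6, 1, 8, 4, 7], [0, 10, 9, 1, 5, 2, 7, 3, 8],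
      [0, 7, 6, 8, 9, 2, 4, 1, 10], [0, 8, 5, 7, 10, 1, 3, 2, 9], [0, 3, 4, 2, 1, 9, 8, 10, 6, 5],
      [0, 4, 3, 1, 2, 10, 7, 9, 5, 6], [0, 6, 2, 5, 8, 7, 1, 4, 10, 3],
      [0, 5, 1, 6, 7, 8, 2, 3, 9, 4]]
    triangles := [[3, 4, 7], [3, 4, 8], [5, 6, 7], [5, 6, 8], [1, 2, 7], [1, 2, 8], [7, 8, 9],
      [7, 8, 10], [3, 9, 10], [4, 9, 10], [0, 3, 7], [0, 4, 8], [0, 3, 9], [0, 4, 10], [1, 3, 6],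
      [2, 4, 5], [1, 3, 8], [2, 4, 7], [1, 4, 5], [2, 3, 6], [1, 4, 9], [2, 3, 10], [1, 5, 10],
      [2, 6, 9], [1, 7, 9], [2, 8, 10], [1, 6, 10], [2, 5, 9], [0, 5, 7], [0, 6, 8], [5, 8, 9],
      [6, 7, 10], [0, 5, 10], [0, 6, 9]]
    positions := [⟨0, 0, 3⟩, ⟨2, 2, 6⟩, ⟨-2, -2, 6⟩, ⟨-2, -4, 2⟩, ⟨2, 4, 2⟩, ⟨-6, -3, -3⟩,
      ⟨6, 3, -3⟩, ⟨-8, 1, -11⟩, ⟨8, -1, -11⟩, ⟨-11, -10, 11⟩, ⟨11, 10, 11⟩]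
    normals := [⟨-16, 11, -9⟩, ⟨16, -11, -9⟩, ⟨-11, 12, 0⟩, ⟨0, 5, -2⟩, ⟨0, 2, 3⟩, ⟨0, 5, 2⟩,
      ⟨-23, 21, 8⟩, ⟨-16, 21, -9⟩, ⟨11, -7, -7⟩, ⟨-12, 7, -8⟩, ⟨11, -15, -3⟩, ⟨73, -63, 30⟩,
      ⟨-20, 27, -6⟩, ⟨1, 2, -2⟩, ⟨17, -13, -8⟩, ⟨7, -9, -4⟩, ⟨-2, -13, 7⟩, ⟨2, 13, 7⟩, ⟨2, -5, 5⟩,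
      ⟨0, 1, 0⟩, ⟨1, 2, 2⟩, ⟨21, -15, 13⟩, ⟨-6, 8, 3⟩, ⟨-17, 13, -8⟩, ⟨-21, 15, 13⟩,
      ⟨-17, 34, 21⟩, ⟨17, -34, 21⟩, ⟨-36, 31, 15⟩, ⟨12, -13, 3⟩, ⟨1, 0, 0⟩, ⟨6, -8, 3⟩,
      ⟨13, -6, -8⟩, ⟨-13, 6, -8⟩, ⟨34, -35, -18⟩, ⟨64, -65, 34⟩, ⟨2, 1, -2⟩, ⟨2, 1, 2⟩,
      ⟨1, 10, 5⟩, ⟨-1, -10, 5⟩, ⟨-12, 13, 3⟩, ⟨25, -33, -7⟩, ⟨-25, 33, -7⟩, ⟨2, -3, -2⟩,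
      ⟨3, -5, -2⟩, ⟨3, -5, 2⟩, ⟨5, -5, 2⟩, ⟨11, -10, 4⟩, ⟨-2, -15, -8⟩, ⟨2, 15, -8⟩,
      ⟨16, -21, -9⟩, ⟨-26, 22, 11⟩, ⟨-64, 65, 34⟩] },
  { links := [[1, 5, 10, 3, 7, 2, 6, 9, 4, 8], [0, 8, 9, 10, 4, 7, 6, 2, 5],
      [0, 7, 10, 9, 3, 8, 5, 1, 6], [0, 10, 8, 2, 9, 5, 4, 6, 7], [0, 9, 7, 1, 10, 6, 3, 5, 8],
      [0, 1, 2, 8, 4, 3, 9, 6, 10], [0, 2, 1, 7, 3, 4, 10, 5, 9], [0, 3, 6, 1, 4, 9, 8, 10, 2],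
      [0, 4, 5, 2, 3, 10, 7, 9, 1], [0, 6, 5, 3, 2, 10, 1, 8, 7, 4],
      [0, 5, 6, 4, 1, 9, 2, 7, 8, 3]]
    triangles := [[1, 2, 5], [1, 2, 6], [3, 4, 5], [3, 4, 6], [5, 6, 9], [5, 6, 10], [7, 8, 9],
      [7, 8, 10], [1, 9, 10], [2, 9, 10], [0, 1, 5], [0, 2, 6], [0, 1, 8], [0, 2, 7], [1, 8, 9],
      [2, 7, 10], [1, 4, 7], [2, 3, 8], [1, 6, 7], [2, 5, 8], [1, 4, 10], [2, 3, 9], [0, 3, 7],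
      [0, 4, 8], [3, 6, 7], [4, 5, 8], [3, 8, 10], [4, 7, 9], [3, 5, 9], [4, 6, 10], [0, 3, 10],
      [0, 4, 9], [0, 5, 10], [0, 6, 9]]
    positions := [⟨0, 0, -3⟩, ⟨2, -2, -2⟩, ⟨-2, 2, -2⟩, ⟨-3, 2, -6⟩, ⟨3, -2, -6⟩, ⟨1, 5, 7⟩,
      ⟨-1, -5, 7⟩, ⟨-5, 1, 1⟩, ⟨5, -1, 1⟩, ⟨-6, 1, 6⟩, ⟨6, -1, 6⟩]
    normals := [⟨5, 7, -3⟩, ⟨-2, 7, 0⟩, ⟨-5, -7, -3⟩, ⟨4, -1, -4⟩, ⟨1, 3, 0⟩, ⟨4, -1, 4⟩,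
      ⟨-19, -16, 10⟩, ⟨19, 16, 10⟩, ⟨2, 1, 0⟩, ⟨2, 5, -2⟩, ⟨2, 5, 2⟩, ⟨4, -5, 0⟩, ⟨-26, -39, 22⟩,
      ⟨26, 39, 22⟩, ⟨1, -5, 0⟩, ⟨2, -5, 0⟩, ⟨-1, 0, 10⟩, ⟨-3, -16, 0⟩, ⟨1, 4, 3⟩, ⟨1, 5, -3⟩,
      ⟨19, 18, 12⟩, ⟨-19, -18, 12⟩, ⟨-6, -28, 1⟩, ⟨6, 28, 1⟩, ⟨-14, -30, -3⟩, ⟨4, 5, -2⟩,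
      ⟨4, 5, 2⟩, ⟨0, 2, 1⟩, ⟨2, 0, -1⟩, ⟨2, 0, 1⟩, ⟨1, 5, -1⟩, ⟨1, 5, 1⟩, ⟨2, 5, -1⟩, ⟨2, 5, 1⟩,
      ⟨1, 0, 10⟩, ⟨14, 30, -3⟩, ⟨28, 27, -18⟩, ⟨-28, -27, -18⟩, ⟨4, 5, -4⟩, ⟨4, 5, 4⟩, ⟨4, 6, -3⟩,
      ⟨-4, -6, -3⟩, ⟨1, 9, -2⟩, ⟨-1, -9, -2⟩, ⟨-9, -8, 5⟩, ⟨9, 8, 5⟩, ⟨-21, -44, -5⟩,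
      ⟨21, 44, -5⟩] },
  { links := [[1, 8, 4, 5, 10, 2, 7, 3, 6, 9], [0, 9, 7, 4, 10, 6, 2, 5, 8],
      [0, 10, 8, 3, 9, 5, 1, 6, 7], [0, 7, 10, 4, 9, 2, 8, 5, 6], [0, 8, 9, 3, 10, 1, 7, 6, 5],
      [0, 4, 6, 3, 8, 1, 2, 9, 10], [0, 3, 5, 4, 7, 2, 1, 10, 9], [0, 2, 6, 4, 1, 9, 8, 10, 3],
      [0, 1, 5, 3, 2, 10, 7, 9, 4], [0, 6, 10, 5, 2, 3, 4, 8, 7, 1],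
      [0, 5, 9, 6, 1, 4, 3, 7, 8, 2]]
    triangles := [[1, 2, 5], [1, 2, 6], [3, 4, 9], [3, 4, 10], [3, 5, 6], [4, 5, 6], [7, 8, 9],
      [7, 8, 10], [5, 9, 10], [6, 9, 10], [1, 5, 8], [2, 6, 7], [0, 1, 8], [0, 2, 7], [0, 1, 9],
      [0, 2, 10], [1, 7, 9], [2, 8, 10], [1, 4, 7], [2, 3, 8], [1, 4, 10], [2, 3, 9], [1, 6, 10],
      [2, 5, 9], [0, 3, 6], [0, 4, 5], [0, 3, 7], [0, 4, 8], [0, 5, 10], [0, 6, 9], [3, 5, 8],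
      [4, 6, 7], [3, 7, 10], [4, 8, 9]]
    positions := [⟨0, 0, -5⟩, ⟨-7, 6, -7⟩, ⟨7, -6, -7⟩, ⟨0, -1, -4⟩, ⟨0, 1, -4⟩, ⟨2, -2, -6⟩,
      ⟨-2, 2, -6⟩, ⟨7, 6, 8⟩, ⟨-7, -6, 8⟩, ⟨-4, 1, 6⟩, ⟨4, -1, 6⟩]
    normals := [⟨1, 3, 0⟩, ⟨0, 1, -5⟩, ⟨3, 4, 0⟩, ⟨23, -8, -9⟩, ⟨-26, -28, -13⟩, ⟨-23, 8, -9⟩,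
      ⟨-20, -21, 11⟩, ⟨1, -5, -2⟩, ⟨1, -5, 2⟩, ⟨12, -3, 5⟩, ⟨-20, 4, 9⟩, ⟨1, -2, -5⟩,
      ⟨-17, -29, 27⟩, ⟨15, 19, 4⟩, ⟨-7, -12, -11⟩, ⟨-10, -12, 3⟩, ⟨-6, -5, -3⟩, ⟨-29, -30, -29⟩,
      ⟨2, 3, 0⟩, ⟨4, -5, 3⟩, ⟨11, 9, -10⟩, ⟨-7, -23, -3⟩, ⟨7, 23, -3⟩, ⟨-119, 38, -47⟩,
      ⟨119, -38, -47⟩, ⟨0, 2, -1⟩, ⟨-5, -6, 0⟩, ⟨6, 5, -3⟩, ⟨10, 12, 3⟩, ⟨1, -1, -1⟩, ⟨0, 1, 4⟩,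
      ⟨4, 5, -5⟩, ⟨1, -1, 0⟩, ⟨2, 1, 0⟩, ⟨2, -2, -1⟩, ⟨-7, 2, 3⟩, ⟨7, 8, -1⟩, ⟨-11, -9, -10⟩,
      ⟨13, 17, 2⟩, ⟨-13, -17, 2⟩, ⟨-15, -19, 4⟩] },
  { links := [[1, 5, 10, 3, 8, 2, 6, 9, 4, 7], [0, 7, 8, 9, 10, 4, 6, 2, 5],
      [0, 8, 7, 10, 9, 3, 5, 1, 6], [0, 10, 6, 5, 2, 9, 7, 4, 8], [0, 9, 5, 6, 1, 10, 8, 3, 7],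
      [0, 1, 2, 3, 6, 4, 9, 8, 10], [0, 2, 1, 4, 5, 3, 10, 7, 9], [0, 4, 3, 9, 6, 10, 2, 8, 1],
      [0, 3, 4, 10, 5, 9, 1, 7, 2], [0, 6, 7, 3, 2, 10, 1, 8, 5, 4],
      [0, 5, 8, 4, 1, 9, 2, 7, 6, 3]]
    triangles := [[1, 2, 5], [1, 2, 6], [3, 4, 7], [3, 4, 8], [3, 5, 6], [4, 5, 6], [1, 7, 8],
      [2, 7, 8], [1, 9, 10], [2, 9, 10], [0, 1, 5], [0, 2, 6], [1, 8, 9], [2, 7, 10], [0, 1, 7],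
      [0, 2, 8], [1, 4, 6], [2, 3, 5], [1, 4, 10], [2, 3, 9], [0, 3, 8], [0, 4, 7], [3, 7, 9],
      [4, 8, 10], [5, 8, 10], [6, 7, 9], [5, 8, 9], [6, 7, 10], [0, 5, 10], [0, 6, 9], [0, 3, 10],
      [0, 4, 9], [3, 6, 10], [4, 5, 9]]
    positions := [⟨0, 0, -6⟩, ⟨-4, -3, -2⟩, ⟨4, 3, -2⟩, ⟨6, -3, 7⟩, ⟨-6, 3, 7⟩, ⟨-1, -1, -1⟩,
      ⟨1, 1, -1⟩, ⟨2, 7, -7⟩, ⟨-2, -7, -7⟩, ⟨-1, 2, 3⟩, ⟨1, -2, 3⟩]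
    normals := [⟨-8, 2, -5⟩, ⟨8, -2, -5⟩, ⟨2, 3, 0⟩, ⟨-10, 13, 1⟩, ⟨14, 37, -22⟩, ⟨-14, -37, -22⟩,
      ⟨3, -4, 2⟩, ⟨4, -1, 0⟩, ⟨1, -2, -4⟩, ⟨-2, 6, -5⟩, ⟨2, -6, -5⟩, ⟨3, 2, -2⟩, ⟨4, -5, -4⟩,
      ⟨2, 1, 1⟩, ⟨-5, 8, -7⟩, ⟨8, -11, 1⟩, ⟨28, -69, -52⟩, ⟨-8, -2, 3⟩, ⟨2, -1, -1⟩, ⟨1, 3, -1⟩,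
      ⟨1, 3, 1⟩, ⟨2, 2, 3⟩, ⟨2, -3, 3⟩, ⟨3, 5, -3⟩, ⟨3, 5, 3⟩, ⟨-28, 69, -52⟩, ⟨4, -1, -3⟩,
      ⟨8, 2, 3⟩, ⟨-1, -32, 7⟩, ⟨2, 0, 1⟩, ⟨1, 2, -2⟩, ⟨2, -4, -3⟩, ⟨2, -4, 3⟩, ⟨-9, 3, -5⟩,
      ⟨9, -3, -5⟩, ⟨5, -8, -7⟩, ⟨1, 23, 5⟩, ⟨-1, -23, 5⟩, ⟨1, 32, 7⟩, ⟨2, 0, -1⟩, ⟨1, -2, -1⟩,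
      ⟨4, -1, 3⟩, ⟨4, 8, 5⟩, ⟨-4, -8, 5⟩, ⟨-8, 11, 1⟩] },
  { links := [[1, 7, 6, 4, 9, 2, 8, 5, 3, 10], [0, 10, 6, 2, 5, 8, 9, 4, 7],
      [0, 9, 5, 1, 6, 7, 10, 3, 8], [0, 5, 6, 9, 7, 4, 8, 2, 10], [0, 6, 5, 10, 8, 3, 7, 1, 9],
      [0, 8, 1, 2, 9, 10, 4, 6, 3], [0, 7, 2, 1, 10, 9, 3, 5, 4], [0, 1, 4, 3, 9, 8, 10, 2, 6],
      [0, 2, 3, 4, 10, 7, 9, 1, 5], [0, 4, 1, 8, 7, 3, 6, 10, 5, 2],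
      [0, 3, 2, 7, 8, 4, 5, 9, 6, 1]]
    triangles := [[1, 2, 5], [1, 2, 6], [3, 4, 7], [3, 4, 8], [3, 5, 6], [4, 5, 6], [7, 8, 9],
      [7, 8, 10], [5, 9, 10], [6, 9, 10], [1, 5, 8], [2, 6, 7], [1, 8, 9], [2, 7, 10], [0, 1, 10],
      [0, 2, 9], [1, 6, 10], [2, 5, 9], [0, 1, 7], [0, 2, 8], [1, 4, 7], [2, 3, 8], [1, 4, 9],
      [2, 3, 10], [0, 3, 5], [0, 4, 6], [0, 3, 10], [0, 4, 9], [0, 5, 8], [0, 6, 7], [3, 6, 9],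
      [4, 5, 10], [3, 7, 9], [4, 8, 10]]
    positions := [⟨0, 0, -1⟩, ⟨2, -4, -5⟩, ⟨-2, 4, -5⟩, ⟨1, 0, 2⟩, ⟨-1, 0, 2⟩, ⟨3, 1, 4⟩,
      ⟨-3, -1, 4⟩, ⟨-3, -4, 6⟩, ⟨3, 4, 6⟩, ⟨5, -5, 5⟩, ⟨-5, 5, 5⟩]
    normals := [⟨5, 2, -2⟩, ⟨5, 2, 2⟩, ⟨5, 4, -1⟩, ⟨1, -1, 13⟩, ⟨3, 5, 3⟩, ⟨3, 0, -2⟩, ⟨3, 0, 2⟩,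
      ⟨1, 4, -2⟩, ⟨1, -4, -2⟩, ⟨4, 12, -15⟩, ⟨9, 0, -4⟩, ⟨-9, 0, -4⟩, ⟨1, 4, 5⟩, ⟨1, -4, 2⟩,
      ⟨-4, -11, -14⟩, ⟨1, 4, -5⟩, ⟨5, 4, 1⟩, ⟨-18, -5, 5⟩, ⟨18, 5, 5⟩, ⟨2, 1, -4⟩, ⟨2, 1, 4⟩,
      ⟨-1, 1, 13⟩, ⟨1, 4, 2⟩, ⟨5, 1, -3⟩, ⟨5, 1, 3⟩, ⟨8, 1, -4⟩, ⟨-8, -1, -4⟩, ⟨2, 3, -3⟩,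
      ⟨5, -4, -2⟩, ⟨5, -4, 2⟩, ⟨3, 2, -1⟩, ⟨3, 2, 1⟩, ⟨1, -5, -1⟩, ⟨1, 5, 6⟩, ⟨-1, -5, 6⟩,
      ⟨1, 2, 0⟩, ⟨3, 2, 0⟩, ⟨1, -5, 1⟩, ⟨-13, -3, 4⟩, ⟨13, 3, 4⟩, ⟨-15, -4, 4⟩, ⟨15, 4, 4⟩,
      ⟨3, 10, 13⟩] }]

namespace SurfaceData

/-- The oriented triangles, each listed once for every vertex. -/
def triples (D : SurfaceData) : List (Fin 11 × Fin 11 × Fin 11) :=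
  vertices.flatMap fun v => (cyclicPairs (D.link v)).map (Prod.mk v)

/-- The vertex `v` together with the vertices below it in the direction `n`. -/
def below (p : Fin 11 → IntPoint) (n : IntPoint) (v : Fin 11) : List (Fin 11) :=
  v :: vertices.filter fun w => n.dot (p w) < n.dot (p v)

/-- The decision procedure for `IsAbove`. -/
def checkAbove (p : Fin 11 → IntPoint) (n : IntPoint) (s t : List (Fin 11)) : Bool :=
  s.all fun v => isSubset t (below p n v)

/-- The decision procedure for `AreCompatible`, given normals of separating planes. -/
def checkCompatible (p : Fin 11 → IntPoint) (ns : List IntPoint) (s t : List (Fin 11)) : Bool :=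
  (t.any fun d => isSubset t (d :: s) && isTetrahedron p (d :: s)) ||
    ns.any fun n => checkAbove p n s t || checkAbove p n t s

theorem mem_triples {D : SurfaceData} {t : Fin 11 × Fin 11 × Fin 11} :
    t ∈ D.triples ↔ t.2 ∈ cyclicPairs (D.link t.1) := by
  obtain ⟨a, b, c⟩ := t
  simp [triples, mem_vertices]

theorem isAbove_of_checkAbove {p : Fin 11 → IntPoint} {n : IntPoint} {s t : List (Fin 11)}
    (h : checkAbove p n s t) : IsAbove p n s t := fun v hv w hw => by
  have hw' := subset_of_isSubset (List.all_eq_true.1 h v hv) hw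
  simpa [below, mem_vertices, eq_comm] using hw'

theorem areCompatible_of_checkCompatible {p : Fin 11 → IntPoint} {ns : List IntPoint}
    {s t : List (Fin 11)} (h : checkCompatible p ns s t) : AreCompatible p s t := by
  rw [checkCompatible, Bool.or_eq_true, List.any_eq_true, List.any_eq_true] at h
  refine h.imp (fun ⟨d, _, hd⟩ => ?_) fun ⟨n, _, hn⟩ => ?_
  · rw [Bool.and_eq_true] at hd
    exact ⟨d :: s, List.subset_cons_self d s, subset_of_isSubset hd.1, hd.2⟩
  · exact ⟨n, (Bool.or_eq_true _ _ ▸ hn).imp isAbove_of_checkAbove isAbove_of_checkAbove⟩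

theorem four_le_length_of_mem :
    ∀ D ∈ surfaces, ∀ v ∈ vertices, 4 ≤ (D.link v).length := by
  decide +kernel

theorem nodup_of_mem : ∀ D ∈ surfaces, ∀ v ∈ vertices, (v :: D.link v).Nodup := by
  decide +kernel

theorem rotate_triples_of_mem :
    ∀ D ∈ surfaces, isSubset (D.triples.map fun t => (t.2.1, t.2.2, t.1)) D.triples := by
  decide +kernel

theorem swapPairs_triples_of_mem :
    ∀ D ∈ surfaces,
      isSubset (D.triples.map (Prod.map swapPairs (Prod.map swapPairs swapPairs))) D.triples := by
  decide +kernel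

theorem exists_hub_of_mem :
    ∀ D ∈ surfaces, ∃ o ∈ vertices, ∀ u ∈ vertices, u ≠ o → u ∈ D.link o := by
  decide +kernel

theorem sum_length_of_mem :
    ∀ D ∈ surfaces, (vertices.map fun v => (D.link v).length).sum = 102 := by
  decide +kernel

theorem triples_covered_of_mem :
    ∀ D ∈ surfaces, isSubset D.triples (D.triangles.flatMap fun t => t ×ˢ t ×ˢ t) := by
  decide +kernel

theorem isTetrahedron_of_mem :
    ∀ D ∈ surfaces,
      D.triangles.all fun t => vertices.any fun d => isTetrahedron D.position (d :: t) := by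
  decide +kernel

theorem areCompatible_of_mem :
    ∀ D ∈ surfaces, D.triangles.Pairwise fun s t => checkCompatible D.position D.normals s t := by
  decide +kernel

theorem position_swapPairs_of_mem :
    ∀ D ∈ surfaces, ∀ v ∈ vertices, D.position (swapPairs v) = (D.position v).halfTurn := by
  decide +kernel

theorem nodup_invariant : (surfaces.map invariant).Nodup := by
  decide +kernel

theorem isValid_of_mem {D : SurfaceData} (hD : D ∈ surfaces) : D.IsValid where
  four_le_length v := four_le_length_of_mem D hD v (mem_vertices v)
  nodup v := nodup_of_mem D hD v (mem_vertices v)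
  cyclic v p hp := mem_triples.1 <| subset_of_isSubset (rotate_triples_of_mem D hD) <|
    List.mem_map_of_mem (mem_triples (t := (v, p)).2 hp)
  swapPairs_mem v p hp := mem_triples.1 <| subset_of_isSubset (swapPairs_triples_of_mem D hD) <|
    List.mem_map_of_mem (mem_triples (t := (v, p)).2 hp)
  exists_hub := by simpa [mem_vertices] using exists_hub_of_mem D hD
  sum_length := sum_map_vertices _ ▸ sum_length_of_mem D hD
  exists_triangle := fun v ⟨b, c⟩ hp => by
    have h := subset_of_isSubset (triples_covered_of_mem D hD) (mem_triples (t := (v, b, c)).2 hp)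
    obtain ⟨t, ht, hvt⟩ := List.mem_flatMap.1 h
    exact ⟨t, ht, by simpa using hvt⟩
  areCompatible s hs t ht := by
    refine List.Pairwise.forall_of_forall (fun t ht => ?_)
      ((areCompatible_of_mem D hD).imp areCompatible_of_checkCompatible) hs ht
    obtain ⟨d, -, hd⟩ := List.any_eq_true.1 (List.all_eq_true.1 (isTetrahedron_of_mem D hD) t ht)
    exact .inl ⟨_, List.subset_cons_self d t, List.subset_cons_self d t, hd⟩
  position_swapPairs v := position_swapPairs_of_mem D hD v (mem_vertices v)

end SurfaceData

theorem length_surfaces : surfaces.length = 28 := rfl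

/-- The surfaces, indexed. -/
def surface (i : Fin 28) : SurfaceData := surfaces.get (i.cast length_surfaces.symm)

theorem isValid_surface (i : Fin 28) : (surface i).IsValid :=
  SurfaceData.isValid_of_mem (List.get_mem _ _)

theorem injective_invariant_surface : Function.Injective fun i => (surface i).invariant := by
  intro i j hij
  have hsurface : surface i = surface j :=
    List.inj_on_of_nodup_map SurfaceData.nodup_invariant (List.get_mem _ _) (List.get_mem _ _) hij
  exact Fin.cast_injective _ ((SurfaceData.nodup_invariant.of_map _).injective_get hsurface)

end TriangulatedSurface

end

theorem theorem10 :
    ∃ T : Fin 28 → AbstractSimplicialComplex (Fin 11),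
      (∀ i, TriangulatedSurface.IsVertexMinimalTriangulation (T i) 4) ∧
      (∀ i j, i ≠ j → ¬ TriangulatedSurface.Isomorphic (T i) (T j)) ∧
      ∀ i, ∃ ψ : Fin 11 → TriangulatedSurface.E3,
        TriangulatedSurface.IsPolyhedralEmbedding (T i) ψ ∧
        ∃ R : TriangulatedSurface.E3 ≃ᵃⁱ[ℝ] TriangulatedSurface.E3,
          TriangulatedSurface.IsHalfTurn R ∧
          TriangulatedSurface.IsGeometricSymmetry (T i) ψ R := by
  have hvalid := TriangulatedSurface.isValid_surface
  refine ⟨fun i => (hvalid i).complex, fun i => (hvalid i).isVertexMinimalTriangulation,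
    fun i j hij h => hij (TriangulatedSurface.injective_invariant_surface ?_),
    fun i => ⟨_, (hvalid i).isPolyhedralEmbedding, TriangulatedSurface.halfTurn,
      TriangulatedSurface.isHalfTurn_halfTurn, (hvalid i).isGeometricSymmetry⟩⟩
  simpa only [TriangulatedSurface.SurfaceData.IsValid.triangleInvariant_complex] using
    TriangulatedSurface.triangleInvariant_eq_of_isomorphic h
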